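/- **Setting.** Let $\mathscr I=\mathbb R\times S^2\ni x=(u,\hat r)$ with measure $\epsilon_{\mathscr I}=du\,\epsilon_S$ ($\epsilon_S$ the area form of the unit sphere), fix $\varepsilon>0$, and let $\eth$ be the covariant derivative along $m=(e_1-ie_2)/\sqrt2$ acting on spin-weighted functions. Let $\mathcal E=\eth^2C^\infty(S^2,\mathbb R)$ (purely electric smooth functions of spin weight 2). Let $\mathcal F_0$ be the real vector space of smooth spin-weight-2 functions $f$ on $\mathscr I$ with $\sup|(1+u^2)^{k/2+\varepsilon}\partial_u^k\mathscr D f|<\infty$ for all $k\ge1$ and all words $\mathscr D$ in $\eth,\bar\eth$, and with limits $f_\pm=\lim_{u\to\pm\infty}f\in\mathcal E$; let $\mathcal F_1=\partial_u\mathcal F_0$. The Fréchet topologies are given by the seminorms $\sup|\mathscr D e|$ on $\mathcal E$; $\sup|\mathscr D f_-|$ and $\sup|(1+u^2)^{k/2+\varepsilon}\partial_u^k\mathscr D f|$, $k\ge1$, on $\mathcal F_0$; $\sup|(1+u^2)^{k/2+1/2+\varepsilon}\partial_u^k\mathscr D g|$, $k\ge0$, on $\mathcal F_1$. A bar on a space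 denotes the space of complex conjugates. $(\mathcal F\otimes\mathcal G)^*$ denotes the jointly continuous real-bilinear complex-valued functionals on $\mathcal F\times\mathcal G$. The phase space is $\mathcal P=\mathcal F_0\times\mathcal F_1\ni(\sigma,\bar N)$, with symplectic form $\Omega=\frac1{4\pi}\mathrm{Re}\int\epsilon_{\mathscr I}\,\delta N\,\delta\sigma$ and constraint surface $\mathcal P_K=\{\bar N+\partial_u\sigma=0\}$. The smeared constraints are $K_\varphi=\frac1{4\pi}\mathrm{Re}\int\epsilon_{\mathscr I}\,\bar\varphi(\bar N+\partial_u\sigma)$ with $\varphi\in\mathcal F_0$, $\varphi_\pm=0$. A *proper observable* is a smooth $F:\mathcal P\to\mathbb R$ with smooth functional derivatives $(\frac{\delta F}{\delta\bar\sigma},\frac{\delta F}{\delta N})\in\mathcal F_1\times\mathcal F_0$ that lie, at points of $\mathcal P_K$, in $$\mathcal G_{TE}=\{(\lambda,\alpha)\in\mathcal F_1\times\mathcal F_0:\ \textstyle\int du\,\lambda=\alpha_+-\alpha_-\}.$$ Its tangential extension is $\tilde F=F+K_\varphi$ with $\{\tilde F,K_{\varphi'}\}=0$ on $\mathcal P_K$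 for all $\varphi'$; $\tilde X_F$ is the Hamiltonian vector of $\tilde F$ ($\delta\tilde F=-I_{\tilde X_F}\Omega$). On $\mathcal P_K$ the Dirac bracket is $\{F,G\}_D=-\Omega(\tilde X_F,\tilde X_G)$ and the directional bracket is $\{F;G\}_D=-\tilde X_FG$. These definitions are extended to complex shear-news functions $\int\epsilon_{\mathscr I}(\bar\lambda\sigma+\bar\alpha\bar N+\lambda'\bar\sigma+\alpha'N)$ by extending $\Omega$ and $K$ to complexified vectors with independent components $X\sigma,X\bar\sigma,XN,X\bar N$; these formal brackets depend on the smearings $\lambda,\alpha,\lambda',\alpha'$, and such a function is called tangentially extensible if $(\lambda,\alpha),(\lambda',\alpha')\in\mathcal G_{TE}$. A *system of distributional brackets* consists of sixteen bidistributions $\{a(x),b(x')\}_D$, $a,b\in\{\sigma,\bar\sigma,N,\bar N\}$, on the product of the spaces of smearings ($\bar{\mathcal F}_1$ for $\sigma$, $\mathcal F_1$ for $\bar\sigma$, $\mathcal F_0$ for $N$, $\bar{\mathcal F}_0$ for $\bar N$). It is *proper* if $$\{F,G\}_D=\sum_{a,b}\int\!\!\int\epsilon_{\mathscr I}\epsilon_{\mathscr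 I}'\,\frac{\delta F}{\delta a(x)}\,\{a(x),b(x')\}_D\,\frac{\delta G}{\delta b(x')}$$ for all tangentially extensible complex shear-news functions $F,G$ and, on $\mathcal P_K$, for all proper observables $F,G$. It is *directional* if the same formula holds for $\{F;G\}_D$ with $F$ tangentially extensible (or a proper observable) and $G$ any complex shear-news function with smearings in $\mathcal F_1,\mathcal F_0$ (or any smooth real function with smooth functional derivatives in $\mathcal F_1\times\mathcal F_0$). It is *real* if $\{\bar a(x),\bar b(x')\}_D=\overline{\{a(x),b(x')\}_D}$, and *antisymmetric* if $\{a(x),b(x')\}_D=-\{b(x'),a(x)\}_D$. Notation: $\int du\,L_\pm(u)f(x)=f_\pm(\hat r)$ for $f\in\mathcal F_0$ (or $\bar{\mathcal F}_0$); $H(u,u')=1$ if $u>u'$ and $0$ otherwise; $\langle\mathfrak D_u\Phi,f\rangle=-\langle\Phi,\partial_uf\rangle$; $\mathfrak D_u^-=\frac12(\mathfrak D_u-\mathfrak D_{u'})$. A distribution $\phi(\hat r,x')$, $\phi\in(\mathcal E\otimes\mathcal F)^*$, acts on $f(x)\in\mathcal F_1$ through $\int du\,f\in\mathcal E$, and $L_\pm(u)\phi(\hat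 r,x')$ acts on $f(x)\in\mathcal F_0$ through $f_\pm$. **Statement.** 1. *(Proper brackets.)* A real antisymmetric system of distributional brackets is proper if and only if there are $\phi\in(\mathcal E\otimes\mathcal F_1)^*$, $\tilde\phi\in(\mathcal E\otimes\mathcal F_0)^*$, $\psi\in(\bar{\mathcal E}\otimes\mathcal F_1)^*$, $\tilde\psi\in(\bar{\mathcal E}\otimes\mathcal F_0)^*$ with $$\begin{aligned} \{\bar\sigma(x),\bar\sigma(x')\}_D&=\phi(\hat r,x')-\phi(\hat r',x),\\ \{\bar\sigma(x),N(x')\}_D&=\tilde\phi(\hat r,x')+(L_+(u')-L_-(u'))\,\phi(\hat r',x),\\ \{N(x),N(x')\}_D&=(L_+(u')-L_-(u'))\,\tilde\phi(\hat r',x)-(L_+(u)-L_-(u))\,\tilde\phi(\hat r,x'),\\ \{\sigma(x),\bar\sigma(x')\}_D&=2\pi\delta(\hat r,\hat r')(H(u,u')-H(u',u))+\psi(\hat r,x')-\bar\psi(\hat r',x),\\ \{\sigma(x),N(x')\}_D&=4\pi\delta(x,x')+2\pi\delta(\hat r,\hat r')L_-(u')+(L_+(u')-L_-(u'))\,\bar\psi(\hat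 r',x)+\tilde\psi(\hat r,x'),\\ \{\bar N(x),N(x')\}_D&=-4\pi\,\mathfrak D_u^-\delta(x,x')+(L_-(u)-L_+(u))\,\tilde\psi(\hat r,x')-(L_-(u')-L_+(u'))\,\bar{\tilde\psi}(\hat r',x). \end{aligned}$$ For all $\phi,\tilde\phi,\psi,\tilde\psi$ there is exactly one real antisymmetric system of this form. In particular, there is a real, antisymmetric, proper system with $\{\sigma(x),\bar\sigma(x')\}_D=2\pi\delta(\hat r,\hat r')(H(u,u')-H(u',u))$, $\{\sigma(x),N(x')\}_D=4\pi\delta(x,x')+2\pi\delta(\hat r,\hat r')L_-(u')$, $\{\bar N(x),N(x')\}_D=-4\pi\mathfrak D_u^-\delta(x,x')$ and $\{\sigma,\sigma\}_D=\{\sigma,\bar N\}_D=\{\bar N,\bar N\}_D=0$ (the minimal choice). 2. *(Directional brackets.)* A real system of distributional brackets is directional if and only if there are $\phi,\tilde\phi,\psi,\tilde\psi$ in the same spaces with $$\begin{aligned} \{\bar\sigma(x);\bar\sigma(x')\}_D&=\phi(\hat r,x'),&\{N(x);\bar\sigma(x')\}_D&=(L_-(u)-L_+(u))\,\phi(\hat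 r,x'),\\ \{\bar\sigma(x);N(x')\}_D&=\tilde\phi(\hat r,x'),&\{N(x);N(x')\}_D&=(L_-(u)-L_+(u))\,\tilde\phi(\hat r,x'),\\ \{\sigma(x);\bar\sigma(x')\}_D&=-4\pi\delta(\hat r,\hat r')H(u',u)+\psi(\hat r,x'),&\{\sigma(x);N(x')\}_D&=4\pi\delta(x,x')+\tilde\psi(\hat r,x'), \end{aligned}$$ $$\{\bar N(x);\bar\sigma(x')\}_D=-4\pi\delta(x,x')-4\pi\delta(\hat r,\hat r')L_-(u)+(L_-(u)-L_+(u))\,\psi(\hat r,x'),$$ $$\{\bar N(x);N(x')\}_D=-4\pi\,\mathfrak D_u\delta(x,x')+(L_-(u)-L_+(u))\,\tilde\psi(\hat r,x').$$ For all $\phi,\tilde\phi,\psi,\tilde\psi$ there is exactly one real system of this form; the minimal choice is $\phi=\tilde\phi=\psi=\tilde\psi=0$. 3. *(Anomalies.)* On $\bar{\mathcal F}_0\otimes\mathcal F_0$, $\mathfrak D_{u'}\delta(x,x')=-\mathfrak D_u\delta(x,x')-\delta(\hat r,\hat r')\left(L_+(u)L_+(u')-L_-(u)L_-(u')\right)$,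 and in particular $\mathfrak D_{u'}\delta\ne-\mathfrak D_u\delta$; on $\bar{\mathcal F}_0\otimes\mathcal F_1$, $\delta(\hat r,\hat r')\,\mathfrak D_uH(u,u')=\delta(x,x')-\delta(\hat r,\hat r')L_+(u)$. -/

import Mathlib

open Filter Topology MeasureTheory
open scoped ContDiff ComplexConjugate

noncomputable section

namespace Scri

/-! ### Frames on the round sphere and spin-weighted functions

A point of `SO3` is a positively oriented orthonormal frame of `ℝ³`: its columns are `(e₁, e₂, r̂)`,
i.e. a point `r̂` of the unit sphere together with an oriented orthonormal basis `(e₁, e₂)` of the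
tangent plane at `r̂`, equivalently the null vector `m = (e₁ - i e₂) / √2`.  A function of spin
weight `s` on the sphere is a function of the frame that is multiplied by `exp (i s ψ)` under
`m ↦ exp (i ψ) m`. -/

/-- The bundle of positively oriented orthonormal frames of the unit sphere. -/
abbrev SO3 : Type := Matrix.specialOrthogonalGroup (Fin 3) ℝ

/-- `R * rotZ ψ` is the frame `R` with `m` replaced by `exp (i ψ) m`. -/
def rotZ (t : ℝ) : SO3 :=
  ⟨!![Real.cos t, -Real.sin t, 0; Real.sin t, Real.cos t, 0; 0, 0, 1], by
    rw [Matrix.mem_specialOrthogonalGroup_iff, Matrix.mem_orthogonalGroup_iff]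
    have h := Real.sin_sq_add_cos_sq t
    constructor
    · ext i j
      fin_cases i <;> fin_cases j <;>
        simp [Matrix.mul_apply, Fin.sum_univ_three] <;> nlinarith
    · simp [Matrix.det_fin_three]; nlinarith⟩

/-- `t ↦ R * rotE₁ t` is the parallel transport of the frame `R` along the unit speed geodesic of
the sphere with initial velocity `e₁`. -/
def rotE₁ (t : ℝ) : SO3 :=
  ⟨!![Real.cos t, 0, Real.sin t; 0, 1, 0; -Real.sin t, 0, Real.cos t], by
    rw [Matrix.mem_specialOrthogonalGroup_iff, Matrix.mem_orthogonalGroup_iff]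
    have h := Real.sin_sq_add_cos_sq t
    constructor
    · ext i j
      fin_cases i <;> fin_cases j <;>
        simp [Matrix.mul_apply, Fin.sum_univ_three] <;> nlinarith
    · simp [Matrix.det_fin_three]; nlinarith⟩

/-- `t ↦ R * rotE₂ t` is the parallel transport of the frame `R` along the unit speed geodesic of
the sphere with initial velocity `e₂`. -/
def rotE₂ (t : ℝ) : SO3 :=
  ⟨!![1, 0, 0; 0, Real.cos t, Real.sin t; 0, -Real.sin t, Real.cos t], by
    rw [Matrix.mem_specialOrthogonalGroup_iff, Matrix.mem_orthogonalGroup_iff]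
    have h := Real.sin_sq_add_cos_sq t
    constructor
    · ext i j
      fin_cases i <;> fin_cases j <;>
        simp [Matrix.mul_apply, Fin.sum_univ_three] <;> nlinarith
    · simp [Matrix.det_fin_three]; nlinarith⟩

/-- The entries of a frame, as a point of the ambient space `ℝ^{3 × 3}`. -/
def entries (R : SO3) : Fin 3 → Fin 3 → ℝ := fun i j => (R : Matrix (Fin 3) (Fin 3) ℝ) i j

/-- Smooth functions on the (closed, embedded) submanifold `SO3` of `ℝ^{3 × 3}`. -/
def SphereSmooth (h : SO3 → ℂ) : Prop :=
  ∃ H : (Fin 3 → Fin 3 → ℝ) → ℂ, ContDiff ℝ ∞ H ∧ ∀ R, h R = H (entries R)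

/-- Smooth functions on `ℝ × SO3`. -/
def ScriSmooth (f : ℝ → SO3 → ℂ) : Prop :=
  ∃ H : ℝ × (Fin 3 → Fin 3 → ℝ) → ℂ, ContDiff ℝ ∞ H ∧ ∀ u R, f u R = H (u, entries R)

/-- Spin weight `s`. -/
def HasSpin (s : ℤ) (h : SO3 → ℂ) : Prop :=
  ∀ (R : SO3) (ψ : ℝ), h (R * rotZ ψ) = Complex.exp (Complex.I * s * ψ) * h R

/-- Derivative at `t = 0` along `R * γ t`. -/
def alongCurve (γ : ℝ → SO3) (h : SO3 → ℂ) : SO3 → ℂ := fun R => deriv (fun t => h (R * γ t)) 0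

/-- The operator `ð`, the covariant derivative along `m = (e₁ - i e₂) / √2`. -/
def eth (h : SO3 → ℂ) : SO3 → ℂ := fun R =>
  ((1 / Real.sqrt 2 : ℝ) : ℂ) * (alongCurve rotE₁ h R - Complex.I * alongCurve rotE₂ h R)

/-- The operator `ð̄`, the covariant derivative along `m̄ = (e₁ + i e₂) / √2`. -/
def ethBar (h : SO3 → ℂ) : SO3 → ℂ := fun R =>
  ((1 / Real.sqrt 2 : ℝ) : ℂ) * (alongCurve rotE₁ h R + Complex.I * alongCurve rotE₂ h R)

/-- Finite strings of `ð` (letter `true`) and `ð̄` (letter `false`). -/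
def word : List Bool → (SO3 → ℂ) → (SO3 → ℂ)
  | [], h => h
  | true :: w, h => eth (word w h)
  | false :: w, h => ethBar (word w h)

/-! Linearity facts. -/

theorem ScriSmooth.add {f g : ℝ → SO3 → ℂ} (hf : ScriSmooth f) (hg : ScriSmooth g) :
    ScriSmooth (fun u R => f u R + g u R) := by
  obtain ⟨F, hF, hF'⟩ := hf
  obtain ⟨G, hG, hG'⟩ := hg
  exact ⟨fun x => F x + G x, hF.add hG, fun u R => by simp [hF', hG']⟩

theorem ScriSmooth.mul_const {f : ℝ → SO3 → ℂ} (hf : ScriSmooth f) (c : ℂ) :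
    ScriSmooth (fun u R => c * f u R) := by
  obtain ⟨F, hF, hF'⟩ := hf
  exact ⟨fun x => c * F x, contDiff_const.mul hF, fun u R => by simp [hF']⟩

theorem SphereSmooth.toScri {h : SO3 → ℂ} (hh : SphereSmooth h) :
    ScriSmooth (fun _ R => h R) := by
  obtain ⟨H, hH, hH'⟩ := hh
  exact ⟨fun x => H x.2, hH.comp contDiff_snd, fun u R => hH' R⟩

theorem ScriSmooth.contDiff {f : ℝ → SO3 → ℂ} (hf : ScriSmooth f) (R : SO3) :
    ContDiff ℝ ∞ (fun u => f u R) := by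
  obtain ⟨F, hF, hF'⟩ := hf
  have : (fun u => f u R) = fun u => F (u, entries R) := by
    funext u; exact hF' u R
  rw [this]
  exact hF.comp (contDiff_id.prodMk contDiff_const)

theorem entries_mul (R S : SO3) (i j : Fin 3) :
    entries (R * S) i j = ∑ k, entries R i k * entries S k j := by
  simp [entries, Matrix.mul_apply]

/-- A curve through the identity with velocity `E`. -/
def IsCurve (γ : ℝ → SO3) (E : Fin 3 → Fin 3 → ℝ) : Prop :=
  γ 0 = 1 ∧ ∀ k j, HasDerivAt (fun t => entries (γ t) k j) (E k j) 0

theorem ScriSmooth.hasDerivAt {γ : ℝ → SO3} {E : Fin 3 → Fin 3 → ℝ} (hγ : IsCurve γ E)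
    {H : ℝ × (Fin 3 → Fin 3 → ℝ) → ℂ} (hH : ContDiff ℝ ∞ H) (u : ℝ) (R : SO3) :
    HasDerivAt (fun t => H (u, entries (R * γ t)))
      (fderiv ℝ H (u, entries R) (0, fun i j => ∑ k, entries R i k * E k j)) 0 := by
  have h1 : HasDerivAt (fun t => entries (R * γ t))
      (fun i j => ∑ k, entries R i k * E k j) 0 := by
    rw [hasDerivAt_pi]
    intro i
    rw [hasDerivAt_pi]
    intro j
    simp only [entries_mul]
    exact HasDerivAt.fun_sum fun k _ => (hγ.2 k j).const_mul _
  have h2 : HasDerivAt (fun t : ℝ => (u, entries (R * γ t)))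
      ((0 : ℝ), fun i j => ∑ k, entries R i k * E k j) 0 := (hasDerivAt_const _ _).prodMk h1
  have h3 : HasFDerivAt H (fderiv ℝ H (u, entries R)) (u, entries (R * γ 0)) := by
    rw [hγ.1, mul_one]
    exact (hH.differentiable (by simp)).differentiableAt.hasFDerivAt
  exact h3.comp_hasDerivAt 0 h2

theorem ScriSmooth.alongCurve {γ : ℝ → SO3} {E : Fin 3 → Fin 3 → ℝ} (hγ : IsCurve γ E)
    {f : ℝ → SO3 → ℂ} (hf : ScriSmooth f) : ScriSmooth (fun u R => alongCurve γ (f u) R) := by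
  obtain ⟨F, hF, hF'⟩ := hf
  refine ⟨fun x => fderiv ℝ F x (0, fun i j => ∑ k, x.2 i k * E k j), ?_, fun u R => ?_⟩
  · refine (hF.fderiv_right (m := ∞) (by simp)).clm_apply (contDiff_const.prodMk ?_)
    fun_prop
  · have : (fun t => f u (R * γ t)) = fun t => F (u, entries (R * γ t)) := by
      funext t; exact hF' u _
    change deriv (fun t => f u (R * γ t)) 0 = _
    rw [this]
    exact (ScriSmooth.hasDerivAt hγ hF u R).deriv

theorem ScriSmooth.alongCurve_differentiableAt {γ : ℝ → SO3} {E : Fin 3 → Fin 3 → ℝ}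
    (hγ : IsCurve γ E) {f : ℝ → SO3 → ℂ} (hf : ScriSmooth f) (u : ℝ) (R : SO3) :
    DifferentiableAt ℝ (fun t => f u (R * γ t)) 0 := by
  obtain ⟨F, hF, hF'⟩ := hf
  have : (fun t => f u (R * γ t)) = fun t => F (u, entries (R * γ t)) := by
    funext t; exact hF' u _
  rw [this]
  exact (ScriSmooth.hasDerivAt hγ hF u R).differentiableAt

theorem isCurve_rotE₁ : IsCurve rotE₁ ![![0, 0, 1], ![0, 0, 0], ![-1, 0, 0]] := by
  refine ⟨?_, fun k j => ?_⟩
  · ext i j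
    fin_cases i <;> fin_cases j <;> simp [rotE₁]
  · have hs : HasDerivAt Real.sin 1 0 := by simpa using Real.hasDerivAt_sin 0
    have hc : HasDerivAt Real.cos 0 0 := by simpa using Real.hasDerivAt_cos 0
    fin_cases k <;> fin_cases j <;> simp [rotE₁, entries] <;>
      first
        | exact hasDerivAt_const _ _
        | exact hs
        | exact hc
        | exact hs.neg

theorem isCurve_rotE₂ : IsCurve rotE₂ ![![0, 0, 0], ![0, 0, 1], ![0, -1, 0]] := by
  refine ⟨?_, fun k j => ?_⟩
  · ext i j
    fin_cases i <;> fin_cases j <;> simp [rotE₂]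
  · have hs : HasDerivAt Real.sin 1 0 := by simpa using Real.hasDerivAt_sin 0
    have hc : HasDerivAt Real.cos 0 0 := by simpa using Real.hasDerivAt_cos 0
    fin_cases k <;> fin_cases j <;> simp [rotE₂, entries] <;>
      first
        | exact hasDerivAt_const _ _
        | exact hs
        | exact hc
        | exact hs.neg

theorem ScriSmooth.word {f : ℝ → SO3 → ℂ} (hf : ScriSmooth f) (w : List Bool) :
    ScriSmooth (fun u R => word w (f u) R) := by
  induction w with
  | nil => exact hf
  | cons b w ih =>
    have h1 := ScriSmooth.alongCurve isCurve_rotE₁ ih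
    have h2 := ScriSmooth.alongCurve isCurve_rotE₂ ih
    cases b
    · exact (h1.add (h2.mul_const Complex.I)).mul_const _
    · have h3 := (h1.add (h2.mul_const (-Complex.I))).mul_const ((1 / Real.sqrt 2 : ℝ) : ℂ)
      convert h3 using 3
      simp [Scri.word, eth]
      ring

theorem word_add {f g : ℝ → SO3 → ℂ} (hf : ScriSmooth f) (hg : ScriSmooth g) (w : List Bool)
    (u : ℝ) : word w (fun R => f u R + g u R) = fun R => word w (f u) R + word w (g u) R := by
  induction w with
  | nil => rfl
  | cons b w ih =>
    have hd : ∀ (γ : ℝ → SO3) (E : Fin 3 → Fin 3 → ℝ), IsCurve γ E → ∀ R,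
        Scri.alongCurve γ (fun R => word w (f u) R + word w (g u) R) R =
          Scri.alongCurve γ (word w (f u)) R + Scri.alongCurve γ (word w (g u)) R := by
      intro γ E hγ R
      exact deriv_fun_add (ScriSmooth.alongCurve_differentiableAt hγ (hf.word w) u R)
        (ScriSmooth.alongCurve_differentiableAt hγ (hg.word w) u R)
    funext R
    cases b
    · simp only [word, ih, ethBar, hd _ _ isCurve_rotE₁, hd _ _ isCurve_rotE₂]; ring
    · simp only [word, ih, eth, hd _ _ isCurve_rotE₁, hd _ _ isCurve_rotE₂]; ring

theorem word_smul (h : SO3 → ℂ) (w : List Bool) (c : ℝ) :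
    word w (fun R => (c : ℂ) * h R) = fun R => (c : ℂ) * word w h R := by
  induction w with
  | nil => rfl
  | cons b w ih =>
    funext R
    cases b
    · simp only [word, ih, ethBar, alongCurve, deriv_const_mul_field]; ring
    · simp only [word, ih, eth, alongCurve, deriv_const_mul_field]; ring

/-! ### The space `ℰ` of purely electric smooth functions of spin weight 2 -/

/-- `ℰ = ð² C^∞(S², ℝ)`. -/
def electricSub : Submodule ℝ (SO3 → ℂ) where
  carrier := {e | ∃ ξ : SO3 → ℂ, SphereSmooth ξ ∧ HasSpin 0 ξ ∧ (∀ R, (ξ R).im = 0) ∧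
    e = eth (eth ξ)}
  add_mem' := by
    rintro a b ⟨ξ, h1, h2, h3, rfl⟩ ⟨η, k1, k2, k3, rfl⟩
    refine ⟨fun R => ξ R + η R, ?_, fun R ψ => ?_, fun R => by simp [h3, k3], ?_⟩
    · obtain ⟨H, hH, hH'⟩ := h1
      obtain ⟨G, hG, hG'⟩ := k1
      exact ⟨fun x => H x + G x, hH.add hG, fun R => by simp [hH', hG']⟩
    · simp only [h2 R ψ, k2 R ψ]; ring
    · exact (word_add h1.toScri k1.toScri [true, true] 0).symm
  zero_mem' := by
    refine ⟨0, ⟨0, contDiff_const, fun R => rfl⟩, fun R ψ => by simp, fun R => by simp, ?_⟩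
    funext R
    simp [eth, alongCurve]
  smul_mem' := by
    rintro c a ⟨ξ, h1, h2, h3, rfl⟩
    refine ⟨fun R => (c : ℂ) * ξ R, ?_, fun R ψ => ?_, fun R => by simp [h3], ?_⟩
    · obtain ⟨H, hH, hH'⟩ := h1
      exact ⟨fun x => (c : ℂ) * H x, contDiff_const.mul hH, fun R => by simp [hH']⟩
    · simp only [h2 R ψ]; ring
    · have := word_smul ξ [true, true] c
      simp only [word] at this
      rw [this]
      funext R
      simp

/-- The space `ℰ`. -/
def Elec : Type := electricSub

instance : AddCommGroup Elec := inferInstanceAs (AddCommGroup electricSub)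
instance : Module ℝ Elec := inferInstanceAs (Module ℝ electricSub)
instance : CoeFun Elec (fun _ => SO3 → ℂ) := ⟨fun e => e.1⟩

/-- The topology of `C^∞(S²)`, given by the seminorms `sup |𝒟 e|`, `𝒟 ∈ words(ð, ð̄)`, i.e. the
coarsest topology for which every `e ↦ 𝒟 e` is continuous for uniform convergence. -/
instance : TopologicalSpace Elec :=
  ⨅ w : List Bool, TopologicalSpace.induced
    (fun e : Elec => UniformFun.ofFun (word w e)) inferInstance

/-! ### The spaces `ℱ₀` and `ℱ₁`

`ε > 0` is the fixed decay exponent. -/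

/-- The space `ℱ₀` of spin weight 2 functions on `ℝ × S²`. -/
def f0Sub (ε : ℝ) : Submodule ℝ (ℝ → SO3 → ℂ) where
  carrier := {f | ScriSmooth f ∧ (∀ u, HasSpin 2 (f u)) ∧
    (∀ (k : ℕ) (w : List Bool), 1 ≤ k → ∃ C : ℝ, ∀ u R,
      ‖(1 + u ^ 2) ^ ((k : ℝ) / 2 + ε) • iteratedDeriv k (fun v => word w (f v) R) u‖ ≤ C) ∧
    (∃ e : Elec, ∀ R, Tendsto (fun u => f u R) atTop (𝓝 (e R))) ∧
    (∃ e : Elec, ∀ R, Tendsto (fun u => f u R) atBot (𝓝 (e R)))}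
  add_mem' := by
    rintro f g ⟨hf, hfs, hfb, ⟨e, he⟩, ⟨e', he'⟩⟩ ⟨hg, hgs, hgb, ⟨d, hd⟩, ⟨d', hd'⟩⟩
    refine ⟨hf.add hg, fun u R ψ => ?_, fun k w hk => ?_, ⟨e + d, fun R => (he R).add (hd R)⟩,
      ⟨e' + d', fun R => (he' R).add (hd' R)⟩⟩
    · simp only [Pi.add_apply, hfs u R ψ, hgs u R ψ]; ring
    · obtain ⟨C, hC⟩ := hfb k w hk
      obtain ⟨D, hD⟩ := hgb k w hk
      refine ⟨C + D, fun u R => ?_⟩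
      have h1 : (fun v => word w ((f + g) v) R) =
          (fun v => word w (f v) R) + fun v => word w (g v) R := by
        funext v
        exact congrFun (word_add hf hg w v) R
      rw [h1, iteratedDeriv_add
        (((hf.word w).contDiff R).contDiffAt.of_le (by exact_mod_cast le_top))
        (((hg.word w).contDiff R).contDiffAt.of_le (by exact_mod_cast le_top)), smul_add]
      exact (norm_add_le _ _).trans (add_le_add (hC u R) (hD u R))
  zero_mem' := by
    have hw : ∀ w : List Bool, word w (fun _ => 0) = fun _ => 0 := by
      intro w
      have := word_smul (fun _ => 0) w 0
      simpa using this
    refine ⟨⟨0, contDiff_const, fun u R => rfl⟩, fun u R ψ => by simp, fun k w hk => ⟨0, ?_⟩,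
      ⟨0, fun R => tendsto_const_nhds⟩, ⟨0, fun R => tendsto_const_nhds⟩⟩
    intro u R
    have : (fun v : ℝ => word w ((0 : ℝ → SO3 → ℂ) v) R) = fun _ => 0 := by
      funext v
      exact congrFun (hw w) R
    rw [this]
    simp
  smul_mem' := by
    rintro c f ⟨hf, hfs, hfb, ⟨e, he⟩, ⟨e', he'⟩⟩
    refine ⟨?_, fun u R ψ => ?_, fun k w hk => ?_, ⟨c • e, fun R => (he R).const_smul c⟩,
      ⟨c • e', fun R => (he' R).const_smul c⟩⟩
    · convert hf.mul_const (c : ℂ) using 3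
      simp
    · simp only [Pi.smul_apply, hfs u R ψ, Complex.real_smul]; ring
    · obtain ⟨C, hC⟩ := hfb k w hk
      refine ⟨|c| * C, fun u R => ?_⟩
      have h1 : (fun v => word w ((c • f) v) R) = c • (fun v => word w (f v) R) := by
        funext v
        have h2 : (c • f) v = fun R => (c : ℂ) * f v R := by funext R; simp
        rw [h2, word_smul]
        simp
      rw [h1, iteratedDeriv_const_smul_field, smul_comm, norm_smul, Real.norm_eq_abs]
      exact mul_le_mul_of_nonneg_left (hC u R) (abs_nonneg c)

/-- The space `ℱ₁ = ∂ᵤ ℱ₀`. -/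
def f1Sub (ε : ℝ) : Submodule ℝ (ℝ → SO3 → ℂ) where
  carrier := {g | ∃ f ∈ f0Sub ε, ∀ u R, HasDerivAt (fun v => f v R) (g u R) u}
  add_mem' := by
    rintro a b ⟨f, hf, h⟩ ⟨f', hf', h'⟩
    exact ⟨f + f', add_mem hf hf', fun u R => (h u R).add (h' u R)⟩
  zero_mem' := ⟨0, zero_mem _, fun u R => hasDerivAt_const _ _⟩
  smul_mem' := by
    rintro c a ⟨f, hf, h⟩
    exact ⟨c • f, Submodule.smul_mem _ c hf, fun u R => (h u R).const_smul c⟩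

/-- The two kinds of local fields: the shear (`σ`, `σ̄`) and the news (`N`, `N̄`). -/
inductive Kind
  | shear
  | news
  deriving DecidableEq

instance : Fintype Kind := ⟨{.shear, .news}, fun x => by cases x <;> simp⟩

/-- The space of smearings for a field of the given kind: shears are smeared with (conjugates of)
elements of `ℱ₁`, news with (conjugates of) elements of `ℱ₀`. -/
def smearSub (ε : ℝ) : Kind → Submodule ℝ (ℝ → SO3 → ℂ)
  | .shear => f1Sub ε
  | .news => f0Sub ε

/-- The space of smearings, as a type (carrying its own topology, defined below). -/
def FSpace (ε : ℝ) (k : Kind) : Type := smearSub ε k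

instance (ε : ℝ) (k : Kind) : AddCommGroup (FSpace ε k) :=
  inferInstanceAs (AddCommGroup (smearSub ε k))
instance (ε : ℝ) (k : Kind) : Module ℝ (FSpace ε k) := inferInstanceAs (Module ℝ (smearSub ε k))
instance (ε : ℝ) (k : Kind) : CoeFun (FSpace ε k) (fun _ => ℝ → SO3 → ℂ) := ⟨fun f => f.1⟩

/-- `ℱ₀` -/
abbrev F0 (ε : ℝ) : Type := FSpace ε .news
/-- `ℱ₁` -/
abbrev F1 (ε : ℝ) : Type := FSpace ε .shear

variable {ε : ℝ}

/-- The asymptotic limit `f₊ ∈ ℰ` of `f ∈ ℱ₀`. -/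
def limPlus (f : F0 ε) : Elec := Classical.choose f.2.2.2.2.1

theorem limPlus_spec (f : F0 ε) (R : SO3) :
    Tendsto (fun u => f u R) atTop (𝓝 (limPlus f R)) := Classical.choose_spec f.2.2.2.2.1 R

/-- The asymptotic limit `f₋ ∈ ℰ` of `f ∈ ℱ₀`. -/
def limMinus (f : F0 ε) : Elec := Classical.choose f.2.2.2.2.2

theorem limMinus_spec (f : F0 ε) (R : SO3) :
    Tendsto (fun u => f u R) atBot (𝓝 (limMinus f R)) := Classical.choose_spec f.2.2.2.2.2 R

/-- The Fréchet topology of `ℱ₀`, given by the seminorms `sup |𝒟 f₋|` and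
`sup |(1 + u²)^{k/2 + ε} ∂ᵤᵏ 𝒟 f|`, `k ≥ 1`. -/
abbrev topF0 (ε : ℝ) : TopologicalSpace (F0 ε) :=
  (⨅ w : List Bool, TopologicalSpace.induced
    (fun f : F0 ε => UniformFun.ofFun (word w (limMinus f))) inferInstance) ⊓
  ⨅ (k : ℕ) (_ : 1 ≤ k) (w : List Bool), TopologicalSpace.induced
    (fun f : F0 ε => UniformFun.ofFun (fun x : ℝ × SO3 =>
      (1 + x.1 ^ 2) ^ ((k : ℝ) / 2 + ε) • iteratedDeriv k (fun v => word w (f v) x.2) x.1))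
    inferInstance

/-- The Fréchet topology of `ℱ₁`, given by the seminorms
`sup |(1 + u²)^{k/2 + 1/2 + ε} ∂ᵤᵏ 𝒟 g|`, `k ≥ 0`. -/
abbrev topF1 (ε : ℝ) : TopologicalSpace (F1 ε) :=
  ⨅ (k : ℕ) (w : List Bool), TopologicalSpace.induced
    (fun g : F1 ε => UniformFun.ofFun (fun x : ℝ × SO3 =>
      (1 + x.1 ^ 2) ^ ((k : ℝ) / 2 + 1 / 2 + ε) •
        iteratedDeriv k (fun v => word w (g v) x.2) x.1))
    inferInstance

instance (ε : ℝ) : (k : Kind) → TopologicalSpace (FSpace ε k)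
  | .shear => topF1 ε
  | .news => topF0 ε

/-- `∂ᵤ : ℱ₀ → ℱ₁`. -/
def du (f : F0 ε) : F1 ε :=
  ⟨fun u R => deriv (fun v => f v R) u, f.1, f.2, fun u R =>
    ((f.2.1.contDiff R).differentiable (by simp)).differentiableAt.hasDerivAt⟩

theorem integral_mem_electric (hε : 0 < ε) (g : F1 ε) :
    (fun R => ∫ u, g u R) ∈ electricSub := by
  obtain ⟨f, hf, h⟩ := g.2
  set f' : F0 ε := ⟨f, hf⟩ with hf'
  have key : (fun R => ∫ u, g u R) = (limPlus f' - limMinus f' : Elec).1 := by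
    funext R
    have hint : Integrable (fun u => g u R) := by
      obtain ⟨C, hC⟩ := hf.2.2.1 1 [] le_rfl
      have hgd : (fun u => g u R) = deriv (fun v => f v R) := by
        funext u; exact (h u R).deriv.symm
      have hmeas : AEStronglyMeasurable (fun u => g u R) volume := by
        rw [hgd]
        exact ((hf.1.contDiff R).continuous_deriv (by simp)).aestronglyMeasurable
      have hI : Integrable (fun u : ℝ => C * ((1 : ℝ) + ‖u‖ ^ 2) ^ (-(1 + 2 * ε) / 2)) :=
        (integrable_rpow_neg_one_add_norm_sq (E := ℝ) (μ := volume)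
          (by simp; linarith)).const_mul C
      refine hI.mono' hmeas (Eventually.of_forall fun u => ?_)
      have h1 := hC u R
      have h2 : iteratedDeriv 1 (fun v => word [] (f v) R) u = g u R := by
        rw [iteratedDeriv_one]; exact (h u R).deriv
      have hp : (0 : ℝ) < 1 + u ^ 2 := by positivity
      rw [h2, norm_smul, Real.norm_eq_abs, abs_of_pos (Real.rpow_pos_of_pos hp _)] at h1
      have hu : ‖u‖ ^ 2 = u ^ 2 := by simp
      have he : -(1 + 2 * ε) / 2 = -(((1 : ℕ) : ℝ) / 2 + ε) := by push_cast; ring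
      rw [hu, he, Real.rpow_neg hp.le, ← div_eq_mul_inv,
        le_div_iff₀ (Real.rpow_pos_of_pos hp _), mul_comm]
      exact h1
    exact integral_of_hasDerivAt_of_tendsto (fun u => h u R) hint
      (limMinus_spec f' R) (limPlus_spec f' R)
  rw [key]
  exact (limPlus f' - limMinus f' : Elec).2

/-- `I_u : ℱ₁ → ℰ`, `g ↦ ∫ du g`. -/
def intU (hε : 0 < ε) (g : F1 ε) : Elec := ⟨fun R => ∫ u, g u R, integral_mem_electric hε g⟩

/-! ### Integration -/

/-- The frame `(∂_θ, ∂_φ / sin θ, r̂)` at the point of the sphere with polar angles `(θ, φ)`. -/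
def polarFrame (θ φ : ℝ) : SO3 := rotZ φ * rotE₁ θ

/-- `∫_S ε_S h`, for `h` of spin weight 0. -/
def sphereInt (h : SO3 → ℂ) : ℂ :=
  ∫ θ in (0 : ℝ)..Real.pi, ∫ φ in (0 : ℝ)..(2 * Real.pi),
    (Real.sin θ : ℂ) * h (polarFrame θ φ)

/-- `∫ ε_𝓘 f`, for `f` of spin weight 0. -/
def scriInt (f : ℝ → SO3 → ℂ) : ℂ := sphereInt fun R => ∫ u, f u R

/-! ### The phase space, its symplectic form, and the constraints -/

/-- The kinematical phase space `𝒫 = ℱ₀ × ℱ₁ ∋ (σ, N̄)`. -/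
abbrev Phase (ε : ℝ) : Type := F0 ε × F1 ε

/-- The value of the constraint `K = N̄ + ∂ᵤσ`. -/
def constraint (p : Phase ε) : F1 ε := p.2 + du p.1

/-- The constraint surface `𝒫_K`. -/
def OnShell (p : Phase ε) : Prop := constraint p = 0

/-- The symplectic form `Ω = (1/4π) Re ∫ δN δσ` (an exterior product), on tangent vectors
`X = (Xσ, XN̄)`. -/
def omega (X X' : Phase ε) : ℝ :=
  1 / (4 * Real.pi) *
    (scriInt fun u R => conj (X.2 u R) * X'.1 u R - conj (X'.2 u R) * X.1 u R).re

/-- The space `𝒦 = ℱ₀⁰` of constraint smearings, those `φ ∈ ℱ₀` with `φ₊ = φ₋ = 0`. -/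
def IsConstraintSmearing (φ : F0 ε) : Prop := limPlus φ = 0 ∧ limMinus φ = 0

/-- The smeared constraint `K_φ = (1/4π) Re ∫ φ̄ (N̄ + ∂ᵤσ)`, a linear functional on phase space. -/
def smearedConstraint (φ : F0 ε) (p : Phase ε) : ℝ :=
  1 / (4 * Real.pi) * (scriInt fun u R => conj (φ u R) * constraint p u R).re

/-! ### Smooth functions, proper observables and their Dirac brackets -/

/-- `C^k` maps between topological vector spaces, in the sense of Michal and Bastiani: the iterated
directional derivatives exist and are jointly continuous. -/
def IsCk {W : Type} [AddCommGroup W] [Module ℝ W] [TopologicalSpace W] :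
    ℕ → ∀ {V : Type} [AddCommGroup V] [Module ℝ V] [TopologicalSpace V], (V → W) → Prop
  | 0, _, _, _, _, f => Continuous f
  | n + 1, V, _, _, _, f => Continuous f ∧ ∃ df : V × V → W,
      (∀ x v, Tendsto (fun t : ℝ => t⁻¹ • (f (x + t • v) - f x)) (𝓝[≠] 0) (𝓝 (df (x, v)))) ∧
      IsCk n df

/-- Smooth maps between topological vector spaces. -/
def IsSmooth {V W : Type} [AddCommGroup V] [Module ℝ V] [TopologicalSpace V]
    [AddCommGroup W] [Module ℝ W] [TopologicalSpace W] (f : V → W) : Prop := ∀ n, IsCk n f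

/-- The differential `δF` at `p`. -/
def differential (F : Phase ε → ℝ) (p Y : Phase ε) : ℝ :=
  deriv (fun t : ℝ => F (p + t • Y)) 0

/-- `F` is smooth and kinematically regular, with smooth functional derivatives
`δF/δσ̄ = (D p).1 = conj (δF/δσ)` and `δF/δN = (D p).2 = conj (δF/δN̄)`. -/
structure IsRegular (F : Phase ε → ℝ) (D : Phase ε → F1 ε × F0 ε) : Prop where
  smooth : IsSmooth F
  smooth_deriv : IsSmooth D
  deriv_eq : ∀ p Y, (differential F p Y : ℂ) = scriInt fun u R =>
    conj ((D p).1 u R) * Y.1 u R + conj ((D p).2 u R) * Y.2 u R +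
    (D p).1 u R * conj (Y.1 u R) + (D p).2 u R * conj (Y.2 u R)

/-- The dual constraint `∫ du λ = α₊ - α₋`, i.e. `(λ, α) ∈ 𝒢_TE`. -/
def DualConstraint (l : F1 ε) (α : F0 ε) : Prop :=
  ∀ R, ∫ u, l u R = limPlus α R - limMinus α R

/-- Proper observables: regular functions `F` with `(δF/δσ̄, δF/δN) ∈ 𝒢_TE` on the constraint
surface. -/
structure IsProper (F : Phase ε → ℝ) (D : Phase ε → F1 ε × F0 ε) : Prop
    extends IsRegular F D where
  dual : ∀ p, OnShell p → DualConstraint (D p).1 (D p).2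

/-- `X` is the Hamiltonian vector, at the on-shell point `p`, of a tangential extension
`F̃ = F + K_φ`, `φ ∈ 𝒦`, of `F`: `δF̃ = - I_X Ω`, and `{F̃, K_φ'} = - X K_φ' = 0` for all `φ' ∈ 𝒦`. -/
def IsTangentialFlow (F : Phase ε → ℝ) (p X : Phase ε) : Prop :=
  ∃ φ : F0 ε, IsConstraintSmearing φ ∧
    (∀ Y, differential F p Y + smearedConstraint φ Y = - omega X Y) ∧
    ∀ φ' : F0 ε, IsConstraintSmearing φ' → smearedConstraint φ' X = 0

/-- The Hamiltonian vector `X̃_F` at `p` of the tangential extension of `F`. -/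
def tangentialFlow (F : Phase ε → ℝ) (p : Phase ε) : Phase ε :=
  Classical.epsilon fun X => IsTangentialFlow F p X

/-- The Dirac bracket `{F, G}_D = {F̃, G̃} = - Ω(X̃_F, X̃_G)` at the on-shell point `p`. -/
def diracBracket (F G : Phase ε → ℝ) (p : Phase ε) : ℝ :=
  - omega (tangentialFlow F p) (tangentialFlow G p)

/-- The directional Dirac bracket `{F; G}_D = - X̃_F G` at the on-shell point `p`. -/
def directionalBracket (F G : Phase ε → ℝ) (p : Phase ε) : ℝ :=
  - differential G p (tangentialFlow F p)

/-! ### Complex brackets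

The brackets of complex functions are only formal: they depend on the expression of the function in
terms of `σ, σ̄, N, N̄`, that is on its four functional derivatives (smearings), treated as independent,
and not just on its values on phase space. -/

/-- The local fields, labelled by their kind and by whether their spin weight is `+2` (`true`) or
`-2` (`false`). -/
abbrev Field : Type := Kind × Bool

/-- the field `σ` (spin weight `2`) -/
abbrev fσ : Field := (.shear, true)
/-- the field `σ̄` (spin weight `-2`) -/
abbrev fσbar : Field := (.shear, false)
/-- the field `N̄` (spin weight `2`) -/
abbrev fNbar : Field := (.news, true)
/-- the field `N` (spin weight `-2`) -/
abbrev fN : Field := (.news, false)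

/-- Complex conjugation of local fields. -/
abbrev Field.bar (a : Field) : Field := (a.1, !a.2)

/-- A smearing of all local fields, with independent components: `s fσbar ∈ ℱ₁` and `s fN ∈ ℱ₀` smear
`σ̄` and `N`, while `s fσ` and `s fNbar` are the complex conjugates of the smearings of `σ` and `N̄`
(which live in the conjugate spaces).  It stands for the complex shear-news function
`Γ^ℂ_{λ,α} + Γ̄^ℂ_{λ',α'} = ∫ (λ̄ σ + ᾱ N̄ + λ' σ̄ + α' N)` with `λ = s fσ`, `α = s fNbar`,
`λ' = s fσbar`, `α' = s fN`. -/
abbrev Smearing (ε : ℝ) : Type := (a : Field) → FSpace ε a.1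

/-- The smearing given by the functional derivatives of a real function. -/
def realSmearing (D : F1 ε × F0 ε) : Smearing ε
  | (.shear, _) => D.1
  | (.news, _) => D.2

/-- Tangential extensibility in the complex sense: `(s_σ̄, s_N) ∈ 𝒢_TE` and
`(conj s_σ, conj s_N̄) ∈ conj 𝒢_TE`. -/
def Smearing.IsProper (s : Smearing ε) : Prop :=
  DualConstraint (s fσbar) (s fN) ∧ DualConstraint (s fσ) (s fNbar)

/-- A complexified tangent vector: `X = (Y, Z)` has the independent components
`Xσ = Y.1`, `X N̄ = Y.2`, `X σ̄ = conj Z.1`, `X N = conj Z.2`.  Real vectors are those with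
`Y = Z`. -/
abbrev CTangent (ε : ℝ) : Type := Phase ε × Phase ε

/-- The linear functional `∫ (s̄_σ σ + s̄_N̄ N̄ + s_σ̄ σ̄ + s_N N)`, on complexified vectors. -/
def smear (s : Smearing ε) (X : CTangent ε) : ℂ :=
  scriInt fun u R =>
    conj (s fσ u R) * X.1.1 u R + conj (s fNbar u R) * X.1.2 u R +
    s fσbar u R * conj (X.2.1 u R) + s fN u R * conj (X.2.2 u R)

/-- The extension of `Ω = (1/8π) ∫ (δN δσ + δN̄ δσ̄)` to complexified vectors. -/
def omegaC (X X' : CTangent ε) : ℂ :=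
  (1 / (8 * Real.pi) : ℂ) * scriInt fun u R =>
    (conj (X.2.2 u R) * X'.1.1 u R - conj (X'.2.2 u R) * X.1.1 u R) +
    (X.1.2 u R * conj (X'.2.1 u R) - X'.1.2 u R * conj (X.2.1 u R))

/-- The extension of `K_φ = (1/8π) ∫ (φ̄ (N̄ + ∂ᵤσ) + φ (N + ∂ᵤσ̄))` to complexified smearings
`(φ₁, φ₂)` (real ones being those with `φ₁ = φ₂`) and complexified vectors. -/
def smearedConstraintC (φ : F0 ε × F0 ε) (X : CTangent ε) : ℂ :=
  (1 / (8 * Real.pi) : ℂ) * scriInt fun u R =>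
    conj (φ.1 u R) * constraint X.1 u R + φ.2 u R * conj (constraint X.2 u R)

/-- `X` is the complexified Hamiltonian vector of a tangential extension `s + K_φ`, `φ ∈ 𝒦 × 𝒦`. -/
def IsTangentialFlowC (s : Smearing ε) (X : CTangent ε) : Prop :=
  ∃ φ : F0 ε × F0 ε, IsConstraintSmearing φ.1 ∧ IsConstraintSmearing φ.2 ∧
    (∀ Y : CTangent ε, smear s Y + smearedConstraintC φ Y = - omegaC X Y) ∧
    ∀ φ' : F0 ε × F0 ε, IsConstraintSmearing φ'.1 → IsConstraintSmearing φ'.2 →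
      smearedConstraintC φ' X = 0

/-- The complexified Hamiltonian vector of the tangential extension of `s`. -/
def tangentialFlowC (s : Smearing ε) : CTangent ε :=
  Classical.epsilon fun X => IsTangentialFlowC s X

/-- The Dirac bracket of complex shear-news functions. -/
def diracBracketC (s s' : Smearing ε) : ℂ := - omegaC (tangentialFlowC s) (tangentialFlowC s')

/-- The directional Dirac bracket of complex shear-news functions. -/
def directionalBracketC (s s' : Smearing ε) : ℂ := - smear s' (tangentialFlowC s)

/-! ### Distributional brackets -/

/-- Bidistributions: jointly continuous real-bilinear complex-valued functionals, i.e. elements of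
`(V ⊗ W)*` for the projective topology. -/
structure Bidist (V W : Type) [AddCommGroup V] [Module ℝ V] [TopologicalSpace V]
    [AddCommGroup W] [Module ℝ W] [TopologicalSpace W] where
  toLin : V →ₗ[ℝ] W →ₗ[ℝ] ℂ
  cont : Continuous fun x : V × W => toLin x.1 x.2

/-- The value of a bidistribution. -/
def Bidist.eval {V W : Type} [AddCommGroup V] [Module ℝ V] [TopologicalSpace V]
    [AddCommGroup W] [Module ℝ W] [TopologicalSpace W] (B : Bidist V W) (v : V) (w : W) : ℂ :=
  B.toLin v w

instance {V W : Type} [AddCommGroup V] [Module ℝ V] [TopologicalSpace V]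
    [AddCommGroup W] [Module ℝ W] [TopologicalSpace W] :
    CoeFun (Bidist V W) (fun _ => V → W → ℂ) := ⟨Bidist.eval⟩

/-- A choice of the sixteen bidistributions `{a(x), b(x')}`, `a, b ∈ {σ, σ̄, N, N̄}`.  Elements of the
conjugate test spaces are written as conjugates of elements of `ℱ₀`, `ℱ₁`; thus
`B a b f g = ⟨{a(x), b(x')}, f^#(x) g^#(x')⟩`, where `f^# = f̄` if `a ∈ {σ, N̄}` and `f^# = f` if
`a ∈ {σ̄, N}`, and likewise for `g` and `b`. -/
abbrev Brackets (ε : ℝ) : Type := (a b : Field) → Bidist (FSpace ε a.1) (FSpace ε b.1)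

/-- `{a(x), b(x')} = - {b(x'), a(x)}`. -/
def Brackets.IsAntisymm (B : Brackets ε) : Prop := ∀ a b f g, B a b f g = - B b a g f

/-- `{ā(x), b̄(x')} = conj {a(x), b(x')}`. -/
def Brackets.IsReal (B : Brackets ε) : Prop :=
  ∀ a b f g, B a.bar b.bar f g = conj (B a b f g)

/-- `∑_{a,b} ∫∫ f_a(x) {a(x), b(x')} g_b(x')`, with `f, g` the smearings `s, s'`. -/
def Brackets.pairing (B : Brackets ε) (s s' : Smearing ε) : ℂ := ∑ a, ∑ b, B a b (s a) (s' b)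

/-- Proper distributional brackets: when integrated against functional derivatives, they reproduce
the Dirac brackets of all tangentially extensible complex shear-news functions, and (on-shell) of all
proper observables. -/
structure Brackets.ReproducesProper (B : Brackets ε) : Prop where
  complex : ∀ s s' : Smearing ε, s.IsProper → s'.IsProper → diracBracketC s s' = B.pairing s s'
  real : ∀ (F G : Phase ε → ℝ) (DF DG : Phase ε → F1 ε × F0 ε), IsProper F DF → IsProper G DG →
    ∀ p, OnShell p →
      (diracBracket F G p : ℂ) = B.pairing (realSmearing (DF p)) (realSmearing (DG p))

/-- Directional distributional brackets: when integrated against functional derivatives, they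
reproduce the directional Dirac brackets of tangentially extensible with arbitrary complex shear-news
functions, and (on-shell) of proper observables with arbitrary regular functions. -/
structure Brackets.ReproducesDirectional (B : Brackets ε) : Prop where
  complex : ∀ s s' : Smearing ε, s.IsProper → directionalBracketC s s' = B.pairing s s'
  real : ∀ (F G : Phase ε → ℝ) (DF DG : Phase ε → F1 ε × F0 ε), IsProper F DF → IsRegular G DG →
    ∀ p, OnShell p →
      (directionalBracket F G p : ℂ) = B.pairing (realSmearing (DF p)) (realSmearing (DG p))

/-! ### The distributions that enter the formulas

The first argument of each pairing is conjugated: e.g. `dirac f g = ⟨δ(x,x'), f̄(x) g(x')⟩`. -/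

/-- `δ(x,x')`; on any pair of test spaces except `ℱ₀, ℱ₀`, where the integral may diverge. -/
def dirac {i j : Kind} (f : FSpace ε i) (g : FSpace ε j) : ℂ :=
  scriInt fun u R => conj (f u R) * g u R

/-- `𝔇_u Φ`. -/
def Du {j : Kind} (Φ : F1 ε → FSpace ε j → ℂ) (f : F0 ε) (g : FSpace ε j) : ℂ := - Φ (du f) g

/-- `𝔇_{u'} Φ`. -/
def Du' {i : Kind} (Φ : FSpace ε i → F1 ε → ℂ) (f : FSpace ε i) (g : F0 ε) : ℂ := - Φ f (du g)

/-- `𝔇_u⁻ δ(x,x') = ½ (𝔇_u - 𝔇_{u'}) δ(x,x')`. -/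
def DuMinusDirac (f g : F0 ε) : ℂ := (1 / 2 : ℂ) * (Du dirac f g - Du' dirac f g)

/-- The Heaviside function `H(u,u')`: `1` if `u > u'`, `0` otherwise. -/
def heaviside (u u' : ℝ) : ℂ := if u' < u then 1 else 0

/-- `δ(r̂,r̂') H(u,u')`. -/
def diracH (f g : F1 ε) : ℂ :=
  sphereInt fun R => ∫ u, ∫ u', heaviside u u' * (conj (f u R) * g u' R)

/-- `δ(r̂,r̂') H(u',u)`. -/
def diracH' (f g : F1 ε) : ℂ :=
  sphereInt fun R => ∫ u, ∫ u', heaviside u' u * (conj (f u R) * g u' R)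

/-- `δ(r̂,r̂')` on `ℰ`. -/
def diracS (e e' : Elec) : ℂ := sphereInt fun R => conj (e R) * e' R

/-- The general form of the proper brackets, with ambiguities `φ ∈ (ℰ ⊗ ℱ₁)*`, `φ' ∈ (ℰ ⊗ ℱ₀)*`,
`ψ ∈ (ℰ̄ ⊗ ℱ₁)*`, `ψ' ∈ (ℰ̄ ⊗ ℱ₀)*` (elements of `ℰ̄` being written as conjugates of elements of `ℰ`).
In the usual notation:
`{σ̄(x),σ̄(x')} = φ(r̂,x') - φ(r̂',x)`,
`{σ̄(x),N(x')} = φ'(r̂,x') + (L₊(u') - L₋(u')) φ(r̂',x)`,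
`{N(x),N(x')} = (L₊(u') - L₋(u')) φ'(r̂',x) - (L₊(u) - L₋(u)) φ'(r̂,x')`,
`{σ(x),σ̄(x')} = 2π δ(r̂,r̂') (H(u,u') - H(u',u)) + ψ(r̂,x') - ψ̄(r̂',x)`,
`{σ(x),N(x')} = 4π δ(x,x') + 2π δ(r̂,r̂') L₋(u') + (L₊(u') - L₋(u')) ψ̄(r̂',x) + ψ'(r̂,x')`,
`{N̄(x),N(x')} = -4π 𝔇_u⁻ δ(x,x') + (L₋(u) - L₊(u)) ψ'(r̂,x') - (L₋(u') - L₊(u')) ψ̄'(r̂',x)`. -/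
structure Brackets.IsProperForm (hε : 0 < ε) (B : Brackets ε)
    (φ : Bidist Elec (F1 ε)) (φ' : Bidist Elec (F0 ε))
    (ψ : Bidist Elec (F1 ε)) (ψ' : Bidist Elec (F0 ε)) : Prop where
  σbar_σbar : ∀ l l' : F1 ε, B fσbar fσbar l l' = φ (intU hε l) l' - φ (intU hε l') l
  σbar_N : ∀ (l : F1 ε) (α : F0 ε),
    B fσbar fN l α = φ' (intU hε l) α + φ (limPlus α - limMinus α) l
  N_N : ∀ α α' : F0 ε,
    B fN fN α α' = φ' (limPlus α' - limMinus α') α - φ' (limPlus α - limMinus α) α'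
  σ_σbar : ∀ l l' : F1 ε, B fσ fσbar l l' =
    2 * Real.pi * (diracH l l' - diracH' l l') + ψ (intU hε l) l' - conj (ψ (intU hε l') l)
  σ_N : ∀ (l : F1 ε) (α : F0 ε), B fσ fN l α =
    4 * Real.pi * dirac l α + 2 * Real.pi * diracS (intU hε l) (limMinus α) +
      conj (ψ (limPlus α - limMinus α) l) + ψ' (intU hε l) α
  Nbar_N : ∀ α α' : F0 ε, B fNbar fN α α' =
    -4 * Real.pi * DuMinusDirac α α' +
      ψ' (limMinus α - limPlus α) α' - conj (ψ' (limMinus α' - limPlus α') α)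

/-- The general form of the directional brackets, with ambiguities as above.  In the usual notation:
`{σ̄(x);σ̄(x')} = φ(r̂,x')`,
`{N(x);σ̄(x')} = (L₋(u) - L₊(u)) φ(r̂,x')`,
`{σ̄(x);N(x')} = φ'(r̂,x')`,
`{N(x);N(x')} = (L₋(u) - L₊(u)) φ'(r̂,x')`,
`{σ(x);σ̄(x')} = -4π δ(r̂,r̂') H(u',u) + ψ(r̂,x')`,
`{N̄(x);σ̄(x')} = -4π δ(x,x') - 4π δ(r̂,r̂') L₋(u) + (L₋(u) - L₊(u)) ψ(r̂,x')`,
`{σ(x);N(x')} = 4π δ(x,x') + ψ'(r̂,x')`,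
`{N̄(x);N(x')} = -4π 𝔇_u δ(x,x') + (L₋(u) - L₊(u)) ψ'(r̂,x')`. -/
structure Brackets.IsDirectionalForm (hε : 0 < ε) (B : Brackets ε)
    (φ : Bidist Elec (F1 ε)) (φ' : Bidist Elec (F0 ε))
    (ψ : Bidist Elec (F1 ε)) (ψ' : Bidist Elec (F0 ε)) : Prop where
  σbar_σbar : ∀ l l' : F1 ε, B fσbar fσbar l l' = φ (intU hε l) l'
  N_σbar : ∀ (α : F0 ε) (l' : F1 ε), B fN fσbar α l' = φ (limMinus α - limPlus α) l'
  σbar_N : ∀ (l : F1 ε) (α' : F0 ε), B fσbar fN l α' = φ' (intU hε l) α'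
  N_N : ∀ α α' : F0 ε, B fN fN α α' = φ' (limMinus α - limPlus α) α'
  σ_σbar : ∀ l l' : F1 ε, B fσ fσbar l l' =
    -4 * Real.pi * diracH' l l' + ψ (intU hε l) l'
  Nbar_σbar : ∀ (α : F0 ε) (l' : F1 ε), B fNbar fσbar α l' =
    -4 * Real.pi * dirac α l' - 4 * Real.pi * diracS (limMinus α) (intU hε l') +
      ψ (limMinus α - limPlus α) l'
  σ_N : ∀ (l : F1 ε) (α' : F0 ε), B fσ fN l α' =
    4 * Real.pi * dirac l α' + ψ' (intU hε l) α'
  Nbar_N : ∀ α α' : F0 ε, B fNbar fN α α' =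
    -4 * Real.pi * Du dirac α α' + ψ' (limMinus α - limPlus α) α'

end Scri

end

noncomputable section

namespace Scri

/-! ### The frame bundle -/

/-! The whole statement follows from solving one linear system. For smearings `(λ, α)`, Hamilton's
equation with multiplier `φ` reads `Xσ = 8πα + φ`, `XN̄ = ∂φ - 8πλ`. Tangency `XN̄ = -∂Xσ` turns it
into `∂φ = 4π(λ - ∂α)`. With `φ₋ = 0` this gives `φ = 4π(∫^u λ - α + α₋)`, and `φ₊ = 0` is then
exactly the dual constraint `∫λ = α₊ - α₋`. Hence the tangential flow exists on `𝒢_TE`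
(`exists_flow`). It is unique because the pairings separate `ℱ₀` and `ℱ₁` (`flow_unique`), so the
choice made by `Classical.epsilon` is harmless. The complexified problem is two uncoupled copies of
the same system, and a nonlinear observable enters only through its functional derivatives at the
point. All brackets are therefore the explicit bilinear form `dirForm`. On extensible functions the
Dirac and directional brackets agree, since a tangential flow annihilates every smeared constraint
(`diracBracketC_eq`).

Reality reduces sixteen brackets to two blocks: `low`, between fields of spin weight `-2`, and
`mixed`, between spin weights `2` and `-2`. Setting half of the smearings to zero shows that a
system reproduces the brackets iff `low` pairs to zero and `mixed` pairs to `dirBlocks`. Here the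
first argument, and in the proper case the second too, is restricted to `𝒢_TE`
(`Brackets.reproducesDirectional_iff`, `Brackets.reproducesProper_iff`).

The solutions form an affine space. `𝒢_TE` is the kernel of the defect map `d(λ, α) = ∫λ - (α₊ -
α₋)` into `ℰ`, which has a continuous linear right inverse `s`, `sectionL`, with values in `ℱ₁`. A
form `C` that vanishes for first argument in `ker d` satisfies `C(f, g) = C(s d f, g)`, so it is an
arbitrary bidistribution in `(d f, g)`. A form vanishing on `ker d × ker d` is `C(s d f, g) + C(f, s
d g) - C(s d f, s d g)`, which under antisymmetry is `χ(d f, g) - χ(d g, f)`. These are the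
ambiguities `φ, φ', ψ, ψ'`. Particular solutions are `dirBlocks` itself and the antihermitian
`minBlocks`, which agrees with it on `𝒢_TE × 𝒢_TE` after integration by parts (`minBlocks_pair`).

Continuity of all these maps for the Fréchet topologies makes everything a genuine bidistribution.
The anomalies are the boundary terms of `dirac_du_right`, which are nonzero because `ℰ` is. -/

theorem continuous_entries : Continuous entries :=
  continuous_pi fun i => continuous_pi fun j =>
    (continuous_apply_apply i j).comp continuous_subtype_val

theorem orthogonality (R : SO3) : (R : Matrix (Fin 3) (Fin 3) ℝ) * (R : Matrix (Fin 3) (Fin 3) ℝ).transpose = 1 := by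
  have h := (Matrix.mem_specialOrthogonalGroup_iff.1 R.2).1
  exact (Matrix.mem_orthogonalGroup_iff _ _).1 h

theorem orthogonality' (R : SO3) : (R : Matrix (Fin 3) (Fin 3) ℝ).transpose * (R : Matrix (Fin 3) (Fin 3) ℝ) = 1 := by
  have h := (Matrix.mem_specialOrthogonalGroup_iff.1 R.2).1
  exact (Matrix.mem_orthogonalGroup_iff' _ _).1 h

/-- Rows of an orthogonal matrix are unit vectors. Frames therefore lie in a compact box of the
ambient space, where smooth extensions are bounded. -/
theorem abs_entries_le (R : SO3) (i j : Fin 3) : |entries R i j| ≤ 1 := by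
  have h := congrFun (congrFun (orthogonality R) i) i
  simp only [Matrix.mul_apply, Matrix.transpose_apply, Matrix.one_apply_eq] at h
  have h1 : (R : Matrix (Fin 3) (Fin 3) ℝ) i j * (R : Matrix (Fin 3) (Fin 3) ℝ) i j ≤ 1 := by
    rw [← h]
    exact Finset.single_le_sum (f := fun j => (R : Matrix (Fin 3) (Fin 3) ℝ) i j *
      (R : Matrix (Fin 3) (Fin 3) ℝ) i j) (fun k _ => mul_self_nonneg _) (Finset.mem_univ j)
  exact abs_le_one_iff_mul_self_le_one.2 h1

theorem entries_mem (R : SO3) : entries R ∈ Set.pi Set.univ fun _ : Fin 3 =>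
    Set.pi Set.univ fun _ : Fin 3 => Set.Icc (-1 : ℝ) 1 :=
  fun i _ j _ => abs_le.1 (abs_entries_le R i j)

theorem isCompact_entries_box : IsCompact (Set.pi Set.univ fun _ : Fin 3 =>
    Set.pi Set.univ fun _ : Fin 3 => Set.Icc (-1 : ℝ) 1) :=
  isCompact_univ_pi fun _ => isCompact_univ_pi fun _ => isCompact_Icc

/-! ### Smoothness -/

theorem ScriSmooth.continuous {f : ℝ → SO3 → ℂ} (hf : ScriSmooth f) :
    Continuous fun x : ℝ × SO3 => f x.1 x.2 := by
  obtain ⟨F, hF, hF'⟩ := hf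
  simp only [hF']
  exact hF.continuous.comp (continuous_fst.prodMk (continuous_entries.comp continuous_snd))

/-- Smooth functions are bounded over compact intervals. -/
theorem ScriSmooth.bounded_of_compact {f : ℝ → SO3 → ℂ} (hf : ScriSmooth f) {s : Set ℝ}
    (hs : IsCompact s) : ∃ C : ℝ, ∀ u ∈ s, ∀ R, ‖f u R‖ ≤ C := by
  obtain ⟨F, hF, hF'⟩ := hf
  obtain ⟨C, hC⟩ := (hs.prod isCompact_entries_box).exists_bound_of_continuousOn
    hF.continuous.continuousOn
  exact ⟨C, fun u hu R => by rw [hF']; exact hC _ ⟨hu, entries_mem R⟩⟩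

theorem ScriSmooth.const_mul_left {f : ℝ → SO3 → ℂ} (hf : ScriSmooth f) {χ : ℝ → ℝ}
    (hχ : ContDiff ℝ ∞ χ) : ScriSmooth fun u R => (χ u : ℂ) * f u R := by
  obtain ⟨F, hF, hF'⟩ := hf
  exact ⟨fun x => (χ x.1 : ℂ) * F x,
    (Complex.ofRealCLM.contDiff.comp (hχ.comp contDiff_fst)).mul hF, fun u R => by simp only [hF']⟩

theorem ScriSmooth.deriv {f : ℝ → SO3 → ℂ} (hf : ScriSmooth f) :
    ScriSmooth fun u R => deriv (fun v => f v R) u := by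
  obtain ⟨F, hF, hF'⟩ := hf
  refine ⟨fun x => fderiv ℝ F x (1, 0),
    (hF.fderiv_right (m := ∞) (by simp)).clm_apply contDiff_const, fun u R => ?_⟩
  simp only [hF']
  have h2 : HasDerivAt (fun v : ℝ => (v, entries R)) ((1 : ℝ), 0) u :=
    (hasDerivAt_id _).prodMk (hasDerivAt_const _ _)
  exact (((hF.differentiable (by simp)).differentiableAt.hasFDerivAt).comp_hasDerivAt u h2).deriv

theorem ScriSmooth.iteratedDeriv {f : ℝ → SO3 → ℂ} (hf : ScriSmooth f) (k : ℕ) :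
    ScriSmooth fun u R => iteratedDeriv k (fun v => f v R) u := by
  induction k with
  | zero => simpa using hf
  | succ k ih => simpa only [iteratedDeriv_succ] using ih.deriv

/-- Derivatives in `u` and along the sphere commute. -/
theorem ScriSmooth.alongCurve_deriv {γ : ℝ → SO3} {E : Fin 3 → Fin 3 → ℝ} (hγ : IsCurve γ E)
    {f : ℝ → SO3 → ℂ} (hf : ScriSmooth f) (u : ℝ) (R : SO3) :
    Scri.alongCurve γ (fun R => _root_.deriv (fun v => f v R) u) R =
      _root_.deriv (fun v => Scri.alongCurve γ (f v) R) u := by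
  obtain ⟨F, hF, hF'⟩ := hf
  have hF1 : ContDiff ℝ ∞ (fderiv ℝ F) := hF.fderiv_right (by simp)
  set V : Fin 3 → Fin 3 → ℝ := fun i j => ∑ k, entries R i k * E k j
  have hu : ∀ (v : ℝ) (S : SO3), HasDerivAt (fun v => f v S) (fderiv ℝ F (v, entries S) (1, 0)) v := by
    intro v S
    simp only [hF']
    have h2 : HasDerivAt (fun v : ℝ => (v, entries S)) ((1 : ℝ), 0) v :=
      (hasDerivAt_id _).prodMk (hasDerivAt_const _ _)
    exact ((hF.differentiable (by simp)).differentiableAt.hasFDerivAt).comp_hasDerivAt v h2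
  have h1 : ∀ v, Scri.alongCurve γ (f v) R = fderiv ℝ F (v, entries R) (0, V) := by
    intro v
    have : (fun t => f v (R * γ t)) = fun t => F (v, entries (R * γ t)) := by
      funext t; exact hF' v _
    change _root_.deriv (fun t => f v (R * γ t)) 0 = _
    rw [this]
    exact (ScriSmooth.hasDerivAt hγ hF v R).deriv
  have h2 : HasDerivAt (fun v => fderiv ℝ F (v, entries R) (0, V))
      (fderiv ℝ (fderiv ℝ F) (u, entries R) (1, 0) (0, V)) u := by
    have h3 : HasDerivAt (fun v : ℝ => (v, entries R)) ((1 : ℝ), 0) u :=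
      (hasDerivAt_id _).prodMk (hasDerivAt_const _ _)
    have h4 := ((hF1.differentiable (by simp)).differentiableAt
      (x := (u, entries R)).hasFDerivAt).comp_hasDerivAt u h3
    exact h4.clm_apply (hasDerivAt_const u _) |>.congr_deriv (by simp)
  have h5 : ContDiff ℝ ∞ fun x => fderiv ℝ F x (1, 0) := hF1.clm_apply contDiff_const
  have h6 : Scri.alongCurve γ (fun R => _root_.deriv (fun v => f v R) u) R =
      fderiv ℝ (fun x => fderiv ℝ F x (1, 0)) (u, entries R) (0, V) := by
    have : (fun t => _root_.deriv (fun v => f v (R * γ t)) u) =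
        fun t => (fun x => fderiv ℝ F x (1, 0)) (u, entries (R * γ t)) := by
      funext t; exact (hu u _).deriv
    change _root_.deriv (fun t => _root_.deriv (fun v => f v (R * γ t)) u) 0 = _
    rw [this]
    exact (ScriSmooth.hasDerivAt hγ h5 u R).deriv
  simp only [h1]
  rw [h2.deriv, h6, fderiv_clm_apply ((hF1.differentiable (by simp)).differentiableAt)
    (differentiableAt_const _)]
  simp only [fderiv_fun_const, Pi.zero_apply, ContinuousLinearMap.comp_zero, zero_add,
    ContinuousLinearMap.flip_apply]
  -- Both mixed derivatives have become values of the second derivative of the ambient extension, so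
  -- only its symmetry is left.
  exact (hF.contDiffAt.isSymmSndFDerivAt (by
    simp only [minSmoothness_of_isRCLikeNormedField]; exact WithTop.coe_le_coe.2 le_top)) _ _

theorem ScriSmooth.word_deriv {f : ℝ → SO3 → ℂ} (hf : ScriSmooth f) (w : List Bool) (u : ℝ) :
    Scri.word w (fun R => _root_.deriv (fun v => f v R) u) =
      fun R => _root_.deriv (fun v => Scri.word w (f v) R) u := by
  induction w with
  | nil => rfl
  | cons b w ih =>
    funext R
    have h1 := (hf.word w).alongCurve_deriv isCurve_rotE₁ u R
    have h2 := (hf.word w).alongCurve_deriv isCurve_rotE₂ u R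
    have d1 : DifferentiableAt ℝ (fun v => Scri.alongCurve rotE₁ (Scri.word w (f v)) R) u :=
      (((hf.word w).alongCurve isCurve_rotE₁).contDiff R).differentiable (by simp) u
    have d2 : DifferentiableAt ℝ (fun v => Scri.alongCurve rotE₂ (Scri.word w (f v)) R) u :=
      (((hf.word w).alongCurve isCurve_rotE₂).contDiff R).differentiable (by simp) u
    cases b
    · simp only [Scri.word, ih, ethBar, h1, h2]
      rw [deriv_const_mul_field, deriv_fun_add d1 (d2.const_mul _), deriv_const_mul_field]
    · simp only [Scri.word, ih, eth, h1, h2]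
      rw [deriv_const_mul_field, deriv_fun_sub d1 (d2.const_mul _), deriv_const_mul_field]

/-! ### Spin weights -/

theorem rotZ_mul_rotZ (s t : ℝ) : rotZ s * rotZ t = rotZ (s + t) := by
  ext i j
  fin_cases i <;> fin_cases j <;>
    simp [rotZ, Real.cos_add, Real.sin_add] <;> ring

theorem rotZ_zero : rotZ 0 = 1 := by
  ext i j
  fin_cases i <;> fin_cases j <;> simp [rotZ]

/-- The velocity transforms by the adjoint action. With `S = rotZ ψ` this compares derivatives at a
rotated frame with those at the original one. -/
theorem IsCurve.conj {γ : ℝ → SO3} {E : Fin 3 → Fin 3 → ℝ} (hγ : IsCurve γ E) {S T : SO3}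
    (hST : S * T = 1) : IsCurve (fun t => S * γ t * T)
      (fun i j => ∑ l, (∑ k, entries S i k * E k l) * entries T l j) := by
  refine ⟨by simp [hγ.1, hST], fun i j => ?_⟩
  simp only [entries_mul]
  exact HasDerivAt.fun_sum fun l _ =>
    (HasDerivAt.fun_sum fun k _ => (hγ.2 k l).const_mul _).mul_const _

theorem rotZ_mul_rotZ_neg (ψ : ℝ) : rotZ ψ * rotZ (-ψ) = 1 := by
  rw [rotZ_mul_rotZ, add_neg_cancel, rotZ_zero]

/-- Moving `rotZ ψ` past `γ t` conjugates the curve and leaves `rotZ ψ` on the right, where the spin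
weight absorbs it. -/
theorem HasSpin.alongCurve {s : ℤ} {h : SO3 → ℂ} (hh : HasSpin s h) (γ : ℝ → SO3) (R : SO3)
    (ψ : ℝ) : Scri.alongCurve γ h (R * rotZ ψ) = Complex.exp (Complex.I * s * ψ) *
      Scri.alongCurve (fun t => rotZ ψ * γ t * rotZ (-ψ)) h R := by
  simp only [Scri.alongCurve]
  rw [← deriv_const_mul_field]
  congr 1
  funext t
  rw [← hh]
  congr 1
  rw [mul_assoc, mul_assoc, mul_assoc, rotZ_mul_rotZ, neg_add_cancel, rotZ_zero, mul_one,
    ← mul_assoc]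

/-- The directional derivative of a smooth function depends linearly on the velocity. -/
theorem ScriSmooth.alongCurve_linear {f : ℝ → SO3 → ℂ} (hf : ScriSmooth f) (u : ℝ) (R : SO3)
    {γ γ₁ γ₂ : ℝ → SO3} {E E₁ E₂ : Fin 3 → Fin 3 → ℝ} (hγ : IsCurve γ E) (h₁ : IsCurve γ₁ E₁)
    (h₂ : IsCurve γ₂ E₂) {a b : ℝ} (hE : ∀ i j, E i j = a * E₁ i j + b * E₂ i j) :
    Scri.alongCurve γ (f u) R =
      a * Scri.alongCurve γ₁ (f u) R + b * Scri.alongCurve γ₂ (f u) R := by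
  obtain ⟨F, hF, hF'⟩ := hf
  have key : ∀ γ E, IsCurve γ E → Scri.alongCurve γ (f u) R =
      fderiv ℝ F (u, entries R) (0, fun i j => ∑ k, entries R i k * E k j) := by
    intro γ E hγ
    have : (fun t => f u (R * γ t)) = fun t => F (u, entries (R * γ t)) := by
      funext t; exact hF' u _
    change _root_.deriv (fun t => f u (R * γ t)) 0 = _
    rw [this]
    exact (ScriSmooth.hasDerivAt hγ hF u R).deriv
  rw [key _ _ hγ, key _ _ h₁, key _ _ h₂, ← Complex.real_smul, ← Complex.real_smul,
    ← map_smul, ← map_smul, ← map_add]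
  congr 1
  ext i j
  · simp
  · simp only [hE, Prod.snd_add, Prod.smul_snd, Pi.add_apply, Pi.smul_apply, smul_eq_mul,
      Finset.mul_sum, ← Finset.sum_add_distrib]
    exact Finset.sum_congr rfl fun k _ => by ring

/-- The adjoint action of `rotZ ψ` rotates the two horizontal generators into each other by the
angle `ψ`. -/
theorem ScriSmooth.alongCurve_rotE₁_mul_rotZ {f : ℝ → SO3 → ℂ} (hf : ScriSmooth f) {s : ℤ}
    {u : ℝ} (hs : HasSpin s (f u)) (R : SO3) (ψ : ℝ) :
    Scri.alongCurve rotE₁ (f u) (R * rotZ ψ) = Complex.exp (Complex.I * s * ψ) *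
      (Real.cos ψ * Scri.alongCurve rotE₁ (f u) R + Real.sin ψ * Scri.alongCurve rotE₂ (f u) R) := by
  rw [hs.alongCurve, hf.alongCurve_linear u R (isCurve_rotE₁.conj (rotZ_mul_rotZ_neg ψ))
    isCurve_rotE₁ isCurve_rotE₂ (a := Real.cos ψ) (b := Real.sin ψ)]
  intro i j
  fin_cases i <;> fin_cases j <;> simp [entries, rotZ, Fin.sum_univ_three]

theorem ScriSmooth.alongCurve_rotE₂_mul_rotZ {f : ℝ → SO3 → ℂ} (hf : ScriSmooth f) {s : ℤ}
    {u : ℝ} (hs : HasSpin s (f u)) (R : SO3) (ψ : ℝ) :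
    Scri.alongCurve rotE₂ (f u) (R * rotZ ψ) = Complex.exp (Complex.I * s * ψ) *
      ((-Real.sin ψ : ℝ) * Scri.alongCurve rotE₁ (f u) R +
        Real.cos ψ * Scri.alongCurve rotE₂ (f u) R) := by
  rw [hs.alongCurve, hf.alongCurve_linear u R (isCurve_rotE₂.conj (rotZ_mul_rotZ_neg ψ))
    isCurve_rotE₁ isCurve_rotE₂ (a := -Real.sin ψ) (b := Real.cos ψ)]
  intro i j
  fin_cases i <;> fin_cases j <;> simp [entries, rotZ, Fin.sum_univ_three]

/-- Rotating the horizontal directions by `ψ` multiplies `∂₁ - i∂₂` by `exp (iψ)`, which accounts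
for the extra unit of spin. -/
theorem ScriSmooth.hasSpin_eth {f : ℝ → SO3 → ℂ} (hf : ScriSmooth f) {s s' : ℤ} {u : ℝ}
    (hs : HasSpin s (f u)) (hs' : s' = s + 1) : HasSpin s' (eth (f u)) := by
  subst hs'
  intro R ψ
  simp only [eth, hf.alongCurve_rotE₁_mul_rotZ hs, hf.alongCurve_rotE₂_mul_rotZ hs]
  have h1 : Complex.exp (Complex.I * ((s + 1 : ℤ) : ℂ) * ψ) =
      Complex.exp (Complex.I * s * ψ) * (Real.cos ψ + Real.sin ψ * Complex.I) := by
    push_cast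
    rw [← Complex.exp_mul_I, ← Complex.exp_add]
    ring_nf
  rw [h1]
  push_cast
  ring_nf
  simp only [Complex.I_sq]
  ring

theorem Elec.scriSmooth (e : Elec) : ScriSmooth fun _ R => e R := by
  obtain ⟨ξ, h1, -, -, h4⟩ := e.2
  simp only [h4]
  exact h1.toScri.word [true, true]

theorem Elec.hasSpin (e : Elec) : HasSpin 2 (e : SO3 → ℂ) := by
  obtain ⟨ξ, h1, h2, -, h4⟩ := e.2
  have h5 : HasSpin 1 (eth ξ) := h1.toScri.hasSpin_eth (u := 0) h2 (by norm_num)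
  have h6 : HasSpin 2 (eth (eth ξ)) :=
    ScriSmooth.hasSpin_eth (f := fun _ => eth ξ) (u := 0) (h1.toScri.word [true]) h5 (by norm_num)
  intro R ψ
  simp only [h4]
  exact h6 R ψ

/-! ### Polar coordinates -/

theorem exists_angle {x y r : ℝ} (hr : 0 ≤ r) (h : x ^ 2 + y ^ 2 = r ^ 2) :
    ∃ t ∈ Set.Icc 0 (2 * Real.pi), x = r * Real.cos t ∧ y = r * Real.sin t := by
  set z : ℂ := ⟨x, y⟩
  have hz : ‖z‖ = r := by
    rw [Complex.norm_eq_sqrt_sq_add_sq]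
    simp only [z, h]
    exact Real.sqrt_sq hr
  have hx : x = r * Real.cos z.arg := by rw [← hz]; exact (Complex.norm_mul_cos_arg z).symm
  have hy : y = r * Real.sin z.arg := by rw [← hz]; exact (Complex.norm_mul_sin_arg z).symm
  have h1 := Complex.neg_pi_lt_arg z
  have h2 := Complex.arg_le_pi z
  have hp := Real.pi_pos
  -- The argument lies in `(-π, π]`; negative values are shifted by `2π` to match the range of
  -- integration in `sphereInt`.
  rcases le_or_gt 0 z.arg with h0 | h0
  · exact ⟨z.arg, ⟨h0, by linarith⟩, hx, hy⟩
  · exact ⟨z.arg + 2 * Real.pi, ⟨by linarith, by linarith⟩, by simpa using hx, by simpa using hy⟩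

/-- A third column equal to the pole forces the third row by normalisation. What remains is a 2×2
orthogonal block of determinant one, hence a plane rotation. -/
theorem exists_rotZ {Q : SO3} (h0 : entries Q 0 2 = 0) (h1 : entries Q 1 2 = 0)
    (h2 : entries Q 2 2 = 1) : ∃ ψ, Q = rotZ ψ := by
  simp only [entries] at h0 h1 h2
  have hr := fun i j => congrFun (congrFun (orthogonality Q) i) j
  have hc := fun i j => congrFun (congrFun (orthogonality' Q) i) j
  have hd := (Matrix.mem_specialOrthogonalGroup_iff.1 Q.2).2
  simp only [Matrix.mul_apply, Matrix.transpose_apply, Fin.sum_univ_three] at hr hc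
  rw [Matrix.det_fin_three] at hd
  have r22 := hr 2 2
  rw [h2] at r22
  simp only [Matrix.one_apply_eq] at r22
  obtain ⟨M, hM⟩ : ∃ M, M = (Q : Matrix (Fin 3) (Fin 3) ℝ) := ⟨_, rfl⟩
  rw [← hM] at h0 h1 h2 hr hc r22 hd
  have h20 : M 2 0 = 0 := by nlinarith [sq_nonneg (M 2 0), sq_nonneg (M 2 1)]
  have h21 : M 2 1 = 0 := by nlinarith [sq_nonneg (M 2 0), sq_nonneg (M 2 1)]
  have c00 := hc 0 0
  have c01 := hc 0 1
  simp [h20, h21] at c00 c01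
  simp only [h0, h1, h2, h20, h21] at hd
  obtain ⟨ψ, -, hcos, hsin⟩ := exists_angle (x := M 0 0) (y := M 1 0) zero_le_one (by linarith)
  have h11 : M 1 1 = M 0 0 := by linear_combination (-M 1 1) * c00 + M 1 0 * c01 + M 0 0 * hd
  have h01 : M 0 1 = -M 1 0 := by linear_combination (-M 0 1) * c00 + M 0 0 * c01 - M 1 0 * hd
  refine ⟨ψ, Subtype.ext ?_⟩
  rw [← hM]
  ext i j
  rw [one_mul] at hcos hsin
  fin_cases i <;> fin_cases j <;> simp [rotZ, h0, h1, h2, h20, h21, h11, h01, hcos, hsin]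

/-- Spherical coordinates of `r̂` give a polar frame with the same third column, so the two frames
differ by a `rotZ`. Functions of spin weight 0 are thus determined by the polar frames over which
`sphereInt` integrates. -/
theorem exists_polarFrame (R : SO3) : ∃ θ ∈ Set.Icc 0 Real.pi, ∃ φ ∈ Set.Icc 0 (2 * Real.pi),
    ∃ ψ, R = polarFrame θ φ * rotZ ψ := by
  have hc := congrFun (congrFun (orthogonality' R) 2) 2
  simp only [Matrix.mul_apply, Matrix.transpose_apply, Fin.sum_univ_three,
    Matrix.one_apply_eq] at hc
  set M := (R : Matrix (Fin 3) (Fin 3) ℝ) with hM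
  set θ := Real.arccos (M 2 2)
  have hcos : Real.cos θ = M 2 2 :=
    Real.cos_arccos (by nlinarith [sq_nonneg (M 0 2), sq_nonneg (M 1 2)])
      (by nlinarith [sq_nonneg (M 0 2), sq_nonneg (M 1 2)])
  have hθ : θ ∈ Set.Icc 0 Real.pi := ⟨Real.arccos_nonneg _, Real.arccos_le_pi _⟩
  have hs := Real.sin_sq_add_cos_sq θ
  obtain ⟨φ, hφ, hx, hy⟩ := exists_angle (x := M 0 2) (y := M 1 2)
    (Real.sin_nonneg_of_mem_Icc hθ) (by rw [hcos] at hs; linarith)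
  have hf := Real.sin_sq_add_cos_sq φ
  have hi : ∀ i j, entries (polarFrame θ φ)⁻¹ i j = entries (polarFrame θ φ) j i := fun i j => rfl
  have he : ∀ i j, entries ((polarFrame θ φ)⁻¹ * R) i j =
      ∑ k, (∑ l, entries (rotZ φ) k l * entries (rotE₁ θ) l i) * entries R k j := by
    intro i j
    rw [entries_mul]
    simp only [hi]
    simp only [polarFrame, entries_mul]
  obtain ⟨ψ, hψ⟩ : ∃ ψ, (polarFrame θ φ)⁻¹ * R = rotZ ψ := by
    apply exists_rotZ <;> rw [he] <;>
      simp only [Fin.sum_univ_three, entries, rotZ, rotE₁, ← hM, hx, hy, ← hcos] <;> simp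
    · linear_combination Real.cos θ * Real.sin θ * hf
    · ring
    · linear_combination Real.sin θ ^ 2 * hf + hs
  exact ⟨θ, hθ, φ, hφ, ψ, by rw [← hψ, mul_inv_cancel_left]⟩

/-! ### Integration over the sphere -/

theorem isInducing_entries : IsInducing entries := by
  have h : IsInducing (fun R : SO3 => (R : Matrix (Fin 3) (Fin 3) ℝ)) := IsInducing.subtypeVal
  exact h

/-- Dominated convergence for integrals depending on a frame works with sequences, hence needs this.
-/
instance : FirstCountableTopology SO3 := isInducing_entries.firstCountableTopology

theorem continuous_rotZ : Continuous rotZ := by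
  refine isInducing_entries.continuous_iff.2 (continuous_pi fun i => continuous_pi fun j => ?_)
  fin_cases i <;> fin_cases j <;> simp [entries, rotZ] <;> fun_prop

theorem continuous_rotE₁ : Continuous rotE₁ := by
  refine isInducing_entries.continuous_iff.2 (continuous_pi fun i => continuous_pi fun j => ?_)
  fin_cases i <;> fin_cases j <;> simp [entries, rotE₁] <;> fun_prop

theorem continuous_mul_SO3 : Continuous fun x : SO3 × SO3 => x.1 * x.2 := by
  refine isInducing_entries.continuous_iff.2 (continuous_pi fun i => continuous_pi fun j => ?_)
  simp only [Function.comp_def, entries_mul]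
  have h : ∀ i j, Continuous fun R : SO3 => entries R i j := fun i j =>
    (continuous_apply_apply i j).comp continuous_entries
  exact continuous_finsetSum _ fun k _ =>
    ((h i k).comp continuous_fst).mul ((h k j).comp continuous_snd)

theorem continuous_polarFrame : Continuous fun x : ℝ × ℝ => polarFrame x.1 x.2 :=
  continuous_mul_SO3.comp ((continuous_rotZ.comp continuous_snd).prodMk
    (continuous_rotE₁.comp continuous_fst))

theorem continuous_sphere_integrand {h : SO3 → ℂ} (hh : Continuous h) :
    Continuous fun x : ℝ × ℝ => (Real.sin x.1 : ℂ) * h (polarFrame x.1 x.2) := by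
  have h1 : Continuous fun x : ℝ × ℝ => h (polarFrame x.1 x.2) := hh.comp continuous_polarFrame
  exact (by fun_prop : Continuous fun x : ℝ × ℝ => (Real.sin x.1 : ℂ)).mul h1

theorem continuous_sphere_inner {h : SO3 → ℂ} (hh : Continuous h) :
    Continuous fun θ : ℝ => ∫ φ in (0 : ℝ)..(2 * Real.pi), (Real.sin θ : ℂ) * h (polarFrame θ φ) :=
  intervalIntegral.continuous_parametric_intervalIntegral_of_continuous'
    (continuous_sphere_integrand hh) _ _

theorem continuous_sphere_fiber {h : SO3 → ℂ} (hh : Continuous h) (θ : ℝ) :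
    Continuous fun φ : ℝ => (Real.sin θ : ℂ) * h (polarFrame θ φ) := by
  have h1 : Continuous fun φ : ℝ => ((θ, φ) : ℝ × ℝ) := by fun_prop
  simpa only [Function.comp_def] using (continuous_sphere_integrand hh).comp h1

theorem sphereInt_add {g h : SO3 → ℂ} (hg : Continuous g) (hh : Continuous h) :
    sphereInt (fun R => g R + h R) = sphereInt g + sphereInt h := by
  simp only [sphereInt, mul_add]
  rw [← intervalIntegral.integral_add ((continuous_sphere_inner hg).intervalIntegrable _ _)
    ((continuous_sphere_inner hh).intervalIntegrable _ _)]
  congr 1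
  funext θ
  exact intervalIntegral.integral_add ((continuous_sphere_fiber hg θ).intervalIntegrable _ _)
    ((continuous_sphere_fiber hh θ).intervalIntegrable _ _)

theorem sphereInt_const_mul (c : ℂ) (h : SO3 → ℂ) :
    sphereInt (fun R => c * h R) = c * sphereInt h := by
  simp only [sphereInt, ← intervalIntegral.integral_const_mul]
  congr 1; funext θ; congr 1; funext φ
  ring

theorem sphereInt_neg (h : SO3 → ℂ) : sphereInt (fun R => -h R) = -sphereInt h := by
  simpa using sphereInt_const_mul (-1) h

theorem sphereInt_sub {g h : SO3 → ℂ} (hg : Continuous g) (hh : Continuous h) :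
    sphereInt (fun R => g R - h R) = sphereInt g - sphereInt h := by
  simp only [sub_eq_add_neg]
  rw [← sphereInt_neg]
  exact sphereInt_add hg hh.neg

theorem sphereInt_conj (h : SO3 → ℂ) : sphereInt (fun R => conj (h R)) = conj (sphereInt h) := by
  simp only [sphereInt, intervalIntegral, map_sub, ← integral_conj, map_mul, Complex.conj_ofReal]

/-- Bounding `|sin θ|` by `1` gives the crude area `π · 2π` instead of `4π`; the constant is
irrelevant for continuity estimates. -/
theorem norm_sphereInt_le {h : SO3 → ℂ} {C : ℝ} (hC : ∀ R, ‖h R‖ ≤ C) :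
    ‖sphereInt h‖ ≤ 2 * Real.pi ^ 2 * C := by
  have hp := Real.pi_pos
  have h1 : ∀ θ, ‖∫ φ in (0 : ℝ)..(2 * Real.pi), (Real.sin θ : ℂ) * h (polarFrame θ φ)‖ ≤
      C * (2 * Real.pi) := by
    intro θ
    have := intervalIntegral.norm_integral_le_of_norm_le_const (a := 0) (b := 2 * Real.pi)
      (f := fun φ => (Real.sin θ : ℂ) * h (polarFrame θ φ)) (C := C) fun φ _ => ?_
    · rwa [sub_zero, abs_of_pos (by positivity)] at this
    · rw [norm_mul, Complex.norm_real]
      calc ‖Real.sin θ‖ * ‖h (polarFrame θ φ)‖ ≤ 1 * ‖h (polarFrame θ φ)‖ := by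
            gcongr; exact Real.abs_sin_le_one θ
        _ ≤ C := by rw [one_mul]; exact hC _
  have := intervalIntegral.norm_integral_le_of_norm_le_const (a := 0) (b := Real.pi)
    (f := fun θ => ∫ φ in (0 : ℝ)..(2 * Real.pi), (Real.sin θ : ℂ) * h (polarFrame θ φ))
    fun θ _ => h1 θ
  rw [sub_zero, abs_of_pos hp] at this
  unfold sphereInt
  linarith

/-- A continuous nonnegative function of spin weight 0 with vanishing integral vanishes. -/
theorem eq_zero_of_sphereInt_eq_zero {g : SO3 → ℝ} (hg : Continuous g) (h0 : ∀ R, 0 ≤ g R)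
    (hs : ∀ R ψ, g (R * rotZ ψ) = g R) (hI : sphereInt (fun R => (g R : ℂ)) = 0) (R : SO3) :
    g R = 0 := by
  obtain ⟨θ₀, hθ₀, φ₀, hφ₀, ψ, rfl⟩ := exists_polarFrame R
  rw [hs]
  by_contra hne
  have hpos : 0 < g (polarFrame θ₀ φ₀) := lt_of_le_of_ne (h0 _) (Ne.symm hne)
  have hp := Real.pi_pos
  have hgc : Continuous fun x : ℝ × ℝ => g (polarFrame x.1 x.2) := hg.comp continuous_polarFrame
  -- The weight `sin θ` vanishes at the poles, so positivity is first carried by continuity to an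
  -- interior `θ`.
  obtain ⟨θ, hθ, hθp⟩ : ∃ θ ∈ Set.Ioo 0 Real.pi, 0 < g (polarFrame θ φ₀) := by
    have h1 : Continuous fun θ : ℝ => ((θ, φ₀) : ℝ × ℝ) := by fun_prop
    have h2 : Continuous fun θ : ℝ => g (polarFrame θ φ₀) := by
      simpa only [Function.comp_def] using hgc.comp h1
    have ho : IsOpen {θ | 0 < g (polarFrame θ φ₀)} := isOpen_lt continuous_const h2
    rw [← closure_Ioo hp.ne] at hθ₀
    obtain ⟨θ, h1, h2⟩ := mem_closure_iff.1 hθ₀ _ ho hpos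
    exact ⟨θ, h2, h1⟩
  have hgi : Continuous fun x : ℝ × ℝ => Real.sin x.1 * g (polarFrame x.1 x.2) :=
    (Real.continuous_sin.comp continuous_fst).mul hgc
  have hgf : Continuous fun φ : ℝ => Real.sin θ * g (polarFrame θ φ) := by
    have h1 : Continuous fun φ : ℝ => ((θ, φ) : ℝ × ℝ) := by fun_prop
    simpa only [Function.comp_def] using hgi.comp h1
  have hgo : Continuous fun θ : ℝ => ∫ φ in (0 : ℝ)..(2 * Real.pi),
      Real.sin θ * g (polarFrame θ φ) :=
    intervalIntegral.continuous_parametric_intervalIntegral_of_continuous' hgi _ _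
  have hnn : ∀ θ ∈ Set.Icc 0 Real.pi, ∀ φ, 0 ≤ Real.sin θ * g (polarFrame θ φ) := fun θ hθ φ =>
    mul_nonneg (Real.sin_nonneg_of_mem_Icc hθ) (h0 _)
  have key : 0 < ∫ θ in (0 : ℝ)..Real.pi, ∫ φ in (0 : ℝ)..(2 * Real.pi),
      Real.sin θ * g (polarFrame θ φ) := by
    refine intervalIntegral.integral_pos hp hgo.continuousOn (fun θ hθ =>
      intervalIntegral.integral_nonneg (by positivity) fun φ _ => hnn θ ⟨hθ.1.le, hθ.2⟩ φ)
      ⟨θ, ⟨hθ.1.le, hθ.2.le⟩, ?_⟩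
    exact intervalIntegral.integral_pos (by positivity)
      hgf.continuousOn
      (fun φ _ => hnn θ ⟨hθ.1.le, hθ.2.le⟩ φ)
      ⟨φ₀, hφ₀, mul_pos (Real.sin_pos_of_mem_Ioo hθ) hθp⟩
  have h3 : sphereInt (fun R => (g R : ℂ)) = ((∫ θ in (0 : ℝ)..Real.pi,
      ∫ φ in (0 : ℝ)..(2 * Real.pi), Real.sin θ * g (polarFrame θ φ) : ℝ) : ℂ) := by
    simp only [sphereInt, ← Complex.ofReal_mul, intervalIntegral.integral_ofReal]
  rw [h3] at hI
  exact key.ne' (Complex.ofReal_eq_zero.1 hI)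

/-! ### Integration over `𝓘` -/

/-- Continuous functions dominated by an integrable function of `u`. -/
structure Tame (f : ℝ → SO3 → ℂ) : Prop where
  cont : Continuous fun x : ℝ × SO3 => f x.1 x.2
  bound : ∃ b : ℝ → ℝ, Integrable b ∧ ∀ u R, ‖f u R‖ ≤ b u

namespace Tame

variable {f g : ℝ → SO3 → ℂ}

theorem continuous_left (hf : Tame f) (R : SO3) : Continuous fun u => f u R :=
  hf.cont.comp (continuous_id.prodMk continuous_const)

theorem continuous_right (hf : Tame f) (u : ℝ) : Continuous fun R => f u R :=
  hf.cont.comp (continuous_const.prodMk continuous_id)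

theorem integrable (hf : Tame f) (R : SO3) : Integrable fun u => f u R := by
  obtain ⟨b, hb, h⟩ := hf.bound
  exact hb.mono' (hf.continuous_left R).aestronglyMeasurable (Eventually.of_forall fun u => h u R)

theorem continuous_integral (hf : Tame f) : Continuous fun R => ∫ u, f u R := by
  obtain ⟨b, hb, h⟩ := hf.bound
  exact continuous_of_dominated (fun R => (hf.continuous_left R).aestronglyMeasurable)
    (fun R => Eventually.of_forall fun u => h u R) hb
    (Eventually.of_forall fun u => hf.continuous_right u)

theorem add (hf : Tame f) (hg : Tame g) : Tame fun u R => f u R + g u R := by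
  obtain ⟨b, hb, h⟩ := hf.bound
  obtain ⟨c, hc, k⟩ := hg.bound
  exact ⟨hf.cont.add hg.cont, fun u => b u + c u, hb.add hc, fun u R =>
    (norm_add_le _ _).trans (add_le_add (h u R) (k u R))⟩

theorem mul_bounded (hf : Tame f) (hg : Continuous fun x : ℝ × SO3 => g x.1 x.2) {C : ℝ}
    (hC : ∀ u R, ‖g u R‖ ≤ C) : Tame fun u R => f u R * g u R := by
  obtain ⟨b, hb, h⟩ := hf.bound
  exact ⟨hf.cont.mul hg, fun u => b u * C, hb.mul_const C, fun u R => by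
    rw [norm_mul]
    exact mul_le_mul (h u R) (hC u R) (norm_nonneg _) ((norm_nonneg _).trans (h u R))⟩

theorem bounded_mul (hf : Tame f) (hg : Continuous fun x : ℝ × SO3 => g x.1 x.2) {C : ℝ}
    (hC : ∀ u R, ‖g u R‖ ≤ C) : Tame fun u R => g u R * f u R := by
  simpa only [mul_comm] using hf.mul_bounded hg hC

theorem const_mul (hf : Tame f) (c : ℂ) : Tame fun u R => c * f u R :=
  hf.bounded_mul (g := fun _ _ => c) continuous_const fun _ _ => le_rfl

theorem neg (hf : Tame f) : Tame fun u R => -f u R := by simpa using hf.const_mul (-1)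

theorem sub (hf : Tame f) (hg : Tame g) : Tame fun u R => f u R - g u R := by
  simpa only [sub_eq_add_neg] using hf.add hg.neg

theorem scriInt_add (hf : Tame f) (hg : Tame g) :
    scriInt (fun u R => f u R + g u R) = scriInt f + scriInt g := by
  unfold scriInt
  rw [← sphereInt_add hf.continuous_integral hg.continuous_integral]
  congr 1
  funext R
  exact integral_add (hf.integrable R) (hg.integrable R)

theorem scriInt_sub (hf : Tame f) (hg : Tame g) :
    scriInt (fun u R => f u R - g u R) = scriInt f - scriInt g := by
  unfold scriInt
  rw [← sphereInt_sub hf.continuous_integral hg.continuous_integral]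
  congr 1
  funext R
  exact integral_sub (hf.integrable R) (hg.integrable R)

end Tame

theorem Tame.conj {f : ℝ → SO3 → ℂ} (hf : Tame f) : Tame fun u R => (starRingEnd ℂ) (f u R) := by
  obtain ⟨b, hb, h⟩ := hf.bound
  exact ⟨Complex.continuous_conj.comp hf.cont, b, hb, fun u R => by
    rw [RCLike.norm_conj]; exact h u R⟩

theorem scriInt_const_mul (c : ℂ) (f : ℝ → SO3 → ℂ) :
    scriInt (fun u R => c * f u R) = c * scriInt f := by
  unfold scriInt
  rw [← sphereInt_const_mul]
  congr 1
  funext R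
  exact integral_const_mul _ _

theorem scriInt_conj (f : ℝ → SO3 → ℂ) :
    scriInt (fun u R => conj (f u R)) = conj (scriInt f) := by
  unfold scriInt
  rw [← sphereInt_conj]
  congr 1
  funext R
  exact integral_conj

/-- A tame nonnegative function of spin weight 0 with vanishing integral vanishes. -/
theorem eq_zero_of_scriInt_eq_zero {g : ℝ → SO3 → ℝ} (hg : Tame fun u R => (g u R : ℂ))
    (h0 : ∀ u R, 0 ≤ g u R) (hs : ∀ u R ψ, g u (R * rotZ ψ) = g u R)
    (hI : scriInt (fun u R => (g u R : ℂ)) = 0) (u : ℝ) (R : SO3) : g u R = 0 := by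
  have h1 : ∀ R, ∫ u, (g u R : ℂ) = ((∫ u, g u R : ℝ) : ℂ) := fun R => integral_ofReal
  have hc : Continuous fun R => ∫ u, g u R := by
    have := Complex.continuous_re.comp hg.continuous_integral
    simpa only [Function.comp_def, h1, Complex.ofReal_re] using this
  have h2 : ∫ u, g u R = 0 := by
    refine eq_zero_of_sphereInt_eq_zero (g := fun R => ∫ u, g u R) hc
      (fun R => integral_nonneg fun u => h0 u R) (fun R ψ => by simp only [hs]) ?_ R
    simpa only [scriInt, h1] using hI
  have hgc : Continuous fun u => g u R := by
    have := Complex.continuous_re.comp (hg.continuous_left R)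
    simpa only [Function.comp_def, Complex.ofReal_re] using this
  have hgi : Integrable fun u => g u R := by
    have := (hg.integrable R).re
    simpa using this
  have h3 := (integral_eq_zero_iff_of_nonneg (fun u => h0 u R) hgi).1 h2
  exact congrFun ((Continuous.ae_eq_iff_eq volume hgc continuous_const).1 h3) u

variable {ε : ℝ}

/-! ### Elements of the function spaces -/

theorem FSpace.ext {k : Kind} {f g : FSpace ε k} (h : ∀ u R, f u R = g u R) : f = g :=
  Subtype.ext (funext fun u => funext fun R => h u R)

theorem Elec.ext {e e' : Elec} (h : ∀ R, e R = e' R) : e = e' := Subtype.ext (funext h)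

@[simp] theorem FSpace.add_apply {k : Kind} (f g : FSpace ε k) (u : ℝ) (R : SO3) :
    (f + g) u R = f u R + g u R := rfl
@[simp] theorem FSpace.sub_apply {k : Kind} (f g : FSpace ε k) (u : ℝ) (R : SO3) :
    (f - g) u R = f u R - g u R := rfl
@[simp] theorem FSpace.neg_apply {k : Kind} (f : FSpace ε k) (u : ℝ) (R : SO3) :
    (-f) u R = -f u R := rfl
@[simp] theorem FSpace.smul_apply {k : Kind} (c : ℝ) (f : FSpace ε k) (u : ℝ) (R : SO3) :
    (c • f) u R = (c : ℂ) * f u R := rfl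
@[simp] theorem FSpace.zero_apply {k : Kind} (u : ℝ) (R : SO3) : (0 : FSpace ε k) u R = 0 := rfl
@[simp] theorem Elec.add_apply (e e' : Elec) (R : SO3) : (e + e') R = e R + e' R := rfl
@[simp] theorem Elec.sub_apply (e e' : Elec) (R : SO3) : (e - e') R = e R - e' R := rfl
@[simp] theorem Elec.neg_apply (e : Elec) (R : SO3) : (-e) R = -e R := rfl
@[simp] theorem Elec.smul_apply (c : ℝ) (e : Elec) (R : SO3) : (c • e) R = (c : ℂ) * e R := rfl
@[simp] theorem Elec.zero_apply (R : SO3) : (0 : Elec) R = 0 := rfl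

theorem F0.scriSmooth (f : F0 ε) : ScriSmooth f := f.2.1

theorem F0.hasDerivAt (f : F0 ε) (u : ℝ) (R : SO3) : HasDerivAt (fun v => f v R) (du f u R) u :=
  ((f.scriSmooth.contDiff R).differentiable (by simp)).differentiableAt.hasDerivAt

theorem F1.exists_du_eq (g : F1 ε) : ∃ f : F0 ε, du f = g := by
  obtain ⟨f, hf, h⟩ := g.2
  exact ⟨⟨f, hf⟩, FSpace.ext fun u R => (h u R).deriv⟩

theorem F1.scriSmooth (g : F1 ε) : ScriSmooth g := by
  obtain ⟨f, rfl⟩ := g.exists_du_eq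
  exact f.scriSmooth.deriv

theorem FSpace.scriSmooth : ∀ {k : Kind} (f : FSpace ε k), ScriSmooth f
  | .shear, f => F1.scriSmooth f
  | .news, f => F0.scriSmooth f

theorem F0.hasSpin (f : F0 ε) (u : ℝ) : HasSpin 2 (f u) := f.2.2.1 u

theorem F1.hasSpin (g : F1 ε) (u : ℝ) : HasSpin 2 (g u) := by
  obtain ⟨f, rfl⟩ := g.exists_du_eq
  intro R ψ
  have h1 : (fun v => f v (R * rotZ ψ)) =
      fun v => Complex.exp (Complex.I * ((2 : ℤ) : ℂ) * ψ) * f v R :=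
    funext fun v => f.hasSpin v R ψ
  change deriv (fun v => f v (R * rotZ ψ)) u = _
  rw [h1, deriv_const_mul_field]
  rfl

theorem FSpace.hasSpin : ∀ {k : Kind} (f : FSpace ε k) (u : ℝ), HasSpin 2 (f u)
  | .shear, f => F1.hasSpin f
  | .news, f => F0.hasSpin f

theorem F0.word_du (f : F0 ε) (w : List Bool) (u : ℝ) (R : SO3) :
    word w (du f u) R = deriv (fun v => word w (f v) R) u :=
  congrFun (f.scriSmooth.word_deriv w u) R

theorem F0.iteratedDeriv_word_du (f : F0 ε) (w : List Bool) (k : ℕ) (u : ℝ) (R : SO3) :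
    iteratedDeriv k (fun v => word w (du f v) R) u =
      iteratedDeriv (k + 1) (fun v => word w (f v) R) u := by
  simp only [F0.word_du, iteratedDeriv_succ']

/-- Order `k` of `g` is order `k + 1` of a primitive in `ℱ₀`, whence the additional `1/2` in the
exponent. -/
theorem F1.decay (g : F1 ε) (k : ℕ) (w : List Bool) : ∃ C : ℝ, ∀ u R,
    ‖(1 + u ^ 2) ^ ((k : ℝ) / 2 + 1 / 2 + ε) • iteratedDeriv k (fun v => word w (g v) R) u‖ ≤ C := by
  obtain ⟨f, rfl⟩ := g.exists_du_eq
  obtain ⟨C, hC⟩ := f.2.2.2.1 (k + 1) w (by omega)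
  refine ⟨C, fun u R => ?_⟩
  rw [F0.iteratedDeriv_word_du]
  convert hC u R using 4
  push_cast
  ring

/-! ### Asymptotic limits -/

/-- The limits were defined by choice; uniqueness of limits makes them computable, and linear in
`f`. -/
theorem limMinus_eq {f : F0 ε} {e : Elec} (h : ∀ R, Tendsto (fun u => f u R) atBot (𝓝 (e R))) :
    limMinus f = e := Elec.ext fun R => tendsto_nhds_unique (limMinus_spec f R) (h R)

theorem limPlus_eq {f : F0 ε} {e : Elec} (h : ∀ R, Tendsto (fun u => f u R) atTop (𝓝 (e R))) :
    limPlus f = e := Elec.ext fun R => tendsto_nhds_unique (limPlus_spec f R) (h R)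

/-- `f ↦ f₋` as a linear map. -/
def limMinusL (ε : ℝ) : F0 ε →ₗ[ℝ] Elec where
  toFun := limMinus
  map_add' f g := limMinus_eq fun R => (limMinus_spec f R).add (limMinus_spec g R)
  map_smul' c f := limMinus_eq fun R => (limMinus_spec f R).const_smul c

/-- `f ↦ f₊` as a linear map. -/
def limPlusL (ε : ℝ) : F0 ε →ₗ[ℝ] Elec where
  toFun := limPlus
  map_add' f g := limPlus_eq fun R => (limPlus_spec f R).add (limPlus_spec g R)
  map_smul' c f := limPlus_eq fun R => (limPlus_spec f R).const_smul c

/-- `∂ᵤ` as a linear map. -/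
def duL (ε : ℝ) : F0 ε →ₗ[ℝ] F1 ε where
  toFun := du
  map_add' f g := FSpace.ext fun u R => ((f.hasDerivAt u R).add (g.hasDerivAt u R)).deriv
  map_smul' c f := FSpace.ext fun u R => ((f.hasDerivAt u R).const_smul c).deriv

@[simp] theorem limMinusL_apply (f : F0 ε) : limMinusL ε f = limMinus f := rfl
@[simp] theorem limPlusL_apply (f : F0 ε) : limPlusL ε f = limPlus f := rfl
@[simp] theorem duL_apply (f : F0 ε) : duL ε f = du f := rfl

@[simp] theorem limMinus_add (f g : F0 ε) : limMinus (f + g) = limMinus f + limMinus g :=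
  map_add (limMinusL ε) f g
@[simp] theorem limMinus_sub (f g : F0 ε) : limMinus (f - g) = limMinus f - limMinus g :=
  map_sub (limMinusL ε) f g
@[simp] theorem limMinus_smul (c : ℝ) (f : F0 ε) : limMinus (c • f) = c • limMinus f :=
  map_smul (limMinusL ε) c f
@[simp] theorem limMinus_zero : limMinus (0 : F0 ε) = 0 := map_zero (limMinusL ε)
@[simp] theorem limPlus_add (f g : F0 ε) : limPlus (f + g) = limPlus f + limPlus g :=
  map_add (limPlusL ε) f g
@[simp] theorem limPlus_sub (f g : F0 ε) : limPlus (f - g) = limPlus f - limPlus g :=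
  map_sub (limPlusL ε) f g
@[simp] theorem limPlus_smul (c : ℝ) (f : F0 ε) : limPlus (c • f) = c • limPlus f :=
  map_smul (limPlusL ε) c f
@[simp] theorem limPlus_zero : limPlus (0 : F0 ε) = 0 := map_zero (limPlusL ε)
@[simp] theorem du_add (f g : F0 ε) : du (f + g) = du f + du g := map_add (duL ε) f g
@[simp] theorem du_sub (f g : F0 ε) : du (f - g) = du f - du g := map_sub (duL ε) f g
@[simp] theorem du_neg (f : F0 ε) : du (-f) = -du f := map_neg (duL ε) f
@[simp] theorem du_smul (c : ℝ) (f : F0 ε) : du (c • f) = c • du f := map_smul (duL ε) c f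
@[simp] theorem du_zero : du (0 : F0 ε) = 0 := map_zero (duL ε)

/-- Elements of `ℱ₀` are determined by their derivative and their limit at `-∞`. -/
theorem F0.eq_of_du_eq {f g : F0 ε} (h : du f = du g) (h' : limMinus f = limMinus g) : f = g := by
  have h0 : du (f - g) = 0 := by rw [du_sub, h, sub_self]
  have hl : limMinus (f - g) = 0 := by rw [limMinus_sub, h', sub_self]
  rw [← sub_eq_zero]
  refine FSpace.ext fun u R => ?_
  have hd : ∀ v, HasDerivAt (fun v => (f - g) v R) 0 v := fun v => by
    have := (f - g).hasDerivAt v R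
    rwa [h0] at this
  have hc : ∀ v, (f - g) v R = (f - g) u R := fun v =>
    is_const_of_deriv_eq_zero (fun v => (hd v).differentiableAt) (fun v => (hd v).deriv) v u
  have h1 := limMinus_spec (f - g) R
  simp only [hc] at h1
  rw [hl] at h1
  exact tendsto_nhds_unique tendsto_const_nhds h1

/-- An electric function, as a function on `𝓘` independent of `u`. -/
def constF0 (ε : ℝ) (e : Elec) : F0 ε :=
  ⟨fun _ R => e R, e.scriSmooth, fun _ => e.hasSpin, fun k w hk => ⟨0, fun u R => by
    rw [iteratedDeriv_const, if_neg (by omega), smul_zero, norm_zero]⟩,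
    ⟨e, fun R => tendsto_const_nhds⟩, ⟨e, fun R => tendsto_const_nhds⟩⟩

@[simp] theorem constF0_apply (e : Elec) (u : ℝ) (R : SO3) : constF0 ε e u R = e R := rfl
@[simp] theorem limMinus_constF0 (e : Elec) : limMinus (constF0 ε e) = e :=
  limMinus_eq fun _ => tendsto_const_nhds
@[simp] theorem limPlus_constF0 (e : Elec) : limPlus (constF0 ε e) = e :=
  limPlus_eq fun _ => tendsto_const_nhds
@[simp] theorem du_constF0 (e : Elec) : du (constF0 ε e) = 0 :=
  FSpace.ext fun _ _ => deriv_const _ _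

/-- Compact support in `u` makes every power weight harmless. It is applied to `u`-derivatives of
cutoffs and steps to place them in `ℱ₀`. -/
theorem ScriSmooth.weighted_bound {G : ℝ → SO3 → ℂ} (hG : ScriSmooth G) {K : Set ℝ}
    (hK : IsCompact K) (h0 : ∀ u ∉ K, ∀ R, G u R = 0) (a : ℝ) :
    ∃ C : ℝ, ∀ u R, ‖((1 + u ^ 2) ^ a : ℝ) • G u R‖ ≤ C := by
  obtain ⟨C, hC⟩ := hG.bounded_of_compact hK
  have hw : Continuous fun u : ℝ => ((1 + u ^ 2) ^ a : ℝ) :=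
    Continuous.rpow_const (by fun_prop) fun u => Or.inl (by positivity)
  obtain ⟨D, hD⟩ := hK.exists_bound_of_continuousOn hw.continuousOn
  refine ⟨|D| * |C|, fun u R => ?_⟩
  by_cases hu : u ∈ K
  · rw [norm_smul]
    exact mul_le_mul ((hD u hu).trans (le_abs_self _)) ((hC u hu R).trans (le_abs_self _))
      (norm_nonneg _) (abs_nonneg _)
  · rw [h0 u hu R, smul_zero, norm_zero]
    positivity

/-! ### Cutoffs, smooth steps and the section of `I_u` -/

theorem word_real_mul (h : SO3 → ℂ) (w : List Bool) (c : ℝ) (R : SO3) :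
    word w (fun R => (c : ℂ) * h R) R = (c : ℂ) * word w h R := congrFun (word_smul h w c) R

/-- The product with a smooth function of `u` with compact support. -/
def cutoff (ε : ℝ) (χ : ℝ → ℝ) (hχ : ContDiff ℝ ∞ χ) (hχ' : HasCompactSupport χ)
    (f : ℝ → SO3 → ℂ) (hf : ScriSmooth f) (hs : ∀ u, HasSpin 2 (f u)) : F0 ε :=
  ⟨fun u R => (χ u : ℂ) * f u R, hf.const_mul_left hχ,
    fun u R ψ => by
      change (χ u : ℂ) * f u (R * rotZ ψ) = _ * ((χ u : ℂ) * f u R)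
      rw [hs u R ψ]; ring,
    fun k w _ => by
      simp only [word_real_mul]
      refine (((hf.word w).const_mul_left hχ).iteratedDeriv k).weighted_bound hχ'
        (fun u hu R => ?_) _
      have h1 : (fun v => (χ v : ℂ) * word w (f v) R) =ᶠ[𝓝 u] fun _ => 0 := by
        filter_upwards [(isClosed_tsupport χ).isOpen_compl.mem_nhds hu] with v hv
        rw [image_eq_zero_of_notMem_tsupport hv, Complex.ofReal_zero, zero_mul]
      rw [h1.iteratedDeriv_eq, iteratedDeriv_const]
      simp,
    ⟨0, fun R => tendsto_const_nhds.congr' (by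
      have h1 : ∀ᶠ u in cocompact ℝ, χ u = 0 := by
        filter_upwards [hχ'.compl_mem_cocompact] with u hu
        exact image_eq_zero_of_notMem_tsupport hu
      filter_upwards [atTop_le_cocompact h1] with u hu
      simp [hu])⟩,
    ⟨0, fun R => tendsto_const_nhds.congr' (by
      have h1 : ∀ᶠ u in cocompact ℝ, χ u = 0 := by
        filter_upwards [hχ'.compl_mem_cocompact] with u hu
        exact image_eq_zero_of_notMem_tsupport hu
      filter_upwards [atBot_le_cocompact h1] with u hu
      simp [hu])⟩⟩

/-- Local constancy outside `[0, 1]` kills all derivatives of positive order there, and `ℱ₀` imposes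
decay on those alone. -/
theorem smoothTransition_eventually {u : ℝ} (hu : u ∉ Set.Icc (0 : ℝ) 1) :
    ∃ c : ℝ, Real.smoothTransition =ᶠ[𝓝 u] fun _ => c := by
  rw [Set.mem_Icc, not_and_or, not_le, not_le] at hu
  rcases hu with hu | hu
  · exact ⟨0, by filter_upwards [gt_mem_nhds hu] with v hv
      using Real.smoothTransition.zero_of_nonpos hv.le⟩
  · exact ⟨1, by filter_upwards [lt_mem_nhds hu] with v hv
      using Real.smoothTransition.one_of_one_le hv.le⟩

/-- An electric function times a smooth step function of `u`. -/
def stepF0 (ε : ℝ) (e : Elec) : F0 ε :=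
  ⟨fun u R => (Real.smoothTransition u : ℂ) * e R,
    e.scriSmooth.const_mul_left Real.smoothTransition.contDiff,
    fun u R ψ => by
      change (Real.smoothTransition u : ℂ) * e (R * rotZ ψ) = _ * ((Real.smoothTransition u : ℂ) * e R)
      rw [e.hasSpin R ψ]; ring,
    fun k w hk => by
      simp only [word_real_mul]
      refine (((e.scriSmooth.word w).const_mul_left
        Real.smoothTransition.contDiff).iteratedDeriv k).weighted_bound
        (isCompact_Icc (a := 0) (b := 1)) (fun u hu R => ?_) _
      obtain ⟨c, hc⟩ := smoothTransition_eventually hu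
      have h1 : (fun v => (Real.smoothTransition v : ℂ) * word w e R) =ᶠ[𝓝 u]
          fun _ => (c : ℂ) * word w e R := by
        filter_upwards [hc] with v hv
        rw [hv]
      rw [h1.iteratedDeriv_eq, iteratedDeriv_const, if_neg (by omega)],
    ⟨e, fun R => tendsto_const_nhds.congr' (by
      filter_upwards [eventually_ge_atTop 1] with u hu
      rw [Real.smoothTransition.one_of_one_le hu]; simp)⟩,
    ⟨0, fun R => tendsto_const_nhds.congr' (by
      filter_upwards [eventually_le_atBot 0] with u hu
      rw [Real.smoothTransition.zero_of_nonpos hu]; simp)⟩⟩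

@[simp] theorem stepF0_apply (e : Elec) (u : ℝ) (R : SO3) :
    stepF0 ε e u R = (Real.smoothTransition u : ℂ) * e R := rfl

@[simp] theorem limPlus_stepF0 (e : Elec) : limPlus (stepF0 ε e) = e :=
  limPlus_eq fun R => tendsto_const_nhds.congr' (by
    filter_upwards [eventually_ge_atTop 1] with u hu
    rw [stepF0_apply, Real.smoothTransition.one_of_one_le hu]; simp)

@[simp] theorem limMinus_stepF0 (e : Elec) : limMinus (stepF0 ε e) = 0 :=
  limMinus_eq fun R => tendsto_const_nhds.congr' (by
    filter_upwards [eventually_le_atBot 0] with u hu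
    rw [stepF0_apply, Real.smoothTransition.zero_of_nonpos hu]; simp)

/-- The section `e ↦ χ(u) e(r̂)`, `∫ du χ = 1`, of `I_u : ℱ₁ → ℰ`. -/
def sectionL (ε : ℝ) : Elec →ₗ[ℝ] F1 ε where
  toFun e := du (stepF0 ε e)
  map_add' e e' := by
    rw [← du_add]
    congr 1
    exact FSpace.ext fun u R => by simp [mul_add]
  map_smul' c e := by
    rw [RingHom.id_apply, ← du_smul]
    congr 1
    exact FSpace.ext fun u R => by simp only [stepF0_apply, Elec.smul_apply, FSpace.smul_apply]; ring

theorem sectionL_eq (e : Elec) : sectionL ε e = du (stepF0 ε e) := rfl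

/-! ### Primitives -/

theorem F1.exists_prim (l : F1 ε) : ∃ f : F0 ε, du f = l ∧ limMinus f = 0 := by
  obtain ⟨f, rfl⟩ := l.exists_du_eq
  exact ⟨f - constF0 ε (limMinus f), by simp, by simp⟩

/-- The primitive that vanishes at `u → -∞`. -/
def prim (l : F1 ε) : F0 ε := Classical.choose l.exists_prim

@[simp] theorem du_prim (l : F1 ε) : du (prim l) = l := (Classical.choose_spec l.exists_prim).1
@[simp] theorem limMinus_prim (l : F1 ε) : limMinus (prim l) = 0 :=
  (Classical.choose_spec l.exists_prim).2

theorem prim_eq {l : F1 ε} {f : F0 ε} (h : du f = l) (h' : limMinus f = 0) : prim l = f :=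
  F0.eq_of_du_eq (by rw [du_prim, h]) (by rw [limMinus_prim, h'])

theorem prim_du (f : F0 ε) : prim (du f) = f - constF0 ε (limMinus f) := prim_eq (by simp) (by simp)

/-- The primitive as a linear map. -/
def primL (ε : ℝ) : F1 ε →ₗ[ℝ] F0 ε where
  toFun := prim
  map_add' l l' := prim_eq (by simp) (by simp)
  map_smul' c l := prim_eq (by simp) (by simp)

@[simp] theorem primL_apply (l : F1 ε) : primL ε l = prim l := rfl

/-- The weight behaves like `|u|^(-1-2ε)`, integrable at infinity because `ε > 0`. It dominates all
integrals over `u` of elements of `ℱ₁`. -/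
theorem integrable_decay (hε : 0 < ε) : Integrable fun u : ℝ => ((1 + u ^ 2) ^ (-(1 / 2 + ε)) : ℝ) := by
  have h := integrable_rpow_neg_one_add_norm_sq (E := ℝ) (μ := volume) (r := 1 + 2 * ε)
    (by simp; linarith)
  have he : -(1 + 2 * ε) / 2 = -(1 / 2 + ε) := by ring
  simpa only [he, Real.norm_eq_abs, sq_abs] using h

theorem norm_le_of_weighted {a C : ℝ} {u : ℝ} {z : ℂ} (h : ‖((1 + u ^ 2) ^ a : ℝ) • z‖ ≤ C) :
    ‖z‖ ≤ C * ((1 + u ^ 2) ^ (-a) : ℝ) := by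
  have hp : (0 : ℝ) < 1 + u ^ 2 := by positivity
  rw [norm_smul, Real.norm_eq_abs, abs_of_pos (Real.rpow_pos_of_pos hp _)] at h
  rw [Real.rpow_neg hp.le, ← div_eq_mul_inv, le_div_iff₀ (Real.rpow_pos_of_pos hp _), mul_comm]
  exact h

theorem F1.tame_word (hε : 0 < ε) (l : F1 ε) (w : List Bool) :
    Tame fun u R => word w (l u) R := by
  obtain ⟨C, hC⟩ := l.decay 0 w
  refine ⟨(l.scriSmooth.word w).continuous, _, (integrable_decay hε).const_mul C, fun u R => ?_⟩
  exact norm_le_of_weighted (by simpa using hC u R)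

theorem F1.tame (hε : 0 < ε) (l : F1 ε) : Tame l := l.tame_word hε []

theorem F1.integrable (hε : 0 < ε) (l : F1 ε) (R : SO3) : Integrable fun u => l u R :=
  (l.tame hε).integrable R

theorem prim_apply (hε : 0 < ε) (l : F1 ε) (u : ℝ) (R : SO3) :
    prim l u R = ∫ v in Set.Iic u, l v R := by
  have h1 : ∀ v, HasDerivAt (fun v => prim l v R) (l v R) v := fun v => by
    have := (prim l).hasDerivAt v R
    rwa [du_prim] at this
  have h2 := limMinus_spec (prim l) R
  rw [limMinus_prim] at h2
  rw [integral_Iic_of_hasDerivAt_of_tendsto' (fun v _ => h1 v) (l.integrable hε R).integrableOn h2]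
  simp

theorem intU_du (hε : 0 < ε) (f : F0 ε) : intU hε (du f) = limPlus f - limMinus f :=
  Elec.ext fun R => integral_of_hasDerivAt_of_tendsto (fun u => f.hasDerivAt u R)
    ((du f).integrable hε R) (limMinus_spec f R) (limPlus_spec f R)

theorem limPlus_prim (hε : 0 < ε) (l : F1 ε) : limPlus (prim l) = intU hε l := by
  have := intU_du hε (prim l)
  rw [du_prim, limMinus_prim, sub_zero] at this
  exact this.symm

/-- `I_u` as a linear map. -/
def intUL (hε : 0 < ε) : F1 ε →ₗ[ℝ] Elec where
  toFun := intU hε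
  map_add' l l' := Elec.ext fun R => integral_add (l.integrable hε R) (l'.integrable hε R)
  map_smul' c _ := Elec.ext fun _ => integral_smul c _

@[simp] theorem intUL_apply (hε : 0 < ε) (l : F1 ε) : intUL hε l = intU hε l := rfl

@[simp] theorem intU_sectionL (hε : 0 < ε) (e : Elec) : intU hε (sectionL ε e) = e := by
  rw [sectionL_eq, intU_du, limPlus_stepF0, limMinus_stepF0, sub_zero]

/-! ### Supremum bounds on the test spaces -/

theorem Elec.bounded (e : Elec) : ∃ C : ℝ, ∀ R, ‖e R‖ ≤ C := by
  obtain ⟨C, hC⟩ := e.scriSmooth.bounded_of_compact (isCompact_singleton (x := (0 : ℝ)))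
  exact ⟨C, hC 0 rfl⟩

theorem Elec.continuous (e : Elec) : Continuous (e : SO3 → ℂ) :=
  e.scriSmooth.continuous.comp (continuous_const (y := (0 : ℝ)) |>.prodMk continuous_id)

theorem norm_prim_le (hε : 0 < ε) {l : F1 ε} {b : ℝ → ℝ} (hb : Integrable b)
    (h : ∀ u R, ‖l u R‖ ≤ b u) (u : ℝ) (R : SO3) : ‖prim l u R‖ ≤ ∫ v, b v := by
  rw [prim_apply hε]
  refine (norm_integral_le_of_norm_le hb.integrableOn
    (Eventually.of_forall fun v => h v R)).trans ?_
  exact setIntegral_le_integral hb (Eventually.of_forall fun v => (norm_nonneg _).trans (h v R))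

/-- This is the splitting `ℱ₀ ≅ ℱ₁ ⊕ ℰ` by derivative and limit at `-∞`; it reduces supremum bounds
on `ℱ₀` to the other two spaces. -/
theorem F0.eq_prim_add (f : F0 ε) : f = prim (du f) + constF0 ε (limMinus f) := by
  rw [prim_du, sub_add_cancel]

theorem F0.bounded (hε : 0 < ε) (f : F0 ε) : ∃ C : ℝ, ∀ u R, ‖f u R‖ ≤ C := by
  obtain ⟨C, hC⟩ := (limMinus f).bounded
  obtain ⟨b, hb, h⟩ := ((du f).tame hε).bound
  refine ⟨(∫ v, b v) + C, fun u R => ?_⟩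
  rw [f.eq_prim_add]
  exact (norm_add_le _ _).trans (add_le_add (norm_prim_le hε hb h u R) (hC R))

theorem F1.bounded (hε : 0 < ε) (l : F1 ε) : ∃ C : ℝ, ∀ u R, ‖l u R‖ ≤ C := by
  obtain ⟨C, hC⟩ := l.decay 0 []
  refine ⟨C, fun u R => ?_⟩
  have h1 := norm_le_of_weighted (hC u R)
  have hC0 : 0 ≤ C := (norm_nonneg _).trans (hC u R)
  have h2 : ((1 + u ^ 2) ^ (-(((0 : ℕ) : ℝ) / 2 + 1 / 2 + ε)) : ℝ) ≤ 1 :=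
    Real.rpow_le_one_of_one_le_of_nonpos (by nlinarith [sq_nonneg u]) (by simp; linarith)
  simp only [iteratedDeriv_zero, word] at h1
  exact h1.trans (mul_le_of_le_one_right hC0 h2)

theorem FSpace.bounded (hε : 0 < ε) : ∀ {k : Kind} (f : FSpace ε k), ∃ C : ℝ, ∀ u R, ‖f u R‖ ≤ C
  | .shear, f => F1.bounded hε f
  | .news, f => F0.bounded hε f

/-! ### The pairings -/

theorem tame_pair (hε : 0 < ε) {j : Kind} (l : F1 ε) (g : FSpace ε j) :
    Tame fun u R => conj (l u R) * g u R := by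
  obtain ⟨C, hC⟩ := g.bounded hε
  exact (l.tame hε).conj.mul_bounded g.scriSmooth.continuous hC

/-- Hermitian symmetry lets properties in the left slot be read off from the right slot. -/
theorem dirac_conj {i j : Kind} (f : FSpace ε i) (g : FSpace ε j) :
    conj (dirac f g) = dirac g f := by
  unfold dirac
  rw [← scriInt_conj]
  congr 1
  funext u R
  rw [map_mul, Complex.conj_conj, mul_comm]

/-- A factor in `ℱ₁` supplies integrable decay and the other one is bounded. Two factors in `ℱ₀` are
excluded because neither need decay. -/
theorem tame_dirac (hε : 0 < ε) : ∀ {i j : Kind}, i = .shear ∨ j = .shear →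
    ∀ (f : FSpace ε i) (g : FSpace ε j), Tame fun u R => conj (f u R) * g u R
  | .shear, _, _, f, g => tame_pair hε f g
  | .news, .shear, _, f, g => by
    have := (tame_pair hε g f).conj
    simpa only [map_mul, Complex.conj_conj, mul_comm] using this
  | .news, .news, h, _, _ => by simp at h

theorem dirac_add_right (hε : 0 < ε) {i j : Kind} (h : i = .shear ∨ j = .shear) (f : FSpace ε i)
    (g g' : FSpace ε j) : dirac f (g + g') = dirac f g + dirac f g' := by
  unfold dirac
  rw [← (tame_dirac hε h f g).scriInt_add (tame_dirac hε h f g')]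
  simp only [FSpace.add_apply, mul_add]

theorem dirac_add_left (hε : 0 < ε) {i j : Kind} (h : i = .shear ∨ j = .shear)
    (f f' : FSpace ε i) (g : FSpace ε j) : dirac (f + f') g = dirac f g + dirac f' g := by
  rw [← dirac_conj, dirac_add_right hε h.symm, map_add, dirac_conj, dirac_conj]

theorem dirac_smul_right {i j : Kind} (f : FSpace ε i) (c : ℝ) (g : FSpace ε j) :
    dirac f (c • g) = c * dirac f g := by
  unfold dirac
  rw [← scriInt_const_mul]
  congr 1
  funext u R
  rw [FSpace.smul_apply]
  ring

theorem dirac_smul_left {i j : Kind} (c : ℝ) (f : FSpace ε i) (g : FSpace ε j) :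
    dirac (c • f) g = c * dirac f g := by
  rw [← dirac_conj, dirac_smul_right, map_mul, Complex.conj_ofReal, dirac_conj]

theorem dirac_neg_right {i j : Kind} (f : FSpace ε i) (g : FSpace ε j) :
    dirac f (-g) = -dirac f g := by
  simpa using dirac_smul_right f (-1) g

theorem dirac_neg_left {i j : Kind} (f : FSpace ε i) (g : FSpace ε j) :
    dirac (-f) g = -dirac f g := by
  simpa using dirac_smul_left (-1) f g

theorem dirac_sub_right (hε : 0 < ε) {i j : Kind} (h : i = .shear ∨ j = .shear) (f : FSpace ε i)
    (g g' : FSpace ε j) : dirac f (g - g') = dirac f g - dirac f g' := by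
  rw [sub_eq_add_neg, dirac_add_right hε h, dirac_neg_right, sub_eq_add_neg]

theorem dirac_sub_left (hε : 0 < ε) {i j : Kind} (h : i = .shear ∨ j = .shear)
    (f f' : FSpace ε i) (g : FSpace ε j) : dirac (f - f') g = dirac f g - dirac f' g := by
  rw [sub_eq_add_neg, dirac_add_left hε h, dirac_neg_left, sub_eq_add_neg]

theorem dirac_zero_right {i j : Kind} (f : FSpace ε i) : dirac f (0 : FSpace ε j) = 0 := by
  simpa using dirac_smul_right f 0 (0 : FSpace ε j)

theorem continuous_diracS_integrand (e e' : Elec) : Continuous fun R => conj (e R) * e' R :=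
  (Complex.continuous_conj.comp e.continuous).mul e'.continuous

theorem diracS_conj (e e' : Elec) : conj (diracS e e') = diracS e' e := by
  unfold diracS
  rw [← sphereInt_conj]
  congr 1
  funext R
  rw [map_mul, Complex.conj_conj, mul_comm]

theorem diracS_add_right (e e₁ e₂ : Elec) : diracS e (e₁ + e₂) = diracS e e₁ + diracS e e₂ := by
  unfold diracS
  rw [← sphereInt_add (continuous_diracS_integrand _ _) (continuous_diracS_integrand _ _)]
  simp only [Elec.add_apply, mul_add]

theorem diracS_smul_right (e : Elec) (c : ℝ) (e' : Elec) :
    diracS e (c • e') = c * diracS e e' := by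
  unfold diracS
  rw [← sphereInt_const_mul]
  congr 1
  funext R
  rw [Elec.smul_apply]
  ring

theorem diracS_add_left (e₁ e₂ e : Elec) : diracS (e₁ + e₂) e = diracS e₁ e + diracS e₂ e := by
  rw [← diracS_conj, diracS_add_right, map_add, diracS_conj, diracS_conj]

theorem diracS_smul_left (c : ℝ) (e e' : Elec) : diracS (c • e) e' = c * diracS e e' := by
  rw [← diracS_conj, diracS_smul_right, map_mul, Complex.conj_ofReal, diracS_conj]

/-- The pairing on `ℰ` as a bilinear map. -/
def diracSL : Elec →ₗ[ℝ] Elec →ₗ[ℝ] ℂ :=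
  LinearMap.mk₂ ℝ diracS diracS_add_left (fun c e e' => by rw [diracS_smul_left]; rfl)
    diracS_add_right (fun c e e' => by rw [diracS_smul_right]; rfl)

theorem diracS_sub_right (e e₁ e₂ : Elec) : diracS e (e₁ - e₂) = diracS e e₁ - diracS e e₂ :=
  map_sub (diracSL e) e₁ e₂

theorem diracS_sub_left (e₁ e₂ e : Elec) : diracS (e₁ - e₂) e = diracS e₁ e - diracS e₂ e :=
  LinearMap.congr_fun (map_sub diracSL e₁ e₂) e

theorem diracS_zero_right (e : Elec) : diracS e 0 = 0 := map_zero (diracSL e)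

theorem diracS_zero_left (e : Elec) : diracS 0 e = 0 := LinearMap.congr_fun (map_zero diracSL) e

theorem conj_mul_self_eq (z : ℂ) : conj z * z = ((‖z‖ ^ 2 : ℝ) : ℂ) := by
  rw [mul_comm, Complex.mul_conj, Complex.normSq_eq_norm_sq]

theorem HasSpin.norm_mul_rotZ {s : ℤ} {h : SO3 → ℂ} (hh : HasSpin s h) (R : SO3) (ψ : ℝ) :
    ‖h (R * rotZ ψ)‖ = ‖h R‖ := by
  have h1 : Complex.I * s * ψ = ((s * ψ : ℝ) : ℂ) * Complex.I := by push_cast; ring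
  rw [hh, norm_mul, h1, Complex.norm_exp_ofReal_mul_I, one_mul]

/-- The self-pairing is real, being its own conjugate, so its real part decides. This suffices for
the real phase space, whose equations only see real parts. -/
theorem Elec.eq_zero_of_diracS {e : Elec} (h : (diracS e e).re = 0) : e = 0 := by
  have h1 : diracS e e = sphereInt fun R => ((‖e R‖ ^ 2 : ℝ) : ℂ) := by
    simp only [diracS, conj_mul_self_eq]
  have h2 : diracS e e = 0 := by
    have h3 := Complex.conj_eq_iff_real.1 (diracS_conj e e)
    obtain ⟨r, hr⟩ := h3
    rw [hr] at h ⊢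
    simpa using h
  refine Elec.ext fun R => ?_
  have h4 := eq_zero_of_sphereInt_eq_zero (g := fun R => ‖e R‖ ^ 2) (e.continuous.norm.pow 2)
    (fun R => by positivity) (fun R ψ => by simp only [e.hasSpin.norm_mul_rotZ])
    (by rw [← h1, h2]) R
  simpa using h4

/-- Integration by parts. -/
theorem dirac_du_right (hε : 0 < ε) (f g : F0 ε) : dirac f (du g) =
    diracS (limPlus f) (limPlus g) - diracS (limMinus f) (limMinus g) - dirac (du f) g := by
  have h1 := tame_dirac hε (Or.inr rfl) f (du g)
  have h2 := tame_dirac hε (Or.inl rfl) (du f) g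
  rw [eq_sub_iff_add_eq]
  unfold dirac diracS
  rw [← h1.scriInt_add h2, ← sphereInt_sub (continuous_diracS_integrand _ _)
    (continuous_diracS_integrand _ _)]
  unfold scriInt
  congr 1
  funext R
  refine integral_of_hasDerivAt_of_tendsto (f := fun u => conj (f u R) * g u R)
    (fun u => ?_) ((h1.integrable R).add (h2.integrable R)) ?_ ?_
  · have hc : HasDerivAt (fun v => conj (f v R)) (conj (du f u R)) u :=
      (f.hasDerivAt u R).star
    exact (hc.mul (g.hasDerivAt u R)).congr_deriv (by ring)
  · exact ((Complex.continuous_conj.tendsto _).comp (limMinus_spec f R)).mul (limMinus_spec g R)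
  · exact ((Complex.continuous_conj.tendsto _).comp (limPlus_spec f R)).mul (limPlus_spec g R)

theorem dirac_constF0 (hε : 0 < ε) (l : F1 ε) (e : Elec) :
    dirac l (constF0 ε e) = diracS (intU hε l) e := by
  unfold dirac diracS scriInt
  congr 1
  funext R
  simp only [constF0_apply]
  rw [integral_mul_const, integral_conj]
  rfl

theorem constF0_dirac (hε : 0 < ε) (e : Elec) (l : F1 ε) :
    dirac (constF0 ε e) l = diracS e (intU hε l) := by
  rw [← dirac_conj, dirac_constF0 hε, diracS_conj]

/-- Integrating `g` over `u' < u` produces its primitive vanishing at `-∞`. -/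
theorem diracH_eq (hε : 0 < ε) (f g : F1 ε) : diracH f g = dirac f (prim g) := by
  unfold diracH dirac scriInt
  congr 1
  funext R
  congr 1
  funext u
  have h1 : (fun u' => heaviside u u' * (conj (f u R) * g u' R)) =
      (Set.Iio u).indicator fun u' => conj (f u R) * g u' R := by
    funext u'
    by_cases h : u' < u <;> simp [heaviside, h]
  rw [h1, integral_indicator measurableSet_Iio, integral_const_mul]
  change _ = conj (f u R) * prim g u R
  rw [prim_apply hε, integral_Iic_eq_integral_Iio]

/-- Integrating `g` over `u' > u` gives the total integral minus the primitive. Integration by parts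
moves the primitive to `f`, and its boundary term cancels the total integral. -/
theorem diracH'_eq (hε : 0 < ε) (f g : F1 ε) : diracH' f g = dirac (prim f) g := by
  have h0 : diracH' f g = dirac f (constF0 ε (intU hε g) - prim g) := by
    unfold diracH' dirac scriInt
    congr 1
    funext R
    congr 1
    funext u
    have h1 : (fun u' => heaviside u' u * (conj (f u R) * g u' R)) =
        (Set.Ioi u).indicator fun u' => conj (f u R) * g u' R := by
      funext u'
      by_cases h : u < u' <;> simp [heaviside, h]
    have h2 := integral_add_compl (s := Set.Iic u) measurableSet_Iic (g.integrable hε R)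
    rw [Set.compl_Iic] at h2
    rw [h1, integral_indicator measurableSet_Ioi, integral_const_mul]
    change _ = conj (f u R) * ((∫ u, g u R) - prim g u R)
    rw [prim_apply hε, ← h2, add_sub_cancel_left]
  have h3 := dirac_du_right hε (prim f) (prim g)
  simp only [du_prim, limMinus_prim, limPlus_prim hε, diracS_zero_right, sub_zero] at h3
  rw [h0, dirac_sub_right hε (Or.inl rfl), dirac_constF0 hε, h3]

/-! ### Nondegeneracy -/

theorem isConstraintSmearing_cutoff {χ : ℝ → ℝ} (hχ : ContDiff ℝ ∞ χ) (hχ' : HasCompactSupport χ)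
    {f : ℝ → SO3 → ℂ} (hf : ScriSmooth f) (hs : ∀ u, HasSpin 2 (f u)) :
    IsConstraintSmearing (cutoff ε χ hχ hχ' f hf hs) := by
  have h1 : ∀ᶠ u in cocompact ℝ, χ u = 0 := by
    filter_upwards [hχ'.compl_mem_cocompact] with u hu
    exact image_eq_zero_of_notMem_tsupport hu
  have h2 : ∀ R, ∀ᶠ u in cocompact ℝ, (0 : Elec) R = cutoff ε χ hχ hχ' f hf hs u R := by
    intro R
    filter_upwards [h1] with u hu
    change 0 = (χ u : ℂ) * f u R
    simp [hu]
  exact ⟨limPlus_eq fun R => tendsto_const_nhds.congr' (atTop_le_cocompact (h2 R)),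
    limMinus_eq fun R => tendsto_const_nhds.congr' (atBot_le_cocompact (h2 R))⟩

/-- Taking `φ = χ l` with a bump `χ` in `u` gives the integral of `χ |l|² ≥ 0`. Such `φ` vanish at
both ends, so constraint smearings already separate `ℱ₁`. -/
theorem F1.eq_zero_of_dirac (hε : 0 < ε) {l : F1 ε}
    (h : ∀ φ : F0 ε, IsConstraintSmearing φ → (dirac φ l).re = 0) : l = 0 := by
  refine FSpace.ext fun u R => ?_
  -- The inner radius exceeds `|u|`, so `χ = 1` at the point under consideration.
  let χ : ContDiffBump (0 : ℝ) := ⟨|u| + 1, |u| + 2, by positivity, by linarith⟩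
  have hχ1 : χ u = 1 := χ.one_of_mem_closedBall (by simp [χ])
  have h1 := h _ (isConstraintSmearing_cutoff χ.contDiff χ.hasCompactSupport l.scriSmooth l.hasSpin)
  have h2 : ∀ u R, conj ((χ u : ℂ) * l u R) * l u R = ((χ u * ‖l u R‖ ^ 2 : ℝ) : ℂ) := by
    intro u R
    rw [map_mul, Complex.conj_ofReal, mul_assoc, conj_mul_self_eq]
    push_cast
    ring
  have h3 : dirac (cutoff ε χ χ.contDiff χ.hasCompactSupport l l.scriSmooth l.hasSpin) l =
      scriInt fun u R => ((χ u * ‖l u R‖ ^ 2 : ℝ) : ℂ) := by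
    unfold dirac
    congr 1
    funext u R
    exact h2 u R
  have ht : Tame fun u R => ((χ u * ‖l u R‖ ^ 2 : ℝ) : ℂ) := by
    have := tame_dirac hε (Or.inr rfl)
      (cutoff ε χ χ.contDiff χ.hasCompactSupport l l.scriSmooth l.hasSpin) l
    convert this using 3 with u R
    exact (h2 u R).symm
  have h4 : scriInt (fun u R => ((χ u * ‖l u R‖ ^ 2 : ℝ) : ℂ)) = 0 := by
    have h5 := scriInt_conj fun u R => ((χ u * ‖l u R‖ ^ 2 : ℝ) : ℂ)
    simp only [Complex.conj_ofReal] at h5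
    obtain ⟨r, hr⟩ := Complex.conj_eq_iff_real.1 h5.symm
    rw [h3, hr] at h1
    rw [hr]
    simpa using h1
  have h6 := eq_zero_of_scriInt_eq_zero ht
    (fun u R => mul_nonneg χ.nonneg (by positivity))
    (fun u R ψ => by simp only [(l.hasSpin u).norm_mul_rotZ]) h4 u R
  simpa [hχ1] using h6

/-- Testing with `∂φ`, `φ` a constraint smearing, forces `∂f = 0`. The remaining electric constant
`e` is tested with an element of `ℱ₁` whose `u`-integral is `e`, leaving the norm of `e`. -/
theorem F0.eq_zero_of_dirac (hε : 0 < ε) {f : F0 ε} (h : ∀ g : F1 ε, (dirac f g).re = 0) :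
    f = 0 := by
  have h1 : du f = 0 := by
    refine F1.eq_zero_of_dirac hε fun φ hφ => ?_
    have h2 := h (du φ)
    rw [dirac_du_right hε, hφ.1, hφ.2, diracS_zero_right, diracS_zero_right, sub_self, zero_sub,
      ← dirac_conj, Complex.neg_re, Complex.conj_re, neg_eq_zero] at h2
    exact h2
  have h3 : f = constF0 ε (limMinus f) := F0.eq_of_du_eq (by simp [h1]) (by simp)
  have h4 := h (sectionL ε (limMinus f))
  rw [h3, constF0_dirac hε, limMinus_constF0, intU_sectionL] at h4
  have h5 := Elec.eq_zero_of_diracS h4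
  exact F0.eq_of_du_eq (by simp [h1]) (by simp [h5])

/-! ### Tangential flows -/

theorem dualConstraint_iff (hε : 0 < ε) (l : F1 ε) (α : F0 ε) :
    DualConstraint l α ↔ intU hε l = limPlus α - limMinus α :=
  ⟨fun h => Elec.ext h, fun h R => congrArg (fun e : Elec => e R) h⟩

/-- The Hamiltonian vector of the tangential extension of the function with functional derivatives
`(l, α)`. -/
def flow (l : F1 ε) (α : F0 ε) : Phase ε :=
  ((4 * Real.pi) • (prim l + α + constF0 ε (limMinus α)), -((4 * Real.pi) • (l + du α)))

/-- Tangency holds for arbitrary `(l, α)`; the dual constraint is only needed for the multiplier to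
vanish at `+∞`. -/
theorem constraint_flow (l : F1 ε) (α : F0 ε) : constraint (flow l α) = 0 := by
  simp [constraint, flow]

/-- Hypothesis `h` is Hamilton's equation cleared of denominators, in real part only, so that it
serves both the real problem and each half of the complexified one. Nondegeneracy splits it into two
equations, tangency eliminates `φ`, and the derivative and limit at `-∞` determine `X.1`. -/
theorem flow_unique (hε : 0 < ε) {l : F1 ε} {α φ : F0 ε} {X : Phase ε}
    (hφ : IsConstraintSmearing φ)
    (h : ∀ Y : Phase ε, (8 * Real.pi * (dirac l Y.1 + dirac α Y.2) + dirac φ (constraint Y) +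
      dirac X.2 Y.1 - dirac X.1 Y.2).re = 0)
    (hX : ∀ φ' : F0 ε, IsConstraintSmearing φ' → (dirac φ' (constraint X)).re = 0) :
    X = flow l α := by
  have h1 : constraint X = 0 := F1.eq_zero_of_dirac hε hX
  have h1' : X.2 = -du X.1 := eq_neg_of_add_eq_zero_left h1
  -- Vary `σ` alone; no boundary terms arise because `φ` vanishes at both ends.
  have h2 : (8 * Real.pi) • l - du φ + X.2 = 0 := by
    refine F1.eq_zero_of_dirac hε fun ψ _ => ?_
    have h3 := h (ψ, 0)
    simp only [constraint, zero_add, dirac_zero_right, add_zero, sub_zero] at h3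
    rw [dirac_du_right hε, hφ.1, hφ.2, diracS_zero_left, diracS_zero_left, sub_self,
      zero_sub] at h3
    rw [← dirac_conj, Complex.conj_re, dirac_add_left hε (Or.inl rfl),
      dirac_sub_left hε (Or.inl rfl), dirac_smul_left, ← h3]
    push_cast
    congr 1
  -- Vary `N̄` alone.
  have h4 : (8 * Real.pi) • α + φ - X.1 = 0 := by
    refine F0.eq_zero_of_dirac hε fun g => ?_
    have h3 := h (0, g)
    simp only [constraint, du_zero, add_zero, dirac_zero_right, zero_add] at h3
    rw [dirac_sub_left hε (Or.inr rfl), dirac_add_left hε (Or.inr rfl), dirac_smul_left, ← h3]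
    push_cast
    congr 1
  have h5 : X.1 = (8 * Real.pi) • α + φ := (sub_eq_zero.1 h4).symm
  have h6 : du φ = (4 * Real.pi) • (l - du α) := by
    rw [h1', h5] at h2
    simp only [du_add, du_smul] at h2
    have h7 : (2 : ℝ) • du φ = (2 : ℝ) • ((4 * Real.pi) • (l - du α)) := by
      rw [← sub_eq_zero, ← neg_eq_zero, ← h2]
      module
    exact smul_right_injective _ (two_ne_zero) h7
  -- At `-∞` the left side tends to `8π α₋`, as `φ₋ = 0`. On the right, `α` and the added constant
  -- `α₋` contribute `4π α₋` each.
  have h8 : X.1 = (flow l α).1 := by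
    apply F0.eq_of_du_eq
    · rw [h5]
      simp only [flow, du_add, du_smul, h6, du_prim, du_constF0]
      module
    · rw [h5]
      simp only [flow, limMinus_add, limMinus_smul, hφ.2, limMinus_prim, limMinus_constF0]
      module
  refine Prod.ext h8 ?_
  rw [h1', h8]
  simp [flow]

/-- The multiplier is the solution of `∂φ = 4π(l - ∂α)` with `φ₋ = 0`; its limit `φ₊ = 4π(∫l - α₊ +
α₋)` vanishes by the dual constraint. -/
theorem exists_flow (hε : 0 < ε) {l : F1 ε} {α : F0 ε} (hd : DualConstraint l α) :
    ∃ φ : F0 ε, IsConstraintSmearing φ ∧ ∀ Y : Phase ε,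
      8 * Real.pi * (dirac l Y.1 + dirac α Y.2) + dirac φ (constraint Y) +
      dirac (flow l α).2 Y.1 - dirac (flow l α).1 Y.2 = 0 := by
  rw [dualConstraint_iff hε] at hd
  set φ : F0 ε := (4 * Real.pi) • (prim l - α + constF0 ε (limMinus α)) with hφ
  have h1 : limPlus φ = 0 := by
    simp only [hφ, limPlus_smul, limPlus_add, limPlus_sub, limPlus_prim hε, limPlus_constF0, hd]
    module
  have h2 : limMinus φ = 0 := by simp [hφ]
  refine ⟨φ, ⟨h1, h2⟩, fun Y => ?_⟩
  have h3 : (flow l α).2 = du φ - (8 * Real.pi) • l := by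
    simp only [flow, hφ, du_smul, du_add, du_sub, du_prim, du_constF0]
    module
  have h4 : (flow l α).1 = (8 * Real.pi) • α + φ := by
    simp only [flow, hφ]
    module
  clear_value φ
  rw [h3, h4, constraint, dirac_add_right hε (Or.inr rfl), dirac_sub_left hε (Or.inl rfl),
    dirac_add_left hε (Or.inr rfl), dirac_smul_left, dirac_smul_left, dirac_du_right hε, h1, h2,
    diracS_zero_left, diracS_zero_left]
  push_cast
  ring

/-! ### Brackets in terms of pairings -/

theorem scriInt_four (hε : 0 < ε) (l m : F1 ε) (a b : F0 ε) (X Y : F0 ε) (Z W : F1 ε) :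
    scriInt (fun u R => conj (l u R) * X u R + conj (a u R) * Z u R + m u R * conj (Y u R) +
      b u R * conj (W u R)) =
    dirac l X + dirac a Z + conj (dirac m Y) + conj (dirac b W) := by
  have h1 := tame_dirac hε (Or.inl rfl) l X
  have h2 := tame_dirac hε (Or.inr rfl) a Z
  have h3 : Tame fun u R => m u R * conj (Y u R) := by
    simpa only [mul_comm] using tame_dirac hε (Or.inr rfl) Y m
  have h4 : Tame fun u R => b u R * conj (W u R) := by
    simpa only [mul_comm] using tame_dirac hε (Or.inl rfl) W b
  rw [((h1.add h2).add h3).scriInt_add h4, (h1.add h2).scriInt_add h3, h1.scriInt_add h2,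
    dirac_conj, dirac_conj]
  simp only [dirac, mul_comm]

theorem smear_eq (hε : 0 < ε) (s : Smearing ε) (X : CTangent ε) :
    smear s X = dirac (s fσ) X.1.1 + dirac (s fNbar) X.1.2 + conj (dirac (s fσbar) X.2.1) +
      conj (dirac (s fN) X.2.2) := scriInt_four hε _ _ _ _ _ _ _ _

theorem omegaC_eq (hε : 0 < ε) (X X' : CTangent ε) :
    omegaC X X' = (1 / (8 * Real.pi) : ℂ) * (dirac X.2.2 X'.1.1 - dirac X'.2.2 X.1.1 +
      (conj (dirac X.1.2 X'.2.1) - conj (dirac X'.1.2 X.2.1))) := by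
  have h1 := tame_dirac hε (Or.inl rfl) X.2.2 X'.1.1
  have h2 := tame_dirac hε (Or.inl rfl) X'.2.2 X.1.1
  have h3 : Tame fun u R => X.1.2 u R * conj (X'.2.1 u R) := by
    simpa only [mul_comm] using tame_dirac hε (Or.inr rfl) X'.2.1 X.1.2
  have h4 : Tame fun u R => X'.1.2 u R * conj (X.2.1 u R) := by
    simpa only [mul_comm] using tame_dirac hε (Or.inr rfl) X.2.1 X'.1.2
  rw [omegaC, (h1.sub h2).scriInt_add (h3.sub h4), h1.scriInt_sub h2, h3.scriInt_sub h4,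
    dirac_conj, dirac_conj]
  simp only [dirac, mul_comm]

theorem smearedConstraintC_eq (hε : 0 < ε) (φ : F0 ε × F0 ε) (X : CTangent ε) :
    smearedConstraintC φ X = (1 / (8 * Real.pi) : ℂ) *
      (dirac φ.1 (constraint X.1) + conj (dirac φ.2 (constraint X.2))) := by
  have h1 := tame_dirac hε (Or.inr rfl) φ.1 (constraint X.1)
  have h2 : Tame fun u R => φ.2 u R * conj (constraint X.2 u R) := by
    simpa only [mul_comm] using tame_dirac hε (Or.inl rfl) (constraint X.2) φ.2
  rw [smearedConstraintC, h1.scriInt_add h2, dirac_conj]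
  simp only [dirac, mul_comm]

theorem omega_eq (hε : 0 < ε) (X X' : Phase ε) :
    omega X X' = 1 / (4 * Real.pi) * (dirac X.2 X'.1 - dirac X'.2 X.1).re := by
  rw [omega, (tame_dirac hε (Or.inl rfl) X.2 X'.1).scriInt_sub
    (tame_dirac hε (Or.inl rfl) X'.2 X.1)]
  rfl

theorem smearedConstraint_eq (φ : F0 ε) (p : Phase ε) :
    smearedConstraint φ p = 1 / (4 * Real.pi) * (dirac φ (constraint p)).re := rfl

theorem differential_eq (hε : 0 < ε) {F : Phase ε → ℝ} {D : Phase ε → F1 ε × F0 ε}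
    (hF : IsRegular F D) (p Y : Phase ε) :
    differential F p Y = 2 * (dirac (D p).1 Y.1 + dirac (D p).2 Y.2).re := by
  have h1 := hF.deriv_eq p Y
  rw [scriInt_four hε] at h1
  have h2 := congrArg Complex.re h1
  simp only [Complex.ofReal_re, Complex.add_re, Complex.conj_re] at h2
  rw [h2, Complex.add_re]
  ring

/-! ### Evaluation of the brackets -/

/-- The complexified equation decouples into two copies of the real one. `Ω` pairs `σ` with `N` and
`σ̄` with `N̄`, so the smearings of `σ̄, N` drive `σ, N̄` and conversely, hence the crossed
components. -/
theorem tangentialFlowC_spec (hε : 0 < ε) {s : Smearing ε} (hs : s.IsProper) :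
    IsTangentialFlowC s (flow (s fσbar) (s fN), flow (s fσ) (s fNbar)) := by
  obtain ⟨φ₂, hφ₂, h2⟩ := exists_flow hε hs.1
  obtain ⟨φ₁, hφ₁, h1⟩ := exists_flow hε hs.2
  refine ⟨(φ₁, φ₂), hφ₁, hφ₂, fun Y => ?_, fun φ' _ _ => ?_⟩
  · have e1 := h1 Y.1
    have e2 := congrArg conj (h2 Y.2)
    rw [smear_eq hε, smearedConstraintC_eq hε, omegaC_eq hε]
    simp only [map_add, map_sub, map_mul, map_zero, dirac_conj, Complex.conj_ofReal,
      map_ofNat] at e1 e2 ⊢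
    have hp : (Real.pi : ℂ) ≠ 0 := Complex.ofReal_ne_zero.2 Real.pi_ne_zero
    field_simp
    linear_combination e1 + e2
  · rw [smearedConstraintC_eq hε, constraint_flow, constraint_flow, dirac_zero_right,
      dirac_zero_right]
    simp

/-- Test vectors and constraint smearings with one vanishing component isolate the two copies, to
each of which `flow_unique` applies. -/
theorem tangentialFlowC_unique (hε : 0 < ε) {s : Smearing ε} {X : CTangent ε}
    (hX : IsTangentialFlowC s X) : X = (flow (s fσbar) (s fN), flow (s fσ) (s fNbar)) := by
  obtain ⟨φ, hφ₁, hφ₂, h, h'⟩ := hX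
  have hp : (Real.pi : ℂ) ≠ 0 := Complex.ofReal_ne_zero.2 Real.pi_ne_zero
  have hz : IsConstraintSmearing (0 : F0 ε) := ⟨limPlus_zero, limMinus_zero⟩
  have z1 : ∀ {i j : Kind} (g : FSpace ε j), dirac (0 : FSpace ε i) g = 0 := fun g => by
    rw [← dirac_conj, dirac_zero_right, map_zero]
  refine Prod.ext (flow_unique hε hφ₂ (fun Y => ?_) fun φ' hφ' => ?_)
    (flow_unique hε hφ₁ (fun Y => ?_) fun φ' hφ' => ?_)
  · have h1 := h (0, Y)
    rw [smear_eq hε, smearedConstraintC_eq hε, omegaC_eq hε] at h1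
    simp only [Prod.fst_zero, Prod.snd_zero, constraint, du_zero, add_zero, dirac_zero_right, z1,
      dirac_conj, map_zero] at h1
    rw [← Complex.conj_re, ← Complex.zero_re]
    congr 1
    simp only [map_add, map_sub, map_mul, dirac_conj, Complex.conj_ofReal, map_ofNat, constraint]
    field_simp at h1
    linear_combination h1
  · have h1 := h' (φ', 0) hφ' hz
    rw [smearedConstraintC_eq hε] at h1
    simp only [z1, map_zero, add_zero] at h1
    have h2 := (mul_eq_zero.1 h1).resolve_left (by simp [Real.pi_ne_zero])
    rw [h2, Complex.zero_re]
  · have h1 := h (Y, 0)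
    rw [smear_eq hε, smearedConstraintC_eq hε, omegaC_eq hε] at h1
    simp only [Prod.fst_zero, Prod.snd_zero, constraint, du_zero, add_zero, dirac_zero_right, z1,
      dirac_conj, map_zero] at h1
    rw [← Complex.zero_re]
    congr 1
    simp only [constraint]
    field_simp at h1
    linear_combination h1
  · have h1 := h' (0, φ') hz hφ'
    rw [smearedConstraintC_eq hε] at h1
    simp only [z1, zero_add] at h1
    have h2 := (mul_eq_zero.1 h1).resolve_left (by simp [Real.pi_ne_zero])
    rw [← Complex.conj_re, h2, Complex.zero_re]

theorem tangentialFlowC_eq (hε : 0 < ε) {s : Smearing ε} (hs : s.IsProper) :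
    tangentialFlowC s = (flow (s fσbar) (s fN), flow (s fσ) (s fNbar)) :=
  tangentialFlowC_unique hε (Classical.epsilon_spec ⟨_, tangentialFlowC_spec hε hs⟩)

/-- Only the differential at `p` enters, so a nonlinear observable behaves like the linear one with
its functional derivatives as smearings. -/
theorem tangentialFlow_eq (hε : 0 < ε) {F : Phase ε → ℝ} {D : Phase ε → F1 ε × F0 ε}
    (hF : IsRegular F D) {p : Phase ε} (hd : DualConstraint (D p).1 (D p).2) :
    tangentialFlow F p = flow (D p).1 (D p).2 := by
  have hp := Real.pi_ne_zero
  have hex : IsTangentialFlow F p (flow (D p).1 (D p).2) := by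
    obtain ⟨φ, hφ, h⟩ := exists_flow hε hd
    refine ⟨φ, hφ, fun Y => ?_, fun φ' _ => ?_⟩
    · have h1 := congrArg Complex.re (h Y)
      rw [differential_eq hε hF, smearedConstraint_eq, omega_eq hε,
        ← dirac_conj (flow (D p).1 (D p).2).1 Y.2]
      simp only [Complex.add_re, Complex.sub_re, Complex.conj_re, Complex.zero_re] at h1 ⊢
      have h2 : (8 * (Real.pi : ℂ) * (dirac (D p).1 Y.1 + dirac (D p).2 Y.2)).re =
          8 * Real.pi * ((dirac (D p).1 Y.1).re + (dirac (D p).2 Y.2).re) := by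
        rw [show (8 * (Real.pi : ℂ)) = ((8 * Real.pi : ℝ) : ℂ) by push_cast; rfl,
          Complex.re_ofReal_mul, Complex.add_re]
      rw [h2] at h1
      field_simp
      linarith
    · rw [smearedConstraint_eq, constraint_flow, dirac_zero_right]
      simp
  obtain ⟨φ, hφ, h, h'⟩ := Classical.epsilon_spec (p := fun X => IsTangentialFlow F p X) ⟨_, hex⟩
  refine flow_unique hε hφ (fun Y => ?_) fun φ' hφ' => ?_
  · have h1 := h Y
    change differential F p Y + smearedConstraint φ Y = -omega (tangentialFlow F p) Y at h1
    rw [differential_eq hε hF, smearedConstraint_eq, omega_eq hε,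
      ← dirac_conj (tangentialFlow F p).1 Y.2] at h1
    simp only [Complex.add_re, Complex.sub_re, Complex.conj_re] at h1 ⊢
    have h2 : (8 * (Real.pi : ℂ) * (dirac (D p).1 Y.1 + dirac (D p).2 Y.2)).re =
        8 * Real.pi * ((dirac (D p).1 Y.1).re + (dirac (D p).2 Y.2).re) := by
      rw [show (8 * (Real.pi : ℂ)) = ((8 * Real.pi : ℝ) : ℂ) by push_cast; rfl,
        Complex.re_ofReal_mul, Complex.add_re]
    rw [h2]
    field_simp at h1
    linarith
  · have h1 := h' φ' hφ'
    rw [smearedConstraint_eq] at h1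
    exact (mul_eq_zero.1 h1).resolve_left (by simp [hp])

/-- The bilinear form of the directional bracket, on smearings of `σ, N̄` and of `σ̄, N`. -/
def dirForm (l : F1 ε) (α : F0 ε) (m : F1 ε) (β : F0 ε) : ℂ :=
  -(dirac (flow l α).1 m + dirac (flow l α).2 β)

theorem directionalBracketC_eq (hε : 0 < ε) {s : Smearing ε} (hs : s.IsProper) (s' : Smearing ε) :
    directionalBracketC s s' = dirForm (s fσ) (s fNbar) (s' fσbar) (s' fN) +
      conj (dirForm (s fσbar) (s fN) (s' fσ) (s' fNbar)) := by
  rw [directionalBracketC, tangentialFlowC_eq hε hs, smear_eq hε, dirForm, dirForm]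
  simp only [map_neg, map_add, dirac_conj]
  ring

/-- Evaluate Hamilton's equation of `s'` on the flow of `s`: the constraint term drops because that
flow is tangential, leaving `Ω` of the two flows. -/
theorem diracBracketC_eq (hε : 0 < ε) {s s' : Smearing ε} (hs : s.IsProper) (hs' : s'.IsProper) :
    diracBracketC s s' = directionalBracketC s s' := by
  obtain ⟨φ, -, -, h, -⟩ := tangentialFlowC_spec hε hs'
  have h1 := h (tangentialFlowC s)
  rw [diracBracketC, directionalBracketC, tangentialFlowC_eq hε hs']
  have h2 : smearedConstraintC φ (tangentialFlowC s) = 0 := by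
    rw [tangentialFlowC_eq hε hs, smearedConstraintC_eq hε, constraint_flow, constraint_flow,
      dirac_zero_right, dirac_zero_right]
    simp
  have h3 : ∀ X X' : CTangent ε, omegaC X X' = -omegaC X' X := by
    intro X X'
    rw [omegaC_eq hε, omegaC_eq hε]
    ring
  rw [h2, add_zero] at h1
  rw [h1, h3, neg_neg]

theorem isProper_realSmearing {D : F1 ε × F0 ε} (hD : DualConstraint D.1 D.2) :
    (realSmearing D).IsProper := ⟨hD, hD⟩

/-- For real smearings the two copies of the flow coincide, and the complexified objects restrict to
the real ones. The real reproducing conditions thereby become instances of the complex ones. -/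
theorem directionalBracket_eq (hε : 0 < ε) {F G : Phase ε → ℝ} {DF DG : Phase ε → F1 ε × F0 ε}
    (hF : IsRegular F DF) (hG : IsRegular G DG) {p : Phase ε}
    (hd : DualConstraint (DF p).1 (DF p).2) :
    (directionalBracket F G p : ℂ) =
      directionalBracketC (realSmearing (DF p)) (realSmearing (DG p)) := by
  rw [directionalBracketC, tangentialFlowC_eq hε (isProper_realSmearing hd), directionalBracket,
    tangentialFlow_eq hε hF hd, Complex.ofReal_neg, hG.deriv_eq]
  rfl

theorem diracBracket_eq (hε : 0 < ε) {F G : Phase ε → ℝ} {DF DG : Phase ε → F1 ε × F0 ε}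
    (hF : IsRegular F DF) (hG : IsRegular G DG) {p : Phase ε}
    (hd : DualConstraint (DF p).1 (DF p).2) (hd' : DualConstraint (DG p).1 (DG p).2) :
    (diracBracket F G p : ℂ) = diracBracketC (realSmearing (DF p)) (realSmearing (DG p)) := by
  rw [diracBracketC, tangentialFlowC_eq hε (isProper_realSmearing hd),
    tangentialFlowC_eq hε (isProper_realSmearing hd'), diracBracket, tangentialFlow_eq hε hF hd,
    tangentialFlow_eq hε hG hd', omega_eq hε, omegaC_eq hε]
  simp only [realSmearing]
  set X := flow (DF p).1 (DF p).2
  set X' := flow (DG p).1 (DG p).2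
  have h1 : dirac X.2 X'.1 - dirac X'.2 X.1 + (conj (dirac X.2 X'.1) - conj (dirac X'.2 X.1)) =
      2 * ((dirac X.2 X'.1 - dirac X'.2 X.1).re : ℂ) := by
    rw [← map_sub, Complex.add_conj]
    push_cast
    ring
  rw [h1]
  push_cast
  have hp : (Real.pi : ℂ) ≠ 0 := Complex.ofReal_ne_zero.2 Real.pi_ne_zero
  field_simp
  ring

/-! ### Differentiation under the integral -/

theorem rotE₁_mul_rotE₁ (s t : ℝ) : rotE₁ s * rotE₁ t = rotE₁ (s + t) := by
  ext i j
  fin_cases i <;> fin_cases j <;>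
    simp [rotE₁, Real.cos_add, Real.sin_add] <;> ring

theorem rotE₂_mul_rotE₂ (s t : ℝ) : rotE₂ s * rotE₂ t = rotE₂ (s + t) := by
  ext i j
  fin_cases i <;> fin_cases j <;>
    simp [rotE₂, Real.cos_add, Real.sin_add] <;> ring

/-- For a one-parameter subgroup the derivative at time `t` is the derivative at time `0` based at
`R * γ t`. A bound uniform over frames then dominates at all times. -/
theorem alongCurve_integral {γ : ℝ → SO3} {E : Fin 3 → Fin 3 → ℝ} (hγ : IsCurve γ E)
    (hadd : ∀ s t, γ s * γ t = γ (s + t)) {f : ℝ → SO3 → ℂ} (hf : ScriSmooth f) (ht : Tame f)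
    (hd : Tame fun u R => alongCurve γ (f u) R) (R : SO3) :
    alongCurve γ (fun R => ∫ u, f u R) R = ∫ u, alongCurve γ (f u) R := by
  obtain ⟨b, hb, h⟩ := hd.bound
  have key := hasDerivAt_integral_of_dominated_loc_of_deriv_le (μ := volume) (𝕜 := ℝ)
    (F := fun t u => f u (R * γ t)) (F' := fun t u => alongCurve γ (f u) (R * γ t)) (x₀ := 0)
    (s := Set.univ) (bound := b) Filter.univ_mem
    (Eventually.of_forall fun t => (ht.continuous_left _).aestronglyMeasurable)
    (ht.integrable _) (hd.continuous_left _).aestronglyMeasurable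
    (Eventually.of_forall fun u t _ => h u _) hb
    (Eventually.of_forall fun u t _ => ?_)
  · have h1 := key.2.deriv
    simp only [hγ.1, mul_one] at h1
    exact h1
  · have h1 := (hf.alongCurve_differentiableAt hγ u (R * γ t)).hasDerivAt
    have h2 : HasDerivAt (fun r => f u (R * γ t * γ r)) (alongCurve γ (f u) (R * γ t)) (t - t) := by
      rw [sub_self]
      exact h1
    have h3 := h2.comp_sub_const t t
    refine h3.congr_of_eventuallyEq (Eventually.of_forall fun r => ?_)
    simp only [mul_assoc, hadd, add_sub_cancel]

/-- Recovering the real directional derivatives from `ð` and `ð̄` lets the decay of words longer by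
one letter dominate them. -/
theorem alongCurve_eq_eth_rotE₁ (h : SO3 → ℂ) (R : SO3) :
    alongCurve rotE₁ h R = ((Real.sqrt 2 / 2 : ℝ) : ℂ) * (eth h R + ethBar h R) := by
  have h2 : (Real.sqrt 2 : ℂ) ≠ 0 := Complex.ofReal_ne_zero.2 (by positivity)
  simp only [eth, ethBar]
  push_cast
  field_simp
  ring

theorem alongCurve_eq_eth_rotE₂ (h : SO3 → ℂ) (R : SO3) :
    alongCurve rotE₂ h R =
      (((Real.sqrt 2 / 2 : ℝ) : ℂ) * Complex.I) * (eth h R - ethBar h R) := by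
  have h2 : (Real.sqrt 2 : ℂ) ≠ 0 := Complex.ofReal_ne_zero.2 (by positivity)
  simp only [eth, ethBar]
  push_cast
  field_simp
  linear_combination (2 * alongCurve rotE₂ h R) * Complex.I_sq

theorem F1.tame_alongCurve_rotE₁ (hε : 0 < ε) (l : F1 ε) (w : List Bool) :
    Tame fun u R => alongCurve rotE₁ (word w (l u)) R := by
  simp only [alongCurve_eq_eth_rotE₁]
  exact ((l.tame_word hε (true :: w)).add (l.tame_word hε (false :: w))).const_mul _

theorem F1.tame_alongCurve_rotE₂ (hε : 0 < ε) (l : F1 ε) (w : List Bool) :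
    Tame fun u R => alongCurve rotE₂ (word w (l u)) R := by
  simp only [alongCurve_eq_eth_rotE₂]
  exact ((l.tame_word hε (true :: w)).sub (l.tame_word hε (false :: w))).const_mul _

theorem word_intU (hε : 0 < ε) (l : F1 ε) (w : List Bool) :
    word w (intU hε l) = fun R => ∫ u, word w (l u) R := by
  induction w with
  | nil => rfl
  | cons b w ih =>
    have h1 := l.tame_alongCurve_rotE₁ hε w
    have h2 := l.tame_alongCurve_rotE₂ hε w
    have e1 := alongCurve_integral isCurve_rotE₁ rotE₁_mul_rotE₁ (l.scriSmooth.word w)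
      (l.tame_word hε w) h1
    have e2 := alongCurve_integral isCurve_rotE₂ rotE₂_mul_rotE₂ (l.scriSmooth.word w)
      (l.tame_word hε w) h2
    funext R
    cases b
    · simp only [word, ih, ethBar, e1, e2]
      rw [integral_const_mul, integral_add (h1.integrable R) ((h2.const_mul _).integrable R),
        integral_const_mul]
    · simp only [word, ih, eth, e1, e2]
      rw [integral_const_mul, integral_sub (h1.integrable R) ((h2.const_mul _).integrable R),
        integral_const_mul]

/-! ### Gauges: continuity of linear and bilinear maps -/

/-- The supremum norm of a family of functionals. -/
def supGauge {V X : Type} [AddCommGroup V] [Module ℝ V] (T : V →ₗ[ℝ] (X → ℂ)) (v : V) : ℝ :=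
  ⨆ x, ‖T v x‖

/-- Boundedness is essential, since the supremum of an unbounded real family is `0` by convention.
-/
theorem le_supGauge {V X : Type} [AddCommGroup V] [Module ℝ V] {T : V →ₗ[ℝ] (X → ℂ)} (hb : ∀ v, ∃ C : ℝ, ∀ x, ‖T v x‖ ≤ C) (v : V) (x : X) :
    ‖T v x‖ ≤ supGauge T v := by
  obtain ⟨C, hC⟩ := hb v
  exact le_ciSup (f := fun x => ‖T v x‖) ⟨C, by rintro _ ⟨y, rfl⟩; exact hC y⟩ x

section Gauge

variable {V W : Type} [AddCommGroup V] [TopologicalSpace V] [AddCommGroup W] [TopologicalSpace W]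

/-- A function that tends to zero at small differences (e.g. a continuous seminorm). -/
def IsGauge (p : V → ℝ) : Prop := ∀ v₀, Tendsto (fun v => p (v - v₀)) (𝓝 v₀) (𝓝 0)

theorem IsGauge.add {p q : V → ℝ} (hp : IsGauge p) (hq : IsGauge q) :
    IsGauge fun v => p v + q v := fun v₀ => by simpa using (hp v₀).add (hq v₀)

theorem IsGauge.const_mul {p : V → ℝ} (hp : IsGauge p) (c : ℝ) : IsGauge fun v => c * p v :=
  fun v₀ => by simpa using (hp v₀).const_mul c

variable [Module ℝ V] [Module ℝ W]

theorem IsGauge.comp {p : W → ℝ} (hp : IsGauge p) {L : V →ₗ[ℝ] W} (hL : Continuous L) :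
    IsGauge fun v => p (L v) := fun v₀ => by
  simp only [map_sub]
  exact (hp (L v₀)).comp hL.continuousAt

variable {X : Type}

theorem isGauge_supGauge [Nonempty X] {T : V →ₗ[ℝ] (X → ℂ)} (hT : Continuous fun v => UniformFun.ofFun (T v)) :
    IsGauge (supGauge T) := by
  intro v₀
  have h1 := UniformFun.tendsto_iff_tendstoUniformly.1 (hT.tendsto v₀)
  rw [Metric.tendstoUniformly_iff] at h1
  rw [Metric.tendsto_nhds]
  intro δ hδ
  -- Passing to the supremum weakens `<` to `≤`; halving `δ` restores strictness.
  filter_upwards [h1 (δ / 2) (half_pos hδ)] with v hv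
  have h2 : supGauge T (v - v₀) ≤ δ / 2 := ciSup_le fun x => by
    have := hv x
    rw [dist_comm, dist_eq_norm] at this
    rw [map_sub]
    exact this.le
  have h3 : 0 ≤ supGauge T (v - v₀) := Real.iSup_nonneg fun x => norm_nonneg _
  rw [Real.dist_eq, sub_zero, abs_of_nonneg h3]
  linarith

theorem continuous_of_gauge {T : V →ₗ[ℝ] (X → ℂ)} {p : V → ℝ} (hp : IsGauge p)
    (h : ∀ v x, ‖T v x‖ ≤ p v) : Continuous fun v => UniformFun.ofFun (T v) := by
  rw [continuous_iff_continuousAt]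
  intro v₀
  refine UniformFun.tendsto_iff_tendstoUniformly.2 (Metric.tendstoUniformly_iff.2 fun δ hδ => ?_)
  filter_upwards [(hp v₀).eventually (gt_mem_nhds hδ)] with v hv x
  refine lt_of_le_of_lt ?_ hv
  have := h (v - v₀) x
  rw [dist_comm, dist_eq_norm]
  rwa [map_sub] at this

/-- Bounded bilinear maps are bidistributions. -/
def Bidist.ofBound (B : V →ₗ[ℝ] W →ₗ[ℝ] ℂ) {p : V → ℝ} {q : W → ℝ} (hp : IsGauge p)
    (hq : IsGauge q) (h : ∀ v w, ‖B v w‖ ≤ p v * q w) : Bidist V W where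
  toLin := B
  cont := by
    rw [continuous_iff_continuousAt]
    rintro ⟨v₀, w₀⟩
    have hv : Tendsto (fun x : V × W => p (x.1 - v₀)) (𝓝 (v₀, w₀)) (𝓝 0) :=
      (hp v₀).comp continuous_fst.continuousAt
    have hw : Tendsto (fun x : V × W => q (x.2 - w₀)) (𝓝 (v₀, w₀)) (𝓝 0) :=
      (hq w₀).comp continuous_snd.continuousAt
    have h0 := ((hv.mul hw).add (hv.mul_const (q w₀))).add (hw.const_mul (p v₀))
    simp only [mul_zero, zero_mul, add_zero] at h0
    refine tendsto_iff_norm_sub_tendsto_zero.2 (squeeze_zero (fun _ => norm_nonneg _)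
      (fun x => ?_) h0)
    -- Expanding about the base point leaves terms that each contain a small difference, matching
    -- the three limits in `h0`.
    have e : B x.1 x.2 - B v₀ w₀ =
        B (x.1 - v₀) (x.2 - w₀) + B (x.1 - v₀) w₀ + B v₀ (x.2 - w₀) := by
      simp only [map_sub, LinearMap.sub_apply]
      ring
    rw [e]
    exact (norm_add_le _ _).trans (add_le_add ((norm_add_le _ _).trans
      (add_le_add (h _ _) (h _ _))) (h _ _))

end Gauge

/-! ### Topologies of the test spaces -/

instance : Nonempty SO3 := ⟨1⟩

/-- `e ↦ 𝒟 e` -/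
def elecT (w : List Bool) : Elec →ₗ[ℝ] (SO3 → ℂ) where
  toFun e := word w e
  map_add' e e' := word_add e.scriSmooth e'.scriSmooth w 0
  map_smul' c e := word_smul e w c

/-- `g ↦ (1 + u²)^{k/2 + 1/2 + ε} ∂ᵤᵏ 𝒟 g` -/
def f1T (ε : ℝ) (k : ℕ) (w : List Bool) : F1 ε →ₗ[ℝ] (ℝ × SO3 → ℂ) where
  toFun g x := ((1 + x.1 ^ 2) ^ ((k : ℝ) / 2 + 1 / 2 + ε) : ℝ) •
    iteratedDeriv k (fun v => word w (g v) x.2) x.1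
  map_add' f g := by
    funext x
    have h1 : (fun v => word w ((f + g) v) x.2) =
        (fun v => word w (f v) x.2) + fun v => word w (g v) x.2 :=
      funext fun v => congrFun (word_add f.scriSmooth g.scriSmooth w v) x.2
    simp only [Pi.add_apply]
    rw [h1, iteratedDeriv_add
      (((f.scriSmooth.word w).contDiff x.2).contDiffAt.of_le (by exact_mod_cast le_top))
      (((g.scriSmooth.word w).contDiff x.2).contDiffAt.of_le (by exact_mod_cast le_top)), smul_add]
  map_smul' c g := by
    funext x
    have h1 : (fun v => word w ((c • g) v) x.2) = c • (fun v => word w (g v) x.2) :=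
      funext fun v => congrFun (word_smul (g v) w c) x.2
    simp only [Pi.smul_apply, RingHom.id_apply]
    rw [h1, iteratedDeriv_const_smul_field, smul_comm]

theorem f1T_apply (k : ℕ) (w : List Bool) (g : F1 ε) (x : ℝ × SO3) : f1T ε k w g x =
    ((1 + x.1 ^ 2) ^ ((k : ℝ) / 2 + 1 / 2 + ε) : ℝ) •
      iteratedDeriv k (fun v => word w (g v) x.2) x.1 := rfl

theorem continuous_elecT (w : List Bool) : Continuous fun e : Elec => UniformFun.ofFun (elecT w e) :=
  continuous_iInf_dom (i := w) continuous_induced_dom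

theorem continuous_f1T (k : ℕ) (w : List Bool) :
    Continuous fun g : F1 ε => UniformFun.ofFun (f1T ε k w g) :=
  continuous_iInf_dom (i := k) (continuous_iInf_dom (i := w) continuous_induced_dom)

theorem elecT_bounded (w : List Bool) (e : Elec) : ∃ C : ℝ, ∀ R, ‖elecT w e R‖ ≤ C := by
  obtain ⟨C, hC⟩ := (e.scriSmooth.word w).bounded_of_compact (isCompact_singleton (x := (0 : ℝ)))
  exact ⟨C, hC 0 rfl⟩

theorem f1T_bounded (k : ℕ) (w : List Bool) (g : F1 ε) : ∃ C : ℝ, ∀ x, ‖f1T ε k w g x‖ ≤ C := by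
  obtain ⟨C, hC⟩ := g.decay k w
  exact ⟨C, fun x => hC x.1 x.2⟩

/-- `sup |𝒟 e|` -/
def elecGauge (w : List Bool) : Elec → ℝ := supGauge (elecT w)

/-- `sup |(1 + u²)^{k/2 + 1/2 + ε} ∂ᵤᵏ 𝒟 g|` -/
def f1Gauge (ε : ℝ) (k : ℕ) (w : List Bool) : F1 ε → ℝ := supGauge (f1T ε k w)

theorem isGauge_elecGauge (w : List Bool) : IsGauge (elecGauge w) :=
  isGauge_supGauge (continuous_elecT w)

theorem isGauge_f1Gauge (k : ℕ) (w : List Bool) : IsGauge (f1Gauge ε k w) :=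
  isGauge_supGauge (continuous_f1T k w)

theorem norm_word_le_elecGauge (w : List Bool) (e : Elec) (R : SO3) :
    ‖word w e R‖ ≤ elecGauge w e := le_supGauge (elecT_bounded w) e R

theorem norm_word_le_f1Gauge (w : List Bool) (g : F1 ε) (u : ℝ) (R : SO3) :
    ‖word w (g u) R‖ ≤ f1Gauge ε 0 w g * ((1 + u ^ 2) ^ (-(1 / 2 + ε)) : ℝ) := by
  have h := le_supGauge (f1T_bounded 0 w) g (u, R)
  refine norm_le_of_weighted ?_
  simpa [f1T_apply, f1Gauge] using h

section Continuity

variable {V : Type} [AddCommGroup V] [Module ℝ V] [TopologicalSpace V]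

theorem continuous_elec_rng {L : V →ₗ[ℝ] Elec} (p : List Bool → V → ℝ) (hp : ∀ w, IsGauge (p w))
    (h : ∀ w v R, ‖word w (L v) R‖ ≤ p w v) : Continuous L :=
  continuous_iInf_rng.2 fun w => continuous_induced_rng.2
    (continuous_of_gauge (T := (elecT w).comp L) (hp w) (h w))

theorem continuous_f1_rng {L : V →ₗ[ℝ] F1 ε} (p : ℕ → List Bool → V → ℝ)
    (hp : ∀ k w, IsGauge (p k w)) (h : ∀ k w v x, ‖f1T ε k w (L v) x‖ ≤ p k w v) :
    Continuous L :=
  continuous_iInf_rng.2 fun k => continuous_iInf_rng.2 fun w => continuous_induced_rng.2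
    (continuous_of_gauge (T := (f1T ε k w).comp L) (hp k w) (h k w))

end Continuity

/-- The order `k + 1` seminorms of `ℱ₀` are the order `k` seminorms of `ℱ₁` after `∂ᵤ`, so the
topology of `ℱ₀` is governed by `du` and `limMinus`. -/
theorem f0_weight_eq (f : F0 ε) (k : ℕ) (w : List Bool) (x : ℝ × SO3) :
    ((1 + x.1 ^ 2) ^ (((k + 1 : ℕ) : ℝ) / 2 + ε) : ℝ) •
      iteratedDeriv (k + 1) (fun v => word w (f v) x.2) x.1 = f1T ε k w (du f) x := by
  rw [f1T_apply, F0.iteratedDeriv_word_du]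
  congr 2
  push_cast
  ring

theorem continuous_limMinusL : Continuous (limMinusL ε) :=
  continuous_iInf_rng.2 fun w => continuous_induced_rng.2 <| continuous_iff_le_induced.2 <|
    (inf_le_left : topF0 ε ≤ _).trans (iInf_le _ w)

theorem continuous_duL : Continuous (duL ε) := by
  refine continuous_iInf_rng.2 fun k => continuous_iInf_rng.2 fun w => continuous_induced_rng.2 ?_
  have h : Continuous[topF0 ε, _] (fun f : F0 ε => UniformFun.ofFun (fun x : ℝ × SO3 =>
      ((1 + x.1 ^ 2) ^ (((k + 1 : ℕ) : ℝ) / 2 + ε) : ℝ) •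
        iteratedDeriv (k + 1) (fun v => word w (f v) x.2) x.1)) :=
    continuous_iff_le_induced.2 <| (inf_le_right : topF0 ε ≤ _).trans <|
      (iInf_le _ (k + 1)).trans <| (iInf_le _ (Nat.le_add_left 1 k)).trans (iInf_le _ w)
  simp only [f0_weight_eq] at h
  exact h

/-- On primitives the first family of seminorms vanishes and the second is that of `ℱ₁`. -/
theorem continuous_primL : Continuous (primL ε) := by
  refine continuous_inf_rng.2 ⟨continuous_iInf_rng.2 fun w => continuous_induced_rng.2 ?_,
    continuous_iInf_rng.2 fun k => continuous_iInf_rng.2 fun hk => continuous_iInf_rng.2 fun w =>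
      continuous_induced_rng.2 ?_⟩
  · simp only [Function.comp_def, primL_apply, limMinus_prim]
    exact continuous_const
  · obtain ⟨k, rfl⟩ := Nat.exists_eq_add_of_le' hk
    simp only [Function.comp_def, primL_apply, f0_weight_eq, du_prim]
    exact continuous_f1T k w

/-- Words in `ð, ð̄` pass under the integral, and the order-zero seminorm of `ℱ₁` controls each
result. -/
theorem continuous_intUL (hε : 0 < ε) : Continuous (intUL hε) := by
  refine continuous_elec_rng
    (fun w l => (∫ u : ℝ, ((1 + u ^ 2) ^ (-(1 / 2 + ε)) : ℝ)) * f1Gauge ε 0 w l)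
    (fun w => (isGauge_f1Gauge 0 w).const_mul _) fun w l R => ?_
  rw [intUL_apply, word_intU, mul_comm, ← integral_const_mul]
  exact norm_integral_le_of_norm_le ((integrable_decay hε).const_mul _)
    (Eventually.of_forall fun u => norm_word_le_f1Gauge w l u R)

/-- Each seminorm of the product of `e` with the derivative of the step factors into `sup |𝒟 e|` and
a constant depending only on the step. -/
theorem continuous_sectionL : Continuous (sectionL ε) := by
  have hC : ∀ k : ℕ, ∃ C : ℝ, ∀ u : ℝ, ‖((1 + u ^ 2) ^ ((k : ℝ) / 2 + 1 / 2 + ε) : ℝ) •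
      iteratedDeriv (k + 1) (fun v => (Real.smoothTransition v : ℂ)) u‖ ≤ C := by
    intro k
    have hs : ScriSmooth fun u _ => (Real.smoothTransition u : ℂ) :=
      ⟨fun x => (Real.smoothTransition x.1 : ℂ), Complex.ofRealCLM.contDiff.comp
        (Real.smoothTransition.contDiff.comp contDiff_fst), fun _ _ => rfl⟩
    obtain ⟨C, hC⟩ := (hs.iteratedDeriv (k + 1)).weighted_bound (isCompact_Icc (a := 0) (b := 1))
      (fun u hu _ => by
        obtain ⟨c, hc⟩ := smoothTransition_eventually hu
        have h1 : (fun v => (Real.smoothTransition v : ℂ)) =ᶠ[𝓝 u] fun _ => (c : ℂ) := by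
          filter_upwards [hc] with v hv
          rw [hv]
        rw [h1.iteratedDeriv_eq, iteratedDeriv_const, if_neg (by omega)])
      ((k : ℝ) / 2 + 1 / 2 + ε)
    exact ⟨C, fun u => hC u 1⟩
  choose C hC using hC
  refine continuous_f1_rng (fun k w e => C k * elecGauge w e)
    (fun k w => (isGauge_elecGauge w).const_mul _) fun k w e x => ?_
  rw [f1T_apply, sectionL_eq, F0.iteratedDeriv_word_du]
  have h1 : (fun v => word w (stepF0 ε e v) x.2) =
      fun v => word w e x.2 * (Real.smoothTransition v : ℂ) := funext fun v =>
    (word_real_mul e w (Real.smoothTransition v) x.2).trans (mul_comm _ _)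
  rw [h1, iteratedDeriv_const_mul_field, mul_comm, ← smul_mul_assoc, norm_mul]
  exact mul_le_mul (hC k x.1) (norm_word_le_elecGauge w e x.2) (norm_nonneg _)
    ((norm_nonneg _).trans (hC k x.1))

/-! ### Operations on bidistributions -/

section Bidist

variable {V W V' W' : Type} [AddCommGroup V] [Module ℝ V] [TopologicalSpace V]
  [AddCommGroup W] [Module ℝ W] [TopologicalSpace W]
  [AddCommGroup V'] [Module ℝ V'] [TopologicalSpace V']
  [AddCommGroup W'] [Module ℝ W'] [TopologicalSpace W']

namespace Bidist

theorem ext {B C : Bidist V W} (h : ∀ v w, B v w = C v w) : B = C := by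
  obtain ⟨B, hB⟩ := B
  obtain ⟨C, hC⟩ := C
  have : B = C := LinearMap.ext₂ h
  subst this
  rfl

theorem map_add_left (B : Bidist V W) (v v' : V) (w : W) : B (v + v') w = B v w + B v' w := by
  simp [eval]
theorem map_sub_left (B : Bidist V W) (v v' : V) (w : W) : B (v - v') w = B v w - B v' w := by
  simp [eval]
theorem map_sub_right (B : Bidist V W) (v : V) (w w' : W) : B v (w - w') = B v w - B v w' := by
  simp [eval]
theorem map_neg_left (B : Bidist V W) (v : V) (w : W) : B (-v) w = -B v w := by simp [eval]
theorem map_neg_right (B : Bidist V W) (v : V) (w : W) : B v (-w) = -B v w := by simp [eval]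
@[simp] theorem map_zero_left (B : Bidist V W) (w : W) : B 0 w = 0 := by simp [eval]
@[simp] theorem map_zero_right (B : Bidist V W) (v : V) : B v 0 = 0 := by simp [eval]

instance : Zero (Bidist V W) := ⟨⟨0, continuous_const⟩⟩
instance : Add (Bidist V W) := ⟨fun B C => ⟨B.toLin + C.toLin, B.cont.add C.cont⟩⟩
instance : Neg (Bidist V W) := ⟨fun B => ⟨-B.toLin, B.cont.neg⟩⟩
instance : Sub (Bidist V W) := ⟨fun B C => ⟨B.toLin - C.toLin, B.cont.sub C.cont⟩⟩
instance : SMul ℝ (Bidist V W) := ⟨fun c B => ⟨c • B.toLin, B.cont.const_smul c⟩⟩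

@[simp] theorem zero_apply (v : V) (w : W) : (0 : Bidist V W) v w = 0 := rfl
@[simp] theorem add_apply (B C : Bidist V W) (v : V) (w : W) : (B + C) v w = B v w + C v w := rfl
@[simp] theorem neg_apply (B : Bidist V W) (v : V) (w : W) : (-B) v w = -B v w := rfl
@[simp] theorem sub_apply (B C : Bidist V W) (v : V) (w : W) : (B - C) v w = B v w - C v w := rfl
@[simp] theorem smul_apply (c : ℝ) (B : Bidist V W) (v : V) (w : W) :
    (c • B) v w = (c : ℂ) * B v w := rfl

/-- Exchange of the two arguments. -/
def flip (B : Bidist V W) : Bidist W V := ⟨B.toLin.flip, B.cont.comp continuous_swap⟩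

@[simp] theorem flip_apply (B : Bidist V W) (v : V) (w : W) : B.flip w v = B v w := rfl

/-- Complex conjugation. -/
def conjugate (B : Bidist V W) : Bidist V W :=
  ⟨B.toLin.compr₂ Complex.conjAe.toLinearMap, Complex.continuous_conj.comp B.cont⟩

@[simp] theorem conjugate_apply (B : Bidist V W) (v : V) (w : W) :
    B.conjugate v w = starRingEnd ℂ (B v w) := rfl

/-- Composition with continuous linear maps. -/
def comp (B : Bidist V W) {L : V' →ₗ[ℝ] V} (hL : Continuous L) {M : W' →ₗ[ℝ] W}
    (hM : Continuous M) : Bidist V' W' :=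
  ⟨B.toLin.compl₁₂ L M, B.cont.comp ((hL.comp continuous_fst).prodMk (hM.comp continuous_snd))⟩

@[simp] theorem comp_apply (B : Bidist V W) {L : V' →ₗ[ℝ] V} (hL : Continuous L)
    {M : W' →ₗ[ℝ] W} (hM : Continuous M) (v : V') (w : W') : B.comp hL hM v w = B (L v) (M w) :=
  rfl

/-- Composition with a continuous linear map in the first argument. -/
def compLeft (B : Bidist V W) {L : V' →ₗ[ℝ] V} (hL : Continuous L) : Bidist V' W :=
  B.comp hL (M := LinearMap.id) continuous_id

@[simp] theorem compLeft_apply (B : Bidist V W) {L : V' →ₗ[ℝ] V} (hL : Continuous L) (v : V')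
    (w : W) : B.compLeft hL v w = B (L v) w := rfl

/-- Composition with a continuous linear map in the second argument. -/
def compRight (B : Bidist V W) {M : W' →ₗ[ℝ] W} (hM : Continuous M) : Bidist V W' :=
  B.comp (L := LinearMap.id) continuous_id hM

@[simp] theorem compRight_apply (B : Bidist V W) {M : W' →ₗ[ℝ] W} (hM : Continuous M) (v : V)
    (w : W') : B.compRight hM v w = B v (M w) := rfl

end Bidist

end Bidist

/-! ### The basic bidistributions -/

theorem norm_le_elecGauge (e : Elec) (R : SO3) : ‖e R‖ ≤ elecGauge [] e :=
  norm_word_le_elecGauge [] e R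

theorem norm_diracS_le (e e' : Elec) :
    ‖diracS e e'‖ ≤ (2 * Real.pi ^ 2 * elecGauge [] e) * elecGauge [] e' := by
  rw [mul_assoc]
  refine norm_sphereInt_le fun R => ?_
  rw [norm_mul, RCLike.norm_conj]
  exact mul_le_mul (norm_le_elecGauge e R) (norm_le_elecGauge e' R) (norm_nonneg _)
    ((norm_nonneg _).trans (norm_le_elecGauge e R))

/-- `δ(r̂,r̂')` as a bidistribution. -/
def diracSB : Bidist Elec Elec :=
  Bidist.ofBound diracSL ((isGauge_elecGauge []).const_mul _) (isGauge_elecGauge [])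
    norm_diracS_le

@[simp] theorem diracSB_apply (e e' : Elec) : diracSB e e' = diracS e e' := rfl

/-- A bound for the supremum of an element of `ℱ₀`. -/
def f0Gauge (ε : ℝ) (f : F0 ε) : ℝ :=
  (∫ u : ℝ, ((1 + u ^ 2) ^ (-(1 / 2 + ε)) : ℝ)) * f1Gauge ε 0 [] (duL ε f) +
    elecGauge [] (limMinusL ε f)

theorem isGauge_f0Gauge : IsGauge (f0Gauge ε) :=
  (((isGauge_f1Gauge 0 []).comp continuous_duL).const_mul _).add
    ((isGauge_elecGauge []).comp continuous_limMinusL)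

theorem norm_le_f0Gauge (hε : 0 < ε) (f : F0 ε) (u : ℝ) (R : SO3) : ‖f u R‖ ≤ f0Gauge ε f := by
  have h1 := norm_prim_le hε (l := du f) ((integrable_decay hε).const_mul (f1Gauge ε 0 [] (du f)))
    (fun u R => norm_word_le_f1Gauge [] (du f) u R) u R
  rw [integral_const_mul, mul_comm] at h1
  have h2 : f u R = prim (du f) u R + limMinus f R := by
    conv_lhs => rw [f.eq_prim_add]
    rfl
  rw [h2]
  exact (norm_add_le _ _).trans (add_le_add h1 (norm_le_elecGauge _ R))

theorem norm_dirac_le (hε : 0 < ε) (l : F1 ε) (α : F0 ε) : ‖dirac l α‖ ≤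
    (2 * Real.pi ^ 2 * (∫ u : ℝ, ((1 + u ^ 2) ^ (-(1 / 2 + ε)) : ℝ)) * f1Gauge ε 0 [] l) *
      f0Gauge ε α := by
  rw [mul_assoc, mul_assoc]
  refine norm_sphereInt_le fun R => ?_
  have h1 := norm_integral_le_of_norm_le (f := fun u => conj (l u R) * α u R)
    (((integrable_decay hε).const_mul (f1Gauge ε 0 [] l)).mul_const (f0Gauge ε α))
    (Eventually.of_forall fun u => by
      rw [norm_mul, RCLike.norm_conj]
      have h2 := norm_word_le_f1Gauge [] l u R
      exact mul_le_mul h2 (norm_le_f0Gauge hε α u R) (norm_nonneg _) ((norm_nonneg _).trans h2))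
  rw [integral_mul_const, integral_const_mul] at h1
  linarith

/-- `δ(x,x')` as a bidistribution. -/
def diracB (hε : 0 < ε) : Bidist (F1 ε) (F0 ε) :=
  Bidist.ofBound (LinearMap.mk₂ ℝ dirac (dirac_add_left hε (Or.inl rfl))
    (fun c l α => by rw [dirac_smul_left]; rfl) (dirac_add_right hε (Or.inl rfl))
    (fun c l α => by rw [dirac_smul_right]; rfl))
    ((isGauge_f1Gauge 0 []).const_mul _) isGauge_f0Gauge (norm_dirac_le hε)

@[simp] theorem diracB_apply (hε : 0 < ε) (l : F1 ε) (α : F0 ε) : diracB hε l α = dirac l α := rfl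

/-! ### Blocks of brackets -/

/-- The function `∫ du λ - (α₊ - α₋)` of a pair `(λ, α)`, restricted to its components. -/
def defectL (hε : 0 < ε) : (k : Kind) → FSpace ε k →ₗ[ℝ] Elec
  | .shear => intUL hε
  | .news => -((intUL hε).comp (duL ε))

@[simp] theorem defectL_shear (hε : 0 < ε) (l : F1 ε) : defectL hε .shear l = intU hε l := rfl

@[simp] theorem defectL_news (hε : 0 < ε) (α : F0 ε) :
    defectL hε .news α = limMinus α - limPlus α := by
  change -intU hε (du α) = _
  rw [intU_du, neg_sub]

theorem continuous_defectL (hε : 0 < ε) : ∀ k, Continuous (defectL (ε := ε) hε k)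
  | .shear => continuous_intUL hε
  | .news => by
    have h : Continuous (defectL (ε := ε) hε .shear ∘ duL ε) := (continuous_intUL hε).comp continuous_duL
    -- The minus sign is invisible to the seminorms.
    refine continuous_elec_rng
      (fun w α => elecGauge w (((intUL hε).comp (duL ε)) α))
      (fun w => (isGauge_elecGauge w).comp (L := (intUL hε).comp (duL ε)) h) fun w α R => ?_
    have h1 := norm_word_le_elecGauge w (intU hε (du α)) R
    have h2 : word w (-(intU hε (du α)) : Elec) R = -word w (intU hε (du α)) R :=
      congrFun (map_neg (elecT w) (intU hε (du α))) R
    change ‖word w (-(intU hε (du α)) : Elec) R‖ ≤ _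
    rw [h2, norm_neg]
    exact h1

/-- Brackets between fields of two given spin weights. -/
abbrev Blocks (ε : ℝ) : Type := (i j : Kind) → Bidist (FSpace ε i) (FSpace ε j)

/-- The pairing of a block with smearings. -/
def Blocks.pair (A : Blocks ε) (l : F1 ε) (α : F0 ε) (m : F1 ε) (β : F0 ε) : ℂ :=
  A .shear .shear l m + A .shear .news l β + A .news .shear α m + A .news .news α β

@[simp] theorem Blocks.pair_zero_left (A : Blocks ε) (m : F1 ε) (β : F0 ε) :
    A.pair 0 0 m β = 0 := by simp [Blocks.pair]

@[simp] theorem Blocks.pair_zero_right (A : Blocks ε) (l : F1 ε) (α : F0 ε) :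
    A.pair l α 0 0 = 0 := by simp [Blocks.pair]

/-- The real system of brackets with given brackets between fields of spin weight `-2`, and between
fields of spin weight `2` and `-2`. -/
def Brackets.ofBlocks (A P : Blocks ε) : Brackets ε
  | (i, false), (j, false) => A i j
  | (i, true), (j, true) => (A i j).conjugate
  | (i, true), (j, false) => P i j
  | (i, false), (j, true) => (P i j).conjugate

theorem Brackets.isReal_ofBlocks (A P : Blocks ε) : (Brackets.ofBlocks A P).IsReal := by
  rintro ⟨i, b⟩ ⟨j, c⟩ f g
  cases b <;> cases c
  · rfl
  · exact (Complex.conj_conj _).symm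
  · rfl
  · exact (Complex.conj_conj _).symm

theorem Brackets.isAntisymm_ofBlocks {A P : Blocks ε} (hA : ∀ i j f g, A i j f g = -A j i g f)
    (hP : ∀ i j f g, P i j f g = -conj (P j i g f)) : (Brackets.ofBlocks A P).IsAntisymm := by
  rintro ⟨i, b⟩ ⟨j, c⟩ f g
  cases b <;> cases c <;> simp only [Brackets.ofBlocks, Bidist.conjugate_apply]
  · exact hA i j f g
  · rw [hP i j f g, map_neg, Complex.conj_conj]
  · exact hP i j f g
  · rw [hA i j f g, map_neg]

/-- The brackets between fields of spin weight `-2`. -/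
def Brackets.low (B : Brackets ε) : Blocks ε := fun i j => B (i, false) (j, false)

/-- The brackets between fields of spin weight `2` and fields of spin weight `-2`. -/
def Brackets.mixed (B : Brackets ε) : Blocks ε := fun i j => B (i, true) (j, false)

/-- Conjugation exchanges the two spin weights, so these two blocks determine the other two. -/
theorem Brackets.IsReal.eq_ofBlocks {B : Brackets ε} (hB : B.IsReal) :
    B = Brackets.ofBlocks B.low B.mixed := by
  funext a b
  obtain ⟨i, b1⟩ := a
  obtain ⟨j, c⟩ := b
  refine Bidist.ext fun f g => ?_
  cases b1 <;> cases c
  · rfl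
  · exact hB (i, true) (j, false) f g
  · rfl
  · exact hB (i, false) (j, false) f g

theorem Kind.sum_eq (f : Kind → ℂ) : ∑ k, f k = f .shear + f .news :=
  Finset.sum_pair (by simp)

theorem Brackets.IsReal.pairing_eq {B : Brackets ε} (hB : B.IsReal) (s s' : Smearing ε) :
    B.pairing s s' = B.low.pair (s fσbar) (s fN) (s' fσbar) (s' fN) +
      conj (B.low.pair (s fσ) (s fNbar) (s' fσ) (s' fNbar)) +
      (B.mixed.pair (s fσ) (s fNbar) (s' fσbar) (s' fN) +
      conj (B.mixed.pair (s fσbar) (s fN) (s' fσ) (s' fNbar))) := by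
  rw [Brackets.pairing, hB.eq_ofBlocks]
  simp only [Fintype.sum_prod_type, Kind.sum_eq, Fintype.sum_bool, Brackets.ofBlocks,
    Bidist.conjugate_apply, Blocks.pair, map_add, Brackets.low, Brackets.mixed]
  ring

/-- A smearing of all fields, from its components. -/
def mkSmearing (l : F1 ε) (α : F0 ε) (l' : F1 ε) (α' : F0 ε) : Smearing ε
  | (.shear, false) => l
  | (.news, false) => α
  | (.shear, true) => l'
  | (.news, true) => α'

/-- The minimal directional brackets. -/
def dirBlocks (hε : 0 < ε) : Blocks ε
  | .shear, .shear => (-4 * Real.pi) • ((diracB hε).compRight continuous_primL).flip.conjugate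
  | .shear, .news => (4 * Real.pi) • diracB hε
  | .news, .shear => (-4 * Real.pi) • ((diracB hε).flip.conjugate +
      diracSB.comp continuous_limMinusL (continuous_intUL hε))
  | .news, .news => (4 * Real.pi) • (diracB hε).compLeft continuous_duL

theorem dirBlocks_shear_shear (hε : 0 < ε) (l m : F1 ε) :
    dirBlocks hε .shear .shear l m = -4 * Real.pi * diracH' l m := by
  simp [dirBlocks, diracH'_eq hε, dirac_conj]

theorem dirBlocks_shear_news (hε : 0 < ε) (l : F1 ε) (β : F0 ε) :
    dirBlocks hε .shear .news l β = 4 * Real.pi * dirac l β := by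
  simp [dirBlocks]

theorem dirBlocks_news_shear (hε : 0 < ε) (α : F0 ε) (m : F1 ε) :
    dirBlocks hε .news .shear α m =
      -4 * Real.pi * dirac α m - 4 * Real.pi * diracS (limMinus α) (intU hε m) := by
  simp [dirBlocks, dirac_conj]
  ring

theorem dirBlocks_news_news (hε : 0 < ε) (α β : F0 ε) :
    dirBlocks hε .news .news α β = -4 * Real.pi * Du dirac α β := by
  simp [dirBlocks, Du]

/-- Each term of `flow` yields one distribution: the primitive gives `H(u',u)`, the constant gives
`L₋(u)`, `∂α` gives `𝔇_u δ`, and the remaining terms give `δ`. -/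
theorem dirForm_eq (hε : 0 < ε) (l : F1 ε) (α : F0 ε) (m : F1 ε) (β : F0 ε) :
    dirForm l α m β = (dirBlocks hε).pair l α m β := by
  rw [Blocks.pair, dirBlocks_shear_shear, dirBlocks_shear_news, dirBlocks_news_shear,
    dirBlocks_news_news, dirForm, flow, dirac_smul_left, dirac_neg_left, dirac_smul_left,
    dirac_add_left hε (Or.inr rfl), dirac_add_left hε (Or.inr rfl), dirac_add_left hε (Or.inl rfl),
    constF0_dirac hε, diracH'_eq hε, Du]
  push_cast
  ring

theorem dualConstraint_zero : DualConstraint (0 : F1 ε) (0 : F0 ε) := fun R => by simp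

/-- Zero satisfies the dual constraint, so half of the smearings may be switched off; this isolates
the blocks. Conversely the two conditions give the complex identity, of which the one for real
observables is a special case. -/
theorem Brackets.reproducesDirectional_iff (hε : 0 < ε) {B : Brackets ε} (hB : B.IsReal) :
    B.ReproducesDirectional ↔ ∀ (l : F1 ε) (α : F0 ε) (m : F1 ε) (β : F0 ε), DualConstraint l α →
      B.low.pair l α m β = 0 ∧ B.mixed.pair l α m β = (dirBlocks hε).pair l α m β := by
  constructor
  · intro h l α m β hd
    -- Smearing only `σ̄, N` in both slots isolates `low`, where the bracket vanishes; smearing `σ,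
    -- N̄` in the first slot isolates `mixed`.
    have h1 := h.complex (mkSmearing l α 0 0) (mkSmearing m β 0 0) ⟨hd, dualConstraint_zero⟩
    have h2 := h.complex (mkSmearing 0 0 l α) (mkSmearing m β 0 0) ⟨dualConstraint_zero, hd⟩
    rw [directionalBracketC_eq hε ⟨hd, dualConstraint_zero⟩, hB.pairing_eq] at h1
    rw [directionalBracketC_eq hε ⟨dualConstraint_zero, hd⟩, hB.pairing_eq] at h2
    simp only [mkSmearing, dirForm_eq hε, Blocks.pair_zero_left, Blocks.pair_zero_right, map_zero,
      add_zero, zero_add] at h1 h2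
    exact ⟨h1.symm, h2.symm⟩
  · intro h
    have hc : ∀ s s' : Smearing ε, s.IsProper → directionalBracketC s s' = B.pairing s s' := by
      intro s s' hs
      rw [directionalBracketC_eq hε hs, hB.pairing_eq, (h _ _ _ _ hs.1).1, (h _ _ _ _ hs.2).1,
        (h _ _ _ _ hs.1).2, (h _ _ _ _ hs.2).2, dirForm_eq hε, dirForm_eq hε]
      simp
    refine ⟨hc, fun F G DF DG hF hG p hp => ?_⟩
    rw [directionalBracket_eq hε hF.toIsRegular hG (hF.dual p hp)]
    exact hc _ _ (isProper_realSmearing (hF.dual p hp))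

theorem Brackets.reproducesProper_iff (hε : 0 < ε) {B : Brackets ε} (hB : B.IsReal) :
    B.ReproducesProper ↔ ∀ (l : F1 ε) (α : F0 ε) (m : F1 ε) (β : F0 ε), DualConstraint l α →
      DualConstraint m β →
      B.low.pair l α m β = 0 ∧ B.mixed.pair l α m β = (dirBlocks hε).pair l α m β := by
  constructor
  · intro h l α m β hd hd'
    have p1 : (mkSmearing l α 0 0).IsProper := ⟨hd, dualConstraint_zero⟩
    have p2 : (mkSmearing 0 0 l α).IsProper := ⟨dualConstraint_zero, hd⟩
    have p3 : (mkSmearing m β 0 0).IsProper := ⟨hd', dualConstraint_zero⟩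
    have h1 := h.complex _ _ p1 p3
    have h2 := h.complex _ _ p2 p3
    rw [diracBracketC_eq hε p1 p3, directionalBracketC_eq hε p1, hB.pairing_eq] at h1
    rw [diracBracketC_eq hε p2 p3, directionalBracketC_eq hε p2, hB.pairing_eq] at h2
    simp only [mkSmearing, dirForm_eq hε, Blocks.pair_zero_left, Blocks.pair_zero_right, map_zero,
      add_zero, zero_add] at h1 h2
    exact ⟨h1.symm, h2.symm⟩
  · intro h
    have hc : ∀ s s' : Smearing ε, s.IsProper → s'.IsProper →
        diracBracketC s s' = B.pairing s s' := by
      intro s s' hs hs'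
      rw [diracBracketC_eq hε hs hs', directionalBracketC_eq hε hs, hB.pairing_eq,
        (h _ _ _ _ hs.1 hs'.1).1, (h _ _ _ _ hs.2 hs'.2).1, (h _ _ _ _ hs.1 hs'.2).2,
        (h _ _ _ _ hs.2 hs'.1).2, dirForm_eq hε, dirForm_eq hε]
      simp
    refine ⟨hc, fun F G DF DG hF hG p hp => ?_⟩
    rw [diracBracket_eq hε hF.toIsRegular hG.toIsRegular (hF.dual p hp) (hG.dual p hp)]
    exact hc _ _ (isProper_realSmearing (hF.dual p hp)) (isProper_realSmearing (hG.dual p hp))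

/-! ### Ambiguities -/

/-- A pair of bidistributions on `ℰ ⊗ ℱ₁` and `ℰ ⊗ ℱ₀`, as a family. -/
def ambPair (φ : Bidist Elec (F1 ε)) (φ' : Bidist Elec (F0 ε)) :
    (j : Kind) → Bidist Elec (FSpace ε j)
  | .shear => φ
  | .news => φ'

/-- The block `(f, g) ↦ χ (defect f, g)`. -/
def ambBlocks (hε : 0 < ε) (χ : (j : Kind) → Bidist Elec (FSpace ε j)) : Blocks ε :=
  fun i j => (χ j).compLeft (continuous_defectL hε i)

@[simp] theorem ambBlocks_apply (hε : 0 < ε) (χ : (j : Kind) → Bidist Elec (FSpace ε j))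
    (i j : Kind) (f : FSpace ε i) (g : FSpace ε j) :
    ambBlocks hε χ i j f g = χ j (defectL hε i f) g := rfl

theorem defect_section (hε : 0 < ε) (e : Elec) : defectL hε .shear (sectionL ε e) = e :=
  intU_sectionL hε e

theorem dualConstraint_iff_defect (hε : 0 < ε) (l : F1 ε) (α : F0 ε) :
    DualConstraint l α ↔ defectL hε .shear l + defectL hε .news α = 0 := by
  rw [dualConstraint_iff hε, defectL_shear, defectL_news, ← neg_sub (limPlus α),
    add_neg_eq_zero]

/-- By linearity the pairing sees only the total defect of `(l, α)`, which is zero. -/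
theorem Blocks.pair_ambBlocks (hε : 0 < ε) (χ : (j : Kind) → Bidist Elec (FSpace ε j))
    {l : F1 ε} {α : F0 ε} (hd : DualConstraint l α) (m : F1 ε) (β : F0 ε) :
    (ambBlocks hε χ).pair l α m β = 0 := by
  have h := (dualConstraint_iff_defect hε l α).1 hd
  have h1 : χ .shear (defectL hε .shear l + defectL hε .news α) m = 0 := by rw [h]; simp
  have h2 : χ .news (defectL hε .shear l + defectL hε .news α) β = 0 := by rw [h]; simp
  rw [Bidist.map_add_left] at h1 h2
  simp only [Blocks.pair, ambBlocks_apply]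
  linear_combination h1 + h2

/-- The proper smearing with the given component, up to an element of `ℱ₁`. -/
theorem dualConstraint_shear (hε : 0 < ε) (l : F1 ε) :
    DualConstraint (l - sectionL ε (defectL hε .shear l)) (0 : F0 ε) := by
  rw [dualConstraint_iff_defect hε, map_sub, defect_section, sub_self, map_zero, add_zero]

theorem dualConstraint_news (hε : 0 < ε) (α : F0 ε) :
    DualConstraint (-sectionL ε (defectL hε .news α)) α := by
  rw [dualConstraint_iff_defect hε, map_neg, defect_section, neg_add_cancel]

/-- Subtracting from `f` the section of its defect gives an element of `𝒢_TE`, on which `C`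
vanishes. Since the section has values in `ℱ₁`, only shear entries of `C` appear on the right. -/
theorem Blocks.eq_of_pair_left (hε : 0 < ε) {C : Blocks ε}
    (h : ∀ (l : F1 ε) (α : F0 ε) (m : F1 ε) (β : F0 ε), DualConstraint l α → C.pair l α m β = 0)
    (i j : Kind) (f : FSpace ε i) (g : FSpace ε j) :
    C i j f g = C .shear j (sectionL ε (defectL hε i f)) g := by
  cases i <;> cases j
  · have := h _ _ g 0 (dualConstraint_shear hε f)
    simp only [Blocks.pair, Bidist.map_sub_left, Bidist.map_zero_left, Bidist.map_zero_right] at this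
    linear_combination this
  · have := h _ _ 0 g (dualConstraint_shear hε f)
    simp only [Blocks.pair, Bidist.map_sub_left, Bidist.map_zero_left, Bidist.map_zero_right] at this
    linear_combination this
  · have := h _ _ g 0 (dualConstraint_news hε f)
    simp only [Blocks.pair, Bidist.map_neg_left, Bidist.map_zero_right] at this
    linear_combination this
  · have := h _ _ 0 g (dualConstraint_news hε f)
    simp only [Blocks.pair, Bidist.map_neg_left, Bidist.map_zero_right] at this
    linear_combination this

/-- Project both arguments to `𝒢_TE` along the section and expand bilinearly. -/
theorem Blocks.eq_of_pair (hε : 0 < ε) {C : Blocks ε}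
    (h : ∀ (l : F1 ε) (α : F0 ε) (m : F1 ε) (β : F0 ε), DualConstraint l α → DualConstraint m β →
      C.pair l α m β = 0) (i j : Kind) (f : FSpace ε i) (g : FSpace ε j) :
    C i j f g = C .shear j (sectionL ε (defectL hε i f)) g +
      C i .shear f (sectionL ε (defectL hε j g)) -
      C .shear .shear (sectionL ε (defectL hε i f)) (sectionL ε (defectL hε j g)) := by
  cases i <;> cases j
  · have := h _ _ _ _ (dualConstraint_shear hε f) (dualConstraint_shear hε g)
    simp only [Blocks.pair, Bidist.map_sub_left, Bidist.map_sub_right, Bidist.map_zero_left,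
      Bidist.map_zero_right] at this
    linear_combination this
  · have := h _ _ _ _ (dualConstraint_shear hε f) (dualConstraint_news hε g)
    simp only [Blocks.pair, Bidist.map_sub_left, Bidist.map_neg_right, Bidist.map_zero_left] at this
    linear_combination this
  · have := h _ _ _ _ (dualConstraint_news hε f) (dualConstraint_shear hε g)
    simp only [Blocks.pair, Bidist.map_neg_left, Bidist.map_sub_right, Bidist.map_zero_right] at this
    linear_combination this
  · have := h _ _ _ _ (dualConstraint_news hε f) (dualConstraint_news hε g)
    simp only [Blocks.pair, Bidist.map_neg_left, Bidist.map_neg_right] at this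
    linear_combination this

/-- The ambiguity of a directional block. -/
def dirAmb (C : Blocks ε) (j : Kind) : Bidist Elec (FSpace ε j) :=
  (C .shear j).compLeft continuous_sectionL

/-- The ambiguity of a (skew-)symmetric block. -/
def skewAmb (hε : 0 < ε) (C : Blocks ε) (j : Kind) : Bidist Elec (FSpace ε j) :=
  (C .shear j).compLeft continuous_sectionL - (1 / 2 : ℝ) •
    ((C .shear .shear).comp continuous_sectionL continuous_sectionL).compRight
      (continuous_defectL hε j)

theorem skewAmb_apply (hε : 0 < ε) (C : Blocks ε) (j : Kind) (e : Elec) (g : FSpace ε j) :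
    skewAmb hε C j e g = C .shear j (sectionL ε e) g -
      1 / 2 * C .shear .shear (sectionL ε e) (sectionL ε (defectL hε j g)) := by
  simp [skewAmb]

theorem Blocks.eq_ambBlocks_of_pair_left (hε : 0 < ε) {C : Blocks ε}
    (h : ∀ (l : F1 ε) (α : F0 ε) (m : F1 ε) (β : F0 ε), DualConstraint l α → C.pair l α m β = 0)
    (i j : Kind) (f : FSpace ε i) (g : FSpace ε j) :
    C i j f g = ambBlocks hε (dirAmb C) i j f g := C.eq_of_pair_left hε h i j f g

/-- Antisymmetry turns the second term of `Blocks.eq_of_pair` into the exchange of the first. The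
doubly projected term is shared equally, which is the reason for the `1/2` in `skewAmb`. -/
theorem Blocks.eq_ambBlocks_of_antisymm (hε : 0 < ε) {C : Blocks ε}
    (hC : ∀ i j f g, C i j f g = -C j i g f)
    (h : ∀ (l : F1 ε) (α : F0 ε) (m : F1 ε) (β : F0 ε), DualConstraint l α → DualConstraint m β →
      C.pair l α m β = 0) (i j : Kind) (f : FSpace ε i) (g : FSpace ε j) :
    C i j f g = ambBlocks hε (skewAmb hε C) i j f g - ambBlocks hε (skewAmb hε C) j i g f := by
  simp only [ambBlocks_apply, skewAmb_apply]
  rw [C.eq_of_pair hε h, hC i .shear,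
    hC .shear .shear (sectionL ε (defectL hε j g)) (sectionL ε (defectL hε i f))]
  ring

theorem Blocks.eq_ambBlocks_of_antihermitian (hε : 0 < ε) {C : Blocks ε}
    (hC : ∀ i j f g, C i j f g = -conj (C j i g f))
    (h : ∀ (l : F1 ε) (α : F0 ε) (m : F1 ε) (β : F0 ε), DualConstraint l α → DualConstraint m β →
      C.pair l α m β = 0) (i j : Kind) (f : FSpace ε i) (g : FSpace ε j) :
    C i j f g = ambBlocks hε (skewAmb hε C) i j f g -
      conj (ambBlocks hε (skewAmb hε C) j i g f) := by
  simp only [ambBlocks_apply, skewAmb_apply, map_sub, map_mul]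
  have h1 := hC .shear .shear (sectionL ε (defectL hε i f)) (sectionL ε (defectL hε j g))
  have h2 : conj (1 / 2 : ℂ) = 1 / 2 := by simp [map_ofNat]
  rw [C.eq_of_pair hε h, hC i .shear, h2]
  linear_combination (-1 / 2 : ℂ) * h1

/-! ### The minimal proper brackets -/

/-- The minimal proper brackets. -/
def minBlocks (hε : 0 < ε) : Blocks ε
  | .shear, .shear => (2 * Real.pi) • ((diracB hε).compRight continuous_primL -
      ((diracB hε).compRight continuous_primL).flip.conjugate)
  | .shear, .news => (4 * Real.pi) • diracB hε +
      (2 * Real.pi) • diracSB.comp (continuous_intUL hε) continuous_limMinusL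
  | .news, .shear => -((4 * Real.pi) • diracB hε +
      (2 * Real.pi) • diracSB.comp (continuous_intUL hε) continuous_limMinusL).flip.conjugate
  | .news, .news => (2 * Real.pi) • ((diracB hε).compLeft continuous_duL -
      ((diracB hε).compLeft continuous_duL).flip.conjugate)

theorem minBlocks_shear_shear (hε : 0 < ε) (l m : F1 ε) :
    minBlocks hε .shear .shear l m = 2 * Real.pi * (diracH l m - diracH' l m) := by
  simp [minBlocks, diracH'_eq hε, diracH_eq hε, dirac_conj]

theorem minBlocks_shear_news (hε : 0 < ε) (l : F1 ε) (β : F0 ε) :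
    minBlocks hε .shear .news l β =
      4 * Real.pi * dirac l β + 2 * Real.pi * diracS (intU hε l) (limMinus β) := by
  simp [minBlocks]

theorem minBlocks_news_shear (hε : 0 < ε) (α : F0 ε) (m : F1 ε) :
    minBlocks hε .news .shear α m =
      -(4 * Real.pi * dirac α m + 2 * Real.pi * diracS (limMinus α) (intU hε m)) := by
  simp [minBlocks, dirac_conj, diracS_conj, map_ofNat]

theorem minBlocks_news_news (hε : 0 < ε) (α β : F0 ε) :
    minBlocks hε .news .news α β = -4 * Real.pi * DuMinusDirac α β := by
  simp [minBlocks, DuMinusDirac, Du, Du', dirac_conj]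
  ring

theorem minBlocks_antihermitian (hε : 0 < ε) (i j : Kind) (f : FSpace ε i) (g : FSpace ε j) :
    minBlocks hε i j f g = -conj (minBlocks hε j i g f) := by
  cases i <;> cases j <;> simp [minBlocks, map_ofNat]
  all_goals ring

/-- Entry by entry the difference is `2π` times boundary data: `⟨∫l, ∫m⟩`, `⟨∫l, β₋⟩`, `⟨α₋, ∫m⟩`
and `⟨α₋, β₋⟩ - ⟨α₊, β₊⟩`. With `∫l = α₊ - α₋` and `∫m = β₊ - β₋` their sum is zero. -/
theorem minBlocks_pair (hε : 0 < ε) {l m : F1 ε} {α β : F0 ε} (hd : DualConstraint l α)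
    (hd' : DualConstraint m β) :
    (minBlocks hε).pair l α m β = (dirBlocks hε).pair l α m β := by
  rw [dualConstraint_iff hε] at hd hd'
  simp only [Blocks.pair, minBlocks_shear_shear, minBlocks_shear_news, minBlocks_news_shear,
    minBlocks_news_news, dirBlocks_shear_shear, dirBlocks_shear_news, dirBlocks_news_shear,
    dirBlocks_news_news, diracH_eq hε, diracH'_eq hε, DuMinusDirac, Du, Du']
  have h1 := dirac_du_right hε (prim l) (prim m)
  have h2 := dirac_du_right hε α β
  simp only [du_prim, limMinus_prim, limPlus_prim hε, diracS_zero_right, sub_zero] at h1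
  rw [h1, h2, hd, hd']
  simp only [diracS_sub_left, diracS_sub_right]
  ring

/-! ### General form of the brackets -/

theorem Brackets.isDirectionalForm_iff (hε : 0 < ε) (B : Brackets ε) (φ : Bidist Elec (F1 ε))
    (φ' : Bidist Elec (F0 ε)) (ψ : Bidist Elec (F1 ε)) (ψ' : Bidist Elec (F0 ε)) :
    B.IsDirectionalForm hε φ φ' ψ ψ' ↔
      (∀ i j f g, B.low i j f g = ambBlocks hε (ambPair φ φ') i j f g) ∧
      ∀ i j f g, B.mixed i j f g = dirBlocks hε i j f g + ambBlocks hε (ambPair ψ ψ') i j f g := by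
  constructor
  · intro h
    refine ⟨fun i j f g => ?_, fun i j f g => ?_⟩ <;> cases i <;> cases j <;>
      simp only [ambBlocks_apply, defectL_shear, defectL_news, dirBlocks_shear_shear,
        dirBlocks_shear_news, dirBlocks_news_shear, dirBlocks_news_news]
    · exact h.σbar_σbar f g
    · exact h.σbar_N f g
    · exact h.N_σbar f g
    · exact h.N_N f g
    · exact h.σ_σbar f g
    · exact h.σ_N f g
    · exact h.Nbar_σbar f g
    · exact h.Nbar_N f g
  · rintro ⟨h1, h2⟩
    have h1' := fun i j f g => (h1 i j f g).trans (ambBlocks_apply hε _ i j f g)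
    refine ⟨h1' .shear .shear, fun α l => ?_, h1' .shear .news, fun α β => ?_, fun l m => ?_,
      fun α m => ?_, fun l β => ?_, fun α β => ?_⟩
    · exact (h1' .news .shear α l).trans (by rw [defectL_news]; rfl)
    · exact (h1' .news .news α β).trans (by rw [defectL_news]; rfl)
    · exact (h2 .shear .shear l m).trans (by rw [dirBlocks_shear_shear]; rfl)
    · exact (h2 .news .shear α m).trans (by
        rw [dirBlocks_news_shear, ambBlocks_apply, defectL_news]; rfl)
    · exact (h2 .shear .news l β).trans (by rw [dirBlocks_shear_news]; rfl)
    · exact (h2 .news .news α β).trans (by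
        rw [dirBlocks_news_news, ambBlocks_apply, defectL_news]; rfl)

theorem Brackets.IsAntisymm.low_antisymm {B : Brackets ε} (ha : B.IsAntisymm) (i j : Kind)
    (f : FSpace ε i) (g : FSpace ε j) : B.low i j f g = -B.low j i g f :=
  ha (i, false) (j, false) f g

/-- Exchanging the arguments leaves the mixed block, and conjugation brings the result back into it.
-/
theorem Brackets.IsReal.mixed_antihermitian {B : Brackets ε} (hB : B.IsReal) (ha : B.IsAntisymm)
    (i j : Kind) (f : FSpace ε i) (g : FSpace ε j) :
    B.mixed i j f g = -conj (B.mixed j i g f) := by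
  have h1 := ha (i, true) (j, false) f g
  have h2 := hB (j, true) (i, false) g f
  change B (j, false) (i, true) g f = _ at h2
  exact h1.trans (congrArg Neg.neg h2)

/-- The general proper brackets between fields of spin weight `-2`. -/
def properLow (hε : 0 < ε) (χ : (j : Kind) → Bidist Elec (FSpace ε j)) : Blocks ε :=
  fun i j => ambBlocks hε χ i j - (ambBlocks hε χ j i).flip

/-- The general proper brackets between fields of spin weight `2` and `-2`. -/
def properMixed (hε : 0 < ε) (χ : (j : Kind) → Bidist Elec (FSpace ε j)) : Blocks ε :=
  fun i j => minBlocks hε i j + (ambBlocks hε χ i j - (ambBlocks hε χ j i).flip.conjugate)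

theorem properLow_apply (hε : 0 < ε) (χ : (j : Kind) → Bidist Elec (FSpace ε j)) (i j : Kind)
    (f : FSpace ε i) (g : FSpace ε j) : properLow hε χ i j f g =
      χ j (defectL hε i f) g - χ i (defectL hε j g) f := rfl

theorem properMixed_apply (hε : 0 < ε) (χ : (j : Kind) → Bidist Elec (FSpace ε j)) (i j : Kind)
    (f : FSpace ε i) (g : FSpace ε j) : properMixed hε χ i j f g =
      minBlocks hε i j f g + (χ j (defectL hε i f) g - conj (χ i (defectL hε j g) f)) := rfl

theorem properLow_antisymm (hε : 0 < ε) (χ : (j : Kind) → Bidist Elec (FSpace ε j)) (i j : Kind)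
    (f : FSpace ε i) (g : FSpace ε j) : properLow hε χ i j f g = -properLow hε χ j i g f := by
  simp only [properLow_apply, neg_sub]

theorem properMixed_antihermitian (hε : 0 < ε) (χ : (j : Kind) → Bidist Elec (FSpace ε j))
    (i j : Kind) (f : FSpace ε i) (g : FSpace ε j) :
    properMixed hε χ i j f g = -conj (properMixed hε χ j i g f) := by
  simp only [properMixed_apply, map_add, map_sub, Complex.conj_conj]
  rw [minBlocks_antihermitian]
  ring

theorem Brackets.isProperForm_iff (hε : 0 < ε) {B : Brackets ε} (hB : B.IsReal)
    (ha : B.IsAntisymm) (φ : Bidist Elec (F1 ε)) (φ' : Bidist Elec (F0 ε))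
    (ψ : Bidist Elec (F1 ε)) (ψ' : Bidist Elec (F0 ε)) :
    B.IsProperForm hε φ φ' ψ ψ' ↔
      (∀ i j f g, B.low i j f g = properLow hε (ambPair φ φ') i j f g) ∧
      ∀ i j f g, B.mixed i j f g = properMixed hε (ambPair ψ ψ') i j f g := by
  -- The defect of a news smearing is `α₋ - α₊`, while several displayed formulas use `α₊ - α₋`.
  have hneg : ∀ (χ : Bidist Elec (F1 ε)) (e e' : Elec) (m : F1 ε),
      χ (e - e') m = -χ (e' - e) m := fun χ e e' m => by rw [← Bidist.map_neg_left, neg_sub]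
  have hneg' : ∀ (χ : Bidist Elec (F0 ε)) (e e' : Elec) (m : F0 ε),
      χ (e - e') m = -χ (e' - e) m := fun χ e e' m => by rw [← Bidist.map_neg_left, neg_sub]
  have hl : ∀ (l : F1 ε) (α : F0 ε), properLow hε (ambPair φ φ') .shear .news l α =
      φ' (intU hε l) α + φ (limPlus α - limMinus α) l := fun l α => by
    rw [properLow_apply, defectL_shear, defectL_news]
    simp only [ambPair, hneg φ (limMinus α), sub_neg_eq_add]
  have hm : ∀ (l : F1 ε) (α : F0 ε), properMixed hε (ambPair ψ ψ') .shear .news l α =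
      4 * Real.pi * dirac l α + 2 * Real.pi * diracS (intU hε l) (limMinus α) +
      conj (ψ (limPlus α - limMinus α) l) + ψ' (intU hε l) α := fun l α => by
    rw [properMixed_apply, defectL_shear, defectL_news, minBlocks_shear_news]
    simp only [ambPair, hneg ψ (limMinus α), map_neg]
    ring
  have hn : ∀ α β : F0 ε, properLow hε (ambPair φ φ') .news .news α β =
      φ' (limPlus β - limMinus β) α - φ' (limPlus α - limMinus α) β := fun α β => by
    rw [properLow_apply, defectL_news, defectL_news]
    simp only [ambPair, hneg' φ' (limMinus α), hneg' φ' (limMinus β)]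
    ring
  constructor
  · intro h
    refine ⟨fun i j f g => ?_, fun i j f g => ?_⟩
    · cases i <;> cases j
      · exact h.σbar_σbar f g
      · exact (h.σbar_N f g).trans (hl f g).symm
      -- The proper form lists three entries per block; the fourth is the exchange of a listed one.
      · rw [Brackets.IsAntisymm.low_antisymm ha, properLow_antisymm]
        exact congrArg Neg.neg ((h.σbar_N g f).trans (hl g f).symm)
      · exact (h.N_N f g).trans (hn f g).symm
    · cases i <;> cases j
      · rw [properMixed_apply, minBlocks_shear_shear, ← add_sub_assoc]
        exact h.σ_σbar f g
      · exact (h.σ_N f g).trans (hm f g).symm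
      · rw [hB.mixed_antihermitian ha, properMixed_antihermitian]
        exact congrArg (fun z => -conj z) ((h.σ_N g f).trans (hm g f).symm)
      · rw [properMixed_apply, minBlocks_news_news, ← add_sub_assoc, defectL_news, defectL_news]
        exact h.Nbar_N f g
  · rintro ⟨h1, h2⟩
    refine ⟨h1 .shear .shear, fun l α => (h1 .shear .news l α).trans (hl l α),
      fun α β => (h1 .news .news α β).trans (hn α β), fun l m => ?_,
      fun l α => (h2 .shear .news l α).trans (hm l α), fun α β => ?_⟩
    · refine (h2 .shear .shear l m).trans ?_
      rw [properMixed_apply, minBlocks_shear_shear, ← add_sub_assoc]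
      rfl
    · refine (h2 .news .news α β).trans ?_
      rw [properMixed_apply, minBlocks_news_news, ← add_sub_assoc, defectL_news, defectL_news]
      rfl

/-! ### Classification of the solutions -/

theorem Blocks.pair_sub (A C : Blocks ε) (l : F1 ε) (α : F0 ε) (m : F1 ε) (β : F0 ε) :
    Blocks.pair (fun i j => A i j - C i j) l α m β = A.pair l α m β - C.pair l α m β := by
  simp only [Blocks.pair, Bidist.sub_apply]
  ring

theorem ambPair_eta (χ : (j : Kind) → Bidist Elec (FSpace ε j)) :
    ambPair (χ .shear) (χ .news) = χ := by
  funext j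
  cases j <;> rfl

theorem Brackets.reproducesDirectional_iff_form (hε : 0 < ε) {B : Brackets ε} (hB : B.IsReal) :
    B.ReproducesDirectional ↔ ∃ φ φ' ψ ψ', B.IsDirectionalForm hε φ φ' ψ ψ' := by
  simp only [B.isDirectionalForm_iff hε]
  rw [B.reproducesDirectional_iff hε hB]
  constructor
  · intro h
    -- Subtracting a particular solution makes the condition on the mixed block homogeneous.
    set C : Blocks ε := fun i j => B.mixed i j - dirBlocks hε i j with hC
    refine ⟨dirAmb B.low .shear, dirAmb B.low .news, dirAmb C .shear, dirAmb C .news, ?_, ?_⟩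
    · rw [ambPair_eta]
      exact Blocks.eq_ambBlocks_of_pair_left hε fun l α m β hd => (h l α m β hd).1
    · intro i j f g
      have h1 := Blocks.eq_ambBlocks_of_pair_left hε (C := C) (fun l α m β hd => by
        rw [hC, Blocks.pair_sub, (h l α m β hd).2, sub_self]) i j f g
      rw [ambPair_eta, ← h1]
      simp [hC]
  · rintro ⟨φ, φ', ψ, ψ', h1, h2⟩ l α m β hd
    have e1 := Blocks.pair_ambBlocks hε (ambPair φ φ') hd m β
    have e2 := Blocks.pair_ambBlocks hε (ambPair ψ ψ') hd m β
    simp only [Blocks.pair, h1, h2] at e1 e2 ⊢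
    exact ⟨e1, by linear_combination e2⟩

theorem Brackets.reproducesProper_iff_form (hε : 0 < ε) {B : Brackets ε} (ha : B.IsAntisymm)
    (hB : B.IsReal) : B.ReproducesProper ↔ ∃ φ φ' ψ ψ', B.IsProperForm hε φ φ' ψ ψ' := by
  simp only [Brackets.isProperForm_iff hε hB ha]
  rw [B.reproducesProper_iff hε hB]
  constructor
  · intro h
    -- Subtracting `minBlocks` rather than `dirBlocks` keeps the remainder antihermitian.
    set C : Blocks ε := fun i j => B.mixed i j - minBlocks hε i j with hC
    refine ⟨skewAmb hε B.low .shear, skewAmb hε B.low .news, skewAmb hε C .shear,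
      skewAmb hε C .news, ?_, ?_⟩
    · rw [ambPair_eta]
      exact Blocks.eq_ambBlocks_of_antisymm hε (Brackets.IsAntisymm.low_antisymm ha)
        fun l α m β hd hd' => (h l α m β hd hd').1
    · intro i j f g
      have h1 := Blocks.eq_ambBlocks_of_antihermitian hε (C := C) (fun i j f g => by
        simp only [hC, Bidist.sub_apply]
        rw [hB.mixed_antihermitian ha, minBlocks_antihermitian, map_sub]
        ring) (fun l α m β hd hd' => by
        rw [hC, Blocks.pair_sub, (h l α m β hd hd').2, minBlocks_pair hε hd hd', sub_self]) i j f g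
      rw [ambPair_eta, properMixed_apply]
      simp only [ambBlocks_apply] at h1
      rw [← h1]
      simp [hC]
  · rintro ⟨φ, φ', ψ, ψ', h1, h2⟩ l α m β hd hd'
    have e1 := Blocks.pair_ambBlocks hε (ambPair φ φ') hd m β
    have e1' := Blocks.pair_ambBlocks hε (ambPair φ φ') hd' l α
    have e2 := Blocks.pair_ambBlocks hε (ambPair ψ ψ') hd m β
    have e2' := congrArg conj (Blocks.pair_ambBlocks hε (ambPair ψ ψ') hd' l α)
    have e3 := minBlocks_pair hε hd hd'
    rw [← e3]
    simp only [Blocks.pair, h1, h2, properLow_apply, properMixed_apply, ambBlocks_apply, map_add,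
      map_zero] at e1 e1' e2 e2' ⊢
    exact ⟨by linear_combination e1 - e1', by linear_combination e2 - e2'⟩

theorem Brackets.eq_ofBlocks_of_blocks {B : Brackets ε} (hB : B.IsReal) {A P : Blocks ε}
    (hA : ∀ i j f g, B.low i j f g = A i j f g) (hP : ∀ i j f g, B.mixed i j f g = P i j f g) :
    B = Brackets.ofBlocks A P := by
  have h1 : B.low = A := funext fun i => funext fun j => Bidist.ext (hA i j)
  have h2 : B.mixed = P := funext fun i => funext fun j => Bidist.ext (hP i j)
  rw [← h1, ← h2]
  exact hB.eq_ofBlocks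

theorem Brackets.existsUnique_properForm (hε : 0 < ε) (φ : Bidist Elec (F1 ε))
    (φ' : Bidist Elec (F0 ε)) (ψ : Bidist Elec (F1 ε)) (ψ' : Bidist Elec (F0 ε)) :
    ∃! B : Brackets ε, B.IsAntisymm ∧ B.IsReal ∧ B.IsProperForm hε φ φ' ψ ψ' := by
  have hr := Brackets.isReal_ofBlocks (properLow hε (ambPair φ φ')) (properMixed hε (ambPair ψ ψ'))
  have ha := Brackets.isAntisymm_ofBlocks (properLow_antisymm hε (ambPair φ φ'))
    (properMixed_antihermitian hε (ambPair ψ ψ'))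
  refine ⟨_, ⟨ha, hr, (Brackets.isProperForm_iff hε hr ha _ _ _ _).2
    ⟨fun _ _ _ _ => rfl, fun _ _ _ _ => rfl⟩⟩, ?_⟩
  rintro B ⟨ha', hr', h⟩
  obtain ⟨h1, h2⟩ := (Brackets.isProperForm_iff hε hr' ha' _ _ _ _).1 h
  exact Brackets.eq_ofBlocks_of_blocks hr' h1 h2

theorem Brackets.existsUnique_directionalForm (hε : 0 < ε) (φ : Bidist Elec (F1 ε))
    (φ' : Bidist Elec (F0 ε)) (ψ : Bidist Elec (F1 ε)) (ψ' : Bidist Elec (F0 ε)) :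
    ∃! B : Brackets ε, B.IsReal ∧ B.IsDirectionalForm hε φ φ' ψ ψ' := by
  refine ⟨Brackets.ofBlocks (ambBlocks hε (ambPair φ φ'))
    (fun i j => dirBlocks hε i j + ambBlocks hε (ambPair ψ ψ') i j),
    ⟨Brackets.isReal_ofBlocks _ _, (Brackets.isDirectionalForm_iff hε _ _ _ _ _).2
      ⟨fun _ _ _ _ => rfl, fun _ _ _ _ => rfl⟩⟩, ?_⟩
  rintro B ⟨hr', h⟩
  obtain ⟨h1, h2⟩ := (Brackets.isDirectionalForm_iff hε _ _ _ _ _).1 h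
  exact Brackets.eq_ofBlocks_of_blocks hr' h1 h2

/-! ### Anomalies -/

theorem deriv_entries_rotE₁ (R : SO3) (i j : Fin 3) :
    HasDerivAt (fun t => entries (R * rotE₁ t) i j)
      (∑ k, entries R i k * (![![0, 0, 1], ![0, 0, 0], ![-1, 0, 0]] : Fin 3 → Fin 3 → ℝ) k j) 0 := by
  simp only [entries_mul]
  exact HasDerivAt.fun_sum fun k _ => (isCurve_rotE₁.2 k j).const_mul _

theorem deriv_entries_rotE₂ (R : SO3) (i j : Fin 3) :
    HasDerivAt (fun t => entries (R * rotE₂ t) i j)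
      (∑ k, entries R i k * (![![0, 0, 0], ![0, 0, 1], ![0, -1, 0]] : Fin 3 → Fin 3 → ℝ) k j) 0 := by
  simp only [entries_mul]
  exact HasDerivAt.fun_sum fun k _ => (isCurve_rotE₂.2 k j).const_mul _

/-- Take `ξ` to be the square of the first coordinate of `r̂`: it has an `ℓ = 2` part, which `ð²`
does not kill. At the identity frame `ð²ξ = 1`. -/
theorem exists_elec_ne_zero : ∃ e : Elec, e ≠ 0 := by
  set ξ : SO3 → ℂ := fun R => ((entries R 0 2 ^ 2 : ℝ) : ℂ) with hξ
  have hs : SphereSmooth ξ := ⟨fun x => ((x 0 2 ^ 2 : ℝ) : ℂ),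
    Complex.ofRealCLM.contDiff.comp ((contDiff_apply_apply ℝ ℝ 0 2).pow 2), fun R => rfl⟩
  have h0 : HasSpin 0 ξ := by
    intro R ψ
    simp [hξ, entries_mul, Fin.sum_univ_three]
    simp [entries, rotZ]
  have hm : eth (eth ξ) ∈ electricSub := ⟨ξ, hs, h0, fun R => by simp only [hξ, Complex.ofReal_im], rfl⟩
  refine ⟨⟨_, hm⟩, fun h => ?_⟩
  have h1 : eth (eth ξ) 1 = 0 := congrArg (fun e : Elec => e 1) h
  have hsq : ((Real.sqrt 2 : ℝ) : ℂ) * (Real.sqrt 2 : ℝ) = 2 := by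
    rw [← Complex.ofReal_mul, Real.mul_self_sqrt (by norm_num)]; norm_num
  have hne : ((Real.sqrt 2 : ℝ) : ℂ) ≠ 0 := Complex.ofReal_ne_zero.2 (by positivity)
  have e1 : eth ξ = fun R => ((1 / Real.sqrt 2 : ℝ) : ℂ) *
      (((2 * entries R 0 2 * entries R 0 0 : ℝ) : ℂ) -
        Complex.I * ((2 * entries R 0 2 * entries R 0 1 : ℝ) : ℂ)) := by
    funext R
    have d1 := ((deriv_entries_rotE₁ R 0 2).pow 2).ofReal_comp.deriv
    have d2 := ((deriv_entries_rotE₂ R 0 2).pow 2).ofReal_comp.deriv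
    have c1 : rotE₁ 0 = 1 := isCurve_rotE₁.1
    have c2 : rotE₂ 0 = 1 := isCurve_rotE₂.1
    simp only [Pi.pow_apply, c1, c2, mul_one, Fin.sum_univ_three] at d1 d2
    simp only [eth, alongCurve, hξ]
    rw [d1, d2]
    simp
  rw [e1] at h1
  have c1 : rotE₁ 0 = 1 := isCurve_rotE₁.1
  have c2 : rotE₂ 0 = 1 := isCurve_rotE₂.1
  have d1 : alongCurve rotE₁ (fun R => ((1 / Real.sqrt 2 : ℝ) : ℂ) *
      (((2 * entries R 0 2 * entries R 0 0 : ℝ) : ℂ) -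
        Complex.I * ((2 * entries R 0 2 * entries R 0 1 : ℝ) : ℂ))) 1 =
      ((1 / Real.sqrt 2 : ℝ) : ℂ) * 2 := by
    have a := ((deriv_entries_rotE₁ 1 0 2).const_mul 2).mul (deriv_entries_rotE₁ 1 0 0)
    have b := ((deriv_entries_rotE₁ 1 0 2).const_mul 2).mul (deriv_entries_rotE₁ 1 0 1)
    have c := ((a.ofReal_comp.sub (b.ofReal_comp.const_mul Complex.I)).const_mul
      ((1 / Real.sqrt 2 : ℝ) : ℂ)).deriv
    refine c.trans ?_
    simp [c1, Fin.sum_univ_three, entries]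
  have d2 : alongCurve rotE₂ (fun R => ((1 / Real.sqrt 2 : ℝ) : ℂ) *
      (((2 * entries R 0 2 * entries R 0 0 : ℝ) : ℂ) -
        Complex.I * ((2 * entries R 0 2 * entries R 0 1 : ℝ) : ℂ))) 1 = 0 := by
    have a := ((deriv_entries_rotE₂ 1 0 2).const_mul 2).mul (deriv_entries_rotE₂ 1 0 0)
    have b := ((deriv_entries_rotE₂ 1 0 2).const_mul 2).mul (deriv_entries_rotE₂ 1 0 1)
    have c := ((a.ofReal_comp.sub (b.ofReal_comp.const_mul Complex.I)).const_mul
      ((1 / Real.sqrt 2 : ℝ) : ℂ)).deriv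
    refine c.trans ?_
    simp [c2, Fin.sum_univ_three, entries]
  rw [eth, d1, d2] at h1
  simp at h1

theorem Du'_dirac (hε : 0 < ε) (α β : F0 ε) : Du' dirac α β = -Du dirac α β -
    diracS (limPlus α) (limPlus β) + diracS (limMinus α) (limMinus β) := by
  rw [Du', Du, dirac_du_right hε]
  ring

/-- For a step from `0` to `e ≠ 0` in both slots only the boundary term at `+∞` survives, and it is
the norm of `e` up to sign. -/
theorem exists_Du'_dirac_ne (hε : 0 < ε) : ∃ α β : F0 ε, Du' dirac α β ≠ -Du dirac α β := by
  obtain ⟨e, he⟩ := exists_elec_ne_zero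
  refine ⟨stepF0 ε e, stepF0 ε e, fun h => he (Elec.eq_zero_of_diracS ?_)⟩
  rw [Du'_dirac hε, limPlus_stepF0, limMinus_stepF0, diracS_zero_left, add_zero] at h
  have : diracS e e = 0 := by linear_combination -h
  rw [this, Complex.zero_re]

/-- `H` replaces `l` by its primitive, and integration by parts leaves a boundary term only at `+∞`,
where the primitive tends to the full integral. -/
theorem Du_diracH (hε : 0 < ε) (α : F0 ε) (l : F1 ε) :
    Du diracH α l = dirac α l - diracS (limPlus α) (intU hε l) := by
  have h := dirac_du_right hε α (prim l)
  rw [du_prim, limMinus_prim, limPlus_prim hε, diracS_zero_right] at h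
  rw [Du, diracH_eq hε, h]
  ring

end Scri

end

theorem mainTheorem9 (ε : ℝ) (hε : 0 < ε) :
    -- the general proper distributional brackets
    (∀ B : Scri.Brackets ε, B.IsAntisymm → B.IsReal →
      (B.ReproducesProper ↔
        ∃ (φ : Scri.Bidist Scri.Elec (Scri.F1 ε)) (φ' : Scri.Bidist Scri.Elec (Scri.F0 ε))
          (ψ : Scri.Bidist Scri.Elec (Scri.F1 ε)) (ψ' : Scri.Bidist Scri.Elec (Scri.F0 ε)),
          B.IsProperForm hε φ φ' ψ ψ')) ∧
    -- every value of the ambiguities occurs, for exactly one choice of the sixteen brackets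
    (∀ (φ : Scri.Bidist Scri.Elec (Scri.F1 ε)) (φ' : Scri.Bidist Scri.Elec (Scri.F0 ε))
        (ψ : Scri.Bidist Scri.Elec (Scri.F1 ε)) (ψ' : Scri.Bidist Scri.Elec (Scri.F0 ε)),
        ∃! B : Scri.Brackets ε, B.IsAntisymm ∧ B.IsReal ∧ B.IsProperForm hε φ φ' ψ ψ') ∧
    -- the minimal proper brackets
    (∃ B : Scri.Brackets ε, B.IsAntisymm ∧ B.IsReal ∧ B.ReproducesProper ∧
      (∀ l l' : Scri.F1 ε, B Scri.fσ Scri.fσbar l l' =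
        2 * Real.pi * (Scri.diracH l l' - Scri.diracH' l l')) ∧
      (∀ (l : Scri.F1 ε) (α : Scri.F0 ε), B Scri.fσ Scri.fN l α =
        4 * Real.pi * Scri.dirac l α +
          2 * Real.pi * Scri.diracS (Scri.intU hε l) (Scri.limMinus α)) ∧
      (∀ α α' : Scri.F0 ε, B Scri.fNbar Scri.fN α α' =
        -4 * Real.pi * Scri.DuMinusDirac α α') ∧
      (∀ l l' : Scri.F1 ε, B Scri.fσ Scri.fσ l l' = 0) ∧
      (∀ (l : Scri.F1 ε) (α : Scri.F0 ε), B Scri.fσ Scri.fNbar l α = 0) ∧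
      (∀ α α' : Scri.F0 ε, B Scri.fNbar Scri.fNbar α α' = 0)) ∧
    -- the general directional distributional brackets
    (∀ B : Scri.Brackets ε, B.IsReal →
      (B.ReproducesDirectional ↔
        ∃ (φ : Scri.Bidist Scri.Elec (Scri.F1 ε)) (φ' : Scri.Bidist Scri.Elec (Scri.F0 ε))
          (ψ : Scri.Bidist Scri.Elec (Scri.F1 ε)) (ψ' : Scri.Bidist Scri.Elec (Scri.F0 ε)),
          B.IsDirectionalForm hε φ φ' ψ ψ')) ∧
    (∀ (φ : Scri.Bidist Scri.Elec (Scri.F1 ε)) (φ' : Scri.Bidist Scri.Elec (Scri.F0 ε))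
        (ψ : Scri.Bidist Scri.Elec (Scri.F1 ε)) (ψ' : Scri.Bidist Scri.Elec (Scri.F0 ε)),
        ∃! B : Scri.Brackets ε, B.IsReal ∧ B.IsDirectionalForm hε φ φ' ψ ψ') ∧
    -- the minimal directional brackets
    (∃ B : Scri.Brackets ε, B.IsReal ∧ B.ReproducesDirectional ∧
      (∀ l l' : Scri.F1 ε, B Scri.fσ Scri.fσbar l l' = -4 * Real.pi * Scri.diracH' l l') ∧
      (∀ (α : Scri.F0 ε) (l' : Scri.F1 ε), B Scri.fNbar Scri.fσbar α l' =
        -4 * Real.pi * Scri.dirac α l' -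
          4 * Real.pi * Scri.diracS (Scri.limMinus α) (Scri.intU hε l')) ∧
      (∀ (l : Scri.F1 ε) (α' : Scri.F0 ε), B Scri.fσ Scri.fN l α' =
        4 * Real.pi * Scri.dirac l α') ∧
      (∀ α α' : Scri.F0 ε, B Scri.fNbar Scri.fN α α' =
        -4 * Real.pi * Scri.Du Scri.dirac α α') ∧
      (∀ l l' : Scri.F1 ε, B Scri.fσbar Scri.fσbar l l' = 0) ∧
      (∀ (l : Scri.F1 ε) (α' : Scri.F0 ε), B Scri.fσbar Scri.fN l α' = 0) ∧
      (∀ (α : Scri.F0 ε) (l' : Scri.F1 ε), B Scri.fN Scri.fσbar α l' = 0) ∧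
      (∀ α α' : Scri.F0 ε, B Scri.fN Scri.fN α α' = 0)) ∧
    -- the anomalies of the derivatives of `δ` and `H`
    (∀ α α' : Scri.F0 ε, Scri.Du' Scri.dirac α α' = -Scri.Du Scri.dirac α α' -
      Scri.diracS (Scri.limPlus α) (Scri.limPlus α') +
      Scri.diracS (Scri.limMinus α) (Scri.limMinus α')) ∧
    (∃ α α' : Scri.F0 ε, Scri.Du' Scri.dirac α α' ≠ -Scri.Du Scri.dirac α α') ∧
    (∀ (α : Scri.F0 ε) (l : Scri.F1 ε), Scri.Du Scri.diracH α l =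
      Scri.dirac α l - Scri.diracS (Scri.limPlus α) (Scri.intU hε l)) := by
  refine ⟨fun B ha hB => Scri.Brackets.reproducesProper_iff_form hε ha hB,
    Scri.Brackets.existsUnique_properForm hε, ?_,
    fun B hB => Scri.Brackets.reproducesDirectional_iff_form hε hB,
    Scri.Brackets.existsUnique_directionalForm hε, ?_, Scri.Du'_dirac hε,
    Scri.exists_Du'_dirac_ne hε, Scri.Du_diracH hε⟩
  -- The minimal system is the one with all ambiguities zero; `hr` transfers the vanishing of the
  -- `σ̄, N` brackets to those of `σ, N̄`.
  · obtain ⟨B, ⟨ha, hB, h⟩, -⟩ := Scri.Brackets.existsUnique_properForm hε 0 0 0 0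
    have hr : ∀ a b f g, B a b f g = (starRingEnd ℂ) (B (Scri.Field.bar a) (Scri.Field.bar b) f g) :=
      fun a b f g => by rw [hB, Complex.conj_conj]
    refine ⟨B, ha, hB, (Scri.Brackets.reproducesProper_iff_form hε ha hB).2 ⟨0, 0, 0, 0, h⟩,
      fun l l' => ?_, fun l α => ?_, fun α α' => ?_, fun l l' => ?_, fun l α => ?_,
      fun α α' => ?_⟩
    · rw [h.σ_σbar]; simp
    · rw [h.σ_N]; simp
    · rw [h.Nbar_N]; simp
    · exact (hr Scri.fσ Scri.fσ l l').trans (by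
        rw [← map_zero (starRingEnd ℂ)]; exact congrArg _ ((h.σbar_σbar l l').trans (by simp)))
    · exact (hr Scri.fσ Scri.fNbar l α).trans (by
        rw [← map_zero (starRingEnd ℂ)]; exact congrArg _ ((h.σbar_N l α).trans (by simp)))
    · exact (hr Scri.fNbar Scri.fNbar α α').trans (by
        rw [← map_zero (starRingEnd ℂ)]; exact congrArg _ ((h.N_N α α').trans (by simp)))
  · obtain ⟨B, ⟨hB, h⟩, -⟩ := Scri.Brackets.existsUnique_directionalForm hε 0 0 0 0
    refine ⟨B, hB, (Scri.Brackets.reproducesDirectional_iff_form hε hB).2 ⟨0, 0, 0, 0, h⟩,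
      fun l l' => ?_, fun α l' => ?_, fun l α' => ?_, fun α α' => ?_, fun l l' => ?_,
      fun l α' => ?_, fun α l' => ?_, fun α α' => ?_⟩
    · rw [h.σ_σbar]; simp
    · rw [h.Nbar_σbar]; simp
    · rw [h.σ_N]; simp
    · rw [h.Nbar_N]; simp
    · rw [h.σbar_σbar]; simp
    · rw [h.σbar_N]; simp
    · rw [h.N_σbar]; simp
    · rw [h.N_N]; simp
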